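/- A \emph{map} is a rooted planar map with at least one edge: a proper embedding of a connected finite planar multigraph (loops and multiple edges allowed) into the oriented sphere, considered up to orientation-preserving homeomorphism, with a distinguished half-edge (oriented edge), the root. The degree of a face is the number of corners incident to it. A map is \emph{loopless} if it has no loop, and \emph{simple} if it is loopless and no two distinct edges have the same endpoints. It is \emph{separable} if its edge set can be partitioned into two non-empty sets $E_1,E_2$ such that exactly one vertex is incident both to a member of $E_1$ and to a member of $E_2$, and \emph{$2$-connected} otherwise. Let $L$ be a finite set of positive integers and $\mathbf{x}^\circ=(x^\circ_\ell)_{\ell\in L}$ a family of variables. For a family $\mathcal F$ of maps put \[F(z;\mathbf{x}^\circ)=\sum_{\mathfrak m\in\mathcal F} z^{e(\mathfrak m)}\prod_{\ell\in L}(x^\circ_\ell)^{f_\ell(\mathfrak m)},\] where $e(\mathfrak m)$ is the number of edges of $\mathfrak m$ and $f_\ell(\mathfrak m)$ is the number of all faces of degree $\ell$ of $\mathfrak m$, root face included. Let $M_{2l}$, $M_3$, $M_4$, $M_5$ be the series obtained in this way from the loopless maps, the simple maps, the $2$-connected maps other than the map consisting of a single loop, and the $2$-connected simple maps, respectively. Proposition.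 For every finite set $L$ of positive integers, the following identities of formal power series in $z$ with coefficients in $\mathbb Z[\mathbf{x}^\circ]$ hold: \[M_{2l}(z;\mathbf{x}^\circ)=M_3\bigl(z\,(1+M_{2l}(z;\mathbf{x}^\circ));\mathbf{x}^\circ\bigr),\qquad M_4(z;\mathbf{x}^\circ)=M_5\bigl(z\,(1+M_4(z;\mathbf{x}^\circ));\mathbf{x}^\circ\bigr).\] -/

import Mathlib

/-- The orbits (cycles, fixed points included) of a permutation. -/
abbrev PermOrbit {D : Type} (f : Equiv.Perm D) : Type :=
  Quotient (Equiv.Perm.SameCycle.setoid f)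

/-- A rooted planar map with at least one edge, presented as a rotation system on its set `D` of
half-edges.  A half-edge is an edge together with one of its two orientations; it starts at its
origin vertex.

* `next d` is the half-edge that follows `d` in anticlockwise order around the origin of `d`;
* `opp d` is the same edge with the opposite orientation;
* `root` is the distinguished half-edge.

The vertices, edges and faces are the orbits of `next`, `opp` and `next⁻¹ * opp`: if `d` is a
half-edge with a given face on its left, then `next⁻¹ (opp d)` is the following half-edge along
the boundary of that face.  The underlying surface is the sphere exactly when Euler's relation
`V + F = E + 2` holds.  There is no such structure on the empty type, so that the map reduced to a
single vertex is left out. -/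
structure RootedPlanarMap (D : Type) where
  finite : Finite D
  next : Equiv.Perm D
  opp : Equiv.Perm D
  root : D
  opp_opp : ∀ d, opp (opp d) = d
  opp_ne : ∀ d, opp d ≠ d
  connected : MulAction.IsPretransitive (Subgroup.closure {next, opp}) D
  planar : Nat.card (PermOrbit next) + Nat.card (PermOrbit (next⁻¹ * opp))
    = Nat.card (PermOrbit opp) + 2

namespace RootedPlanarMap

variable {D D' : Type}

/-- The permutation whose orbits are the faces; a half-edge belongs to the face on its left. -/
def facePerm (m : RootedPlanarMap D) : Equiv.Perm D := m.next⁻¹ * m.opp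

abbrev Vertex (m : RootedPlanarMap D) : Type := PermOrbit m.next

abbrev Edge (m : RootedPlanarMap D) : Type := PermOrbit m.opp

abbrev Face (m : RootedPlanarMap D) : Type := PermOrbit m.facePerm

/-- The origin of a half-edge. -/
def vertexOf (m : RootedPlanarMap D) (d : D) : m.Vertex := Quotient.mk _ d

/-- The edge that carries a half-edge. -/
def edgeOf (m : RootedPlanarMap D) (d : D) : m.Edge := Quotient.mk _ d

/-- The face on the left of a half-edge. -/
def faceOf (m : RootedPlanarMap D) (d : D) : m.Face := Quotient.mk _ d

/-- The degree of a face: the number of its corners, equivalently the number of half-edges that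
have the face on their left. -/
noncomputable def faceDegree (m : RootedPlanarMap D) (f : m.Face) : ℕ :=
  Nat.card {d : D // m.faceOf d = f}

/-- The number of faces of degree `l`, the root face being counted like every other face. -/
noncomputable def numFaces (m : RootedPlanarMap D) (l : ℕ) : ℕ :=
  Nat.card {f : m.Face // m.faceDegree f = l}

/-- No edge joins a vertex to itself. -/
def Loopless (m : RootedPlanarMap D) : Prop :=
  ∀ d, m.vertexOf d ≠ m.vertexOf (m.opp d)

/-- No loops, and no two distinct edges with the same endpoints. -/
def Simple (m : RootedPlanarMap D) : Prop :=
  m.Loopless ∧ ∀ d e, m.vertexOf d = m.vertexOf e →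
    m.vertexOf (m.opp d) = m.vertexOf (m.opp e) → m.edgeOf d = m.edgeOf e

/-- The vertex `v` is an endpoint of the edge `e`. -/
def Incident (m : RootedPlanarMap D) (v : m.Vertex) (e : m.Edge) : Prop :=
  ∃ d, m.vertexOf d = v ∧ m.edgeOf d = e

/-- The edges can be partitioned into two nonempty sets such that exactly one vertex is incident
to members of both. -/
def Separable (m : RootedPlanarMap D) : Prop :=
  ∃ E₁ E₂ : Set m.Edge, E₁.Nonempty ∧ E₂.Nonempty ∧ Disjoint E₁ E₂ ∧ E₁ ∪ E₂ = Set.univ ∧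
    ∃! v : m.Vertex, (∃ e ∈ E₁, m.Incident v e) ∧ (∃ e ∈ E₂, m.Incident v e)

def TwoConnected (m : RootedPlanarMap D) : Prop := ¬ m.Separable

/-- Isomorphism of rooted maps: a relabelling of the half-edges that respects the rotation, the
edges and the root. -/
def Iso (m : RootedPlanarMap D) (m' : RootedPlanarMap D') : Prop :=
  ∃ e : D ≃ D', (∀ d, e (m.next d) = m'.next (e d)) ∧ (∀ d, e (m.opp d) = m'.opp (e d)) ∧
    e m.root = m'.root

theorem Iso.numFaces_eq {m : RootedPlanarMap D} {m' : RootedPlanarMap D'} (h : Iso m m') (l : ℕ) :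
    m.numFaces l = m'.numFaces l := by
  obtain ⟨e, hn, ho, -⟩ := h
  have hf : ∀ d, e (m.facePerm d) = m'.facePerm (e d) := by
    intro d
    apply m'.next.injective
    rw [← hn]
    simp [facePerm, ho]
  have hconj : m'.facePerm = e.permCongr m.facePerm := by
    ext d
    simp [Equiv.permCongr_apply, hf]
  have hz : ∀ (k : ℤ) (d : D), e ((m.facePerm ^ k) d) = (m'.facePerm ^ k) (e d) := by
    intro k d
    have h1 : m'.facePerm ^ k = e.permCongr (m.facePerm ^ k) := by
      rw [hconj]
      exact (map_zpow e.permCongrHom m.facePerm k).symm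
    simp [h1, Equiv.permCongr_apply]
  have hs : ∀ a b : D, m.facePerm.SameCycle a b ↔ m'.facePerm.SameCycle (e a) (e b) := by
    intro a b
    constructor
    · rintro ⟨k, rfl⟩
      exact ⟨k, (hz k a).symm⟩
    · rintro ⟨k, hk⟩
      exact ⟨k, e.injective (by rw [hz, hk])⟩
  let E : m.Face ≃ m'.Face := Quotient.congr e hs
  have hE : ∀ d, E (m.faceOf d) = m'.faceOf (e d) := fun d => rfl
  have hd : ∀ f, m.faceDegree f = m'.faceDegree (E f) := by
    intro f
    refine Nat.card_congr (e.subtypeEquiv fun d => ?_)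
    rw [← hE, E.apply_eq_iff_eq]
  exact Nat.card_congr (E.subtypeEquiv fun f => by rw [hd])

/-- Two rooted maps on the same set of half-edge labels are identified when they are isomorphic. -/
def isoSetoid (D : Type) : Setoid (RootedPlanarMap D) where
  r m m' := Iso m m'
  iseqv :=
    { refl := fun _ => ⟨Equiv.refl _, fun _ => rfl, fun _ => rfl, rfl⟩
      symm := by
        rintro m m' ⟨e, h1, h2, h3⟩
        refine ⟨e.symm, fun d => ?_, fun d => ?_, ?_⟩
        · rw [Equiv.symm_apply_eq, h1, Equiv.apply_symm_apply]
        · rw [Equiv.symm_apply_eq, h2, Equiv.apply_symm_apply]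
        · rw [Equiv.symm_apply_eq, h3]
      trans := by
        rintro m m' m'' ⟨e, h1, h2, h3⟩ ⟨e', h1', h2', h3'⟩
        refine ⟨e.trans e', fun d => ?_, fun d => ?_, ?_⟩
        · simp [h1, h1']
        · simp [h2, h2']
        · simp [h3, h3'] }

theorem finite_of_finite (D : Type) [Finite D] : Finite (RootedPlanarMap D) := by
  refine Finite.of_injective
    (fun m : RootedPlanarMap D => ((m.next, m.opp, m.root) : Equiv.Perm D × Equiv.Perm D × D)) ?_
  rintro ⟨_, a, b, c, _, _, _, _⟩ ⟨_, a', b', c', _, _, _, _⟩ h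
  simp only [Prod.mk.injEq] at h
  obtain ⟨rfl, rfl, rfl⟩ := h
  rfl

/-- A family of rooted planar maps. -/
abbrev Family : Type 1 := ∀ D : Type, RootedPlanarMap D → Prop

/-- The rooted planar maps with `n` edges (that is, `2 * n` half-edges) that belong to the family
`P`, up to isomorphism. -/
def IsoClass (P : Family) (n : ℕ) : Type :=
  Quotient (Setoid.comap (Subtype.val : {m : RootedPlanarMap (Fin (2 * n)) // P _ m} → _)
    (isoSetoid (Fin (2 * n))))

instance (P : Family) (n : ℕ) : Finite (IsoClass P n) := by
  have := finite_of_finite (Fin (2 * n))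
  unfold IsoClass
  infer_instance

noncomputable instance (P : Family) (n : ℕ) : Fintype (IsoClass P n) := Fintype.ofFinite _

/-- The number of faces of degree `l` (root face included) of an isomorphism class. -/
noncomputable def IsoClass.numFaces {P : Family} {n : ℕ} (c : IsoClass P n) (l : ℕ) : ℕ :=
  Quotient.lift (fun m : {m : RootedPlanarMap (Fin (2 * n)) // P _ m} => m.1.numFaces l)
    (fun _ _ h => Iso.numFaces_eq h l) c

/-- The generating series of the family `P`: a power series in `z`, which marks the number of
edges, whose coefficients are polynomials in the variables `x_l`, `l ∈ L`, and `x_l` marks the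
number of faces of degree `l`, root face included. -/
noncomputable def faceSeries (P : Family) (L : Finset ℕ) : PowerSeries (MvPolynomial L ℤ) :=
  PowerSeries.mk fun n => ∑ c : IsoClass P n, ∏ l : L, MvPolynomial.X l ^ c.numFaces l

/-- Loopless maps. -/
noncomputable def seriesM2l (L : Finset ℕ) : PowerSeries (MvPolynomial L ℤ) :=
  faceSeries (fun _ m => m.Loopless) L

/-- Simple maps. -/
noncomputable def seriesM3 (L : Finset ℕ) : PowerSeries (MvPolynomial L ℤ) :=
  faceSeries (fun _ m => m.Simple) L

/-- 2-connected maps, without the map that consists of a single loop (a loop is never an edge of a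
2-connected map with at least two edges). -/
noncomputable def seriesM4 (L : Finset ℕ) : PowerSeries (MvPolynomial L ℤ) :=
  faceSeries (fun _ m => m.TwoConnected ∧ m.Loopless) L

/-- 2-connected simple maps. -/
noncomputable def seriesM5 (L : Finset ℕ) : PowerSeries (MvPolynomial L ℤ) :=
  faceSeries (fun _ m => m.TwoConnected ∧ m.Simple) L

end RootedPlanarMap

/-! A map is handled as a rotation system: permutations `next` and `opp` of the half-edges, with
faces the cycles of `next⁻¹ * opp`. To insert a map in an edge of a core, the core edge and the root
edge of the inserted map are both opened and their halves rejoined crosswise, which amounts to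
multiplying `next` and `opp` on the left by the same involution. That involution cancels in `next⁻¹
* opp`, so the faces of the result are exactly the faces of the two pieces (`Gluing.face_eq`), and
the half-edges are those of the two pieces. An edge of the core is therefore either kept or replaced
by itself together with a whole map. On series this is the substitution of `z (1 + M)` for `z`, with
face weights multiplying.

It remains to see that every loopless planar map arises exactly once from a simple core with
loopless maps inserted in some edges. The core is recovered intrinsically. Let `nextParallel` turn
around a vertex to the next half-edge with the same two ends, and let `cutOpp` be `opp` after
`nextParallel`. In a glued map `cutOpp` restricts to the involution of the core, and the core is
what the root reaches under `face` and `cutOpp` (`Decoration.core_glue`). An isomorphism of glued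
maps thus preserves cores and inserted maps, and since rooted maps have no automorphisms, the
insertion is injective.

Conversely, in any loopless planar map two parallel edges form a closed curve that separates the
sphere (`Bigon.b_notMem_side`). The combinatorial source is the inequality V - E + F ≤ 2 for
connected rotation systems, obtained from `genus_inequality`: cutting along the curve adds two
vertices and changes neither the number of edges nor the faces, which a connected map does not
allow. Separation shows that `cutOpp` is an involution, that the core is simple, and that the parts
of the map enclosed by its consecutive parallel edges are disjoint and fill the rest
(`CoreOrientation.isIso_glue`).

For the second identity, the same bijection restricts to 2-connected maps: a glued map is
2-connected exactly when its core and all inserted maps are. The structure `Insertable` isolates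
what the two cases share. -/

section

open Equiv

/-! ### Cycle counts under transpositions, and the genus inequality. -/

namespace PermCycles

variable {D : Type}

/-- The number of cycles of a permutation, fixed points included. -/
noncomputable def numCycles (f : Perm D) : ℕ := Nat.card (PermOrbit f)

theorem numCycles_inv (f : Perm D) : numCycles f⁻¹ = numCycles f :=
  Nat.card_congr (Quotient.congr (Equiv.refl D) fun _ _ => Perm.sameCycle_inv)

variable [Finite D]

/-- On a finite set a cycle is swept out by nonnegative powers, so an equivalence relation need only
be tested on one step of `f`. -/
theorem sameCycle_le {f : Perm D} {r : Setoid D} (h : ∀ x, r x (f x)) {x y : D}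
    (hxy : f.SameCycle x y) : r x y := by
  obtain ⟨n, rfl⟩ := hxy.exists_nat_pow_eq
  induction n with
  | zero => exact r.refl x
  | succ n ih =>
    rw [pow_succ', Perm.mul_apply]
    exact r.trans (ih ⟨n, by simp⟩) (h _)

theorem mem_of_sameCycle {f : Perm D} {S : Set D} (h : ∀ x ∈ S, f x ∈ S) {x y : D}
    (hxy : f.SameCycle x y) (hx : x ∈ S) : y ∈ S := by
  obtain ⟨n, rfl⟩ := hxy.exists_nat_pow_eq
  clear hxy
  induction n with
  | zero => exact hx
  | succ n ih =>
    rw [pow_succ', Perm.mul_apply]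
    exact h _ ih

theorem eq_of_sameCycle {α : Type*} {f : Perm D} {g : D → α} (h : ∀ x, g (f x) = g x) {x y : D}
    (hxy : f.SameCycle x y) : g x = g y :=
  sameCycle_le (r := Setoid.ker g) (fun x => (h x).symm) hxy

theorem apply_mem_iff {f : Perm D} {S : Set D} (h : ∀ x ∈ S, f x ∈ S) (x : D) :
    f x ∈ S ↔ x ∈ S :=
  ⟨fun hx => mem_of_sameCycle h ⟨-1, by simp⟩ hx, h x⟩

theorem exists_min_pow {f : Perm D} {x y : D} (h : f.SameCycle x y) :
    ∃ n, (f ^ n) x = y ∧ ∀ i < n, (f ^ i) x ≠ y := by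
  classical
  have h' := h.exists_nat_pow_eq
  exact ⟨Nat.find h', Nat.find_spec h', fun i hi => Nat.find_min h' hi⟩

/-- Number of classes of a setoid when two classes are merged at most. -/
theorem card_quotient_le_succ {r r' : Setoid D} {x y : D}
    (h : ∀ α : Type, ∀ g : D → α, (∀ z w, r z w → g z = g w) → g x = g y →
      ∀ z w, r' z w → g z = g w) :
    Nat.card (Quotient r) ≤ Nat.card (Quotient r') + 1 := by
  classical
  -- The quotient map of `r` with the class of `x` collapsed onto that of `y`; by hypothesis it
  -- factors through `r'`.
  let g : D → Quotient r := fun z => if r z x then ⟦y⟧ else ⟦z⟧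
  have hg : ∀ z w, r' z w → g z = g w := by
    refine h _ g ?_ ?_
    · intro z w hzw
      by_cases hz : r z x
      · have hw : r w x := r.trans (r.symm hzw) hz
        simp [g, hz, hw]
      · have hw : ¬ r w x := fun hw => hz (r.trans hzw hw)
        simp only [g, hz, hw, if_false]
        exact Quotient.sound hzw
    · by_cases hy : r y x <;> simp [g]
  -- Away from the class of `x`, `g` still separates the `r`-classes; that one class is sent to
  -- `none`.
  let F : Quotient r → Option (Quotient r') := fun q => if q = ⟦x⟧ then none else some ⟦q.out⟧
  have hF : Function.Injective F := by
    intro p q hpq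
    by_cases hp : p = ⟦x⟧ <;> by_cases hq : q = ⟦x⟧
    · rw [hp, hq]
    · simp [F, hp, hq] at hpq
    · simp [F, hp, hq] at hpq
    · simp only [F, hp, hq, if_false, Option.some.injEq] at hpq
      have h1 := hg _ _ (Quotient.exact hpq)
      have hp' : ¬ r p.out x := fun h => hp (by rw [← p.out_eq]; exact Quotient.sound h)
      have hq' : ¬ r q.out x := fun h => hq (by rw [← q.out_eq]; exact Quotient.sound h)
      simpa [g, hp', hq'] using h1
  have := Nat.card_le_card_of_injective F hF
  rwa [Finite.card_option] at this

theorem card_quotient_le {r r' : Setoid D} (h : ∀ x y, r x y → r' x y) :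
    Nat.card (Quotient r') ≤ Nat.card (Quotient r) :=
  Nat.card_le_card_of_surjective (Quotient.map' id h : Quotient r → Quotient r')
    (fun q => Quotient.inductionOn' q fun a => ⟨Quotient.mk _ a, rfl⟩)

theorem card_quotient_lt {r r' : Setoid D} (h : ∀ x y, r x y → r' x y) {x y : D} (h1 : r' x y)
    (h2 : ¬ r x y) : Nat.card (Quotient r') < Nat.card (Quotient r) := by
  refine lt_of_le_of_ne (card_quotient_le h) fun he => h2 ?_
  have hs : Function.Surjective (Quotient.map' id h : Quotient r → Quotient r') :=
    fun q => Quotient.inductionOn' q fun a => ⟨Quotient.mk _ a, rfl⟩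
  have hi := ((Nat.bijective_iff_surjective_and_card _).2 ⟨hs, he.symm⟩).1
  exact Quotient.exact (hi (a₁ := Quotient.mk _ x) (a₂ := Quotient.mk _ y) (Quotient.sound h1))

section swap

variable [DecidableEq D]

theorem numCycles_le_swap_mul (f : Perm D) (x y : D) :
    numCycles f ≤ numCycles (swap x y * f) + 1 := by
  refine card_quotient_le_succ (x := x) (y := y) fun α g hg hxy z w h => ?_
  have hs : ∀ z, g (swap x y z) = g z := by
    intro z
    rcases eq_or_ne z x with rfl | hx
    · simp [hxy]
    rcases eq_or_ne z y with rfl | hy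
    · simp [hxy]
    rw [swap_apply_of_ne_of_ne hx hy]
  refine eq_of_sameCycle (f := swap x y * f) (fun z => ?_) h
  rw [Perm.mul_apply, hs]
  exact (hg _ _ ⟨1, by simp⟩).symm

/-- The `f`-cycle of `y` never meets `x`, so the product follows it until the return to `y`, where
the transposition diverts it to `x`. -/
theorem sameCycle_swap_mul {f : Perm D} {x y : D} (h : ¬ f.SameCycle x y) :
    (swap x y * f).SameCycle x y := by
  have key : ∀ i : ℕ, (swap x y * f).SameCycle y ((f ^ i) y) ∨ (swap x y * f).SameCycle x y := by
    intro i
    induction i with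
    | zero => exact Or.inl (by simp [Perm.SameCycle.refl])
    | succ i ih =>
      rcases ih with h1 | h1
      · have h2 := Perm.sameCycle_apply_right.2 h1
        have hx : (f ^ (i + 1)) y ≠ x := fun hx => h (Perm.SameCycle.symm ⟨(i + 1 : ℕ), hx⟩)
        rw [Perm.mul_apply (swap x y) f, ← Perm.mul_apply f, ← pow_succ'] at h2
        by_cases hy : (f ^ (i + 1)) y = y
        · rw [hy, swap_apply_right] at h2
          exact Or.inr h2.symm
        · rw [swap_apply_of_ne_of_ne hx hy] at h2
          exact Or.inl h2
      · exact Or.inr h1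
  obtain ⟨i, hi⟩ := Perm.SameCycle.exists_nat_pow_eq (f := f) (x := y) (y := f⁻¹ y) ⟨-1, by simp⟩
  rcases key i with h1 | h1
  · rw [hi] at h1
    have h2 := Perm.sameCycle_apply_right.2 h1
    rw [Perm.mul_apply, show f (f⁻¹ y) = y by simp, swap_apply_right] at h2
    exact h2.symm
  · exact h1

/-- With `n` least such that `f ^ n` takes `x` to `y`, the segment `x, f x, …, f ^ (n - 1) x` is
closed under the product: its last step, which would reach `y`, is sent back to `x`. -/
theorem not_sameCycle_swap_mul {f : Perm D} {x y : D} (h : f.SameCycle x y) (hxy : x ≠ y) :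
    ¬ (swap x y * f).SameCycle x y := by
  obtain ⟨n, hn, hmin⟩ := exists_min_pow h
  intro hs
  have hn0 : 0 < n := Nat.pos_of_ne_zero fun h0 => hxy (by simpa [h0] using hn)
  obtain ⟨i, hi, hiy⟩ : ∃ i < n, (f ^ i) x = y := by
    refine mem_of_sameCycle (S := {z | ∃ i < n, (f ^ i) x = z}) ?_ hs ⟨0, hn0, rfl⟩
    rintro _ ⟨i, hi, rfl⟩
    rw [Perm.mul_apply, ← Perm.mul_apply f, ← pow_succ']
    rcases Nat.lt_or_ge (i + 1) n with h1 | h1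
    · refine ⟨i + 1, h1, (swap_apply_of_ne_of_ne (fun hx => ?_) (hmin _ h1)).symm⟩
      refine hmin (n - (i + 1)) (by omega) ?_
      rw [← hn]
      nth_rw 1 [← hx]
      rw [← Perm.mul_apply, ← pow_add]
      congr 2
      omega
    · refine ⟨0, hn0, ?_⟩
      rw [show i + 1 = n by omega, hn]
      simp
  exact hmin i hi hiy

theorem numCycles_swap_mul_of_not_sameCycle {f : Perm D} {x y : D} (h : ¬ f.SameCycle x y) :
    numCycles (swap x y * f) + 1 = numCycles f := by
  refine le_antisymm (Nat.succ_le_of_lt ?_) (numCycles_le_swap_mul f x y)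
  have hxy := sameCycle_swap_mul h
  refine card_quotient_lt (x := x) (y := y) (fun z w => ?_) hxy h
  refine sameCycle_le (r := Perm.SameCycle.setoid (swap x y * f)) fun z => ?_
  have h1 : (swap x y * f).SameCycle z (swap x y (f z)) :=
    Perm.sameCycle_apply_right.2 (Perm.SameCycle.refl _ _)
  rcases eq_or_ne (f z) x with hx | hx
  · rw [hx, swap_apply_left] at h1
    rw [hx]
    exact h1.trans hxy.symm
  rcases eq_or_ne (f z) y with hy | hy
  · rw [hy, swap_apply_right] at h1
    rw [hy]
    exact h1.trans hxy
  rwa [swap_apply_of_ne_of_ne hx hy] at h1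

theorem numCycles_swap_mul_of_sameCycle {f : Perm D} {x y : D} (h : f.SameCycle x y)
    (hxy : x ≠ y) : numCycles (swap x y * f) = numCycles f + 1 := by
  have := numCycles_swap_mul_of_not_sameCycle (not_sameCycle_swap_mul h hxy)
  rw [← mul_assoc, swap_mul_self, one_mul] at this
  exact this.symm

end swap

/-- The number of orbits of the group generated by two permutations. -/
noncomputable def numOrbits (f g : Perm D) : ℕ :=
  Nat.card (Quotient (Perm.SameCycle.setoid f ⊔ Perm.SameCycle.setoid g))

/-- The genus of a pair of permutations is nonnegative. -/
theorem genus_inequality (f g : Perm D) :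
    numCycles f + numCycles g + numCycles (g * f) ≤ Nat.card D + 2 * numOrbits f g := by
  classical
  have := Fintype.ofFinite D
  induction hn : g.support.card using Nat.strong_induction_on generalizing g with
  | _ n ih =>
  by_cases hg : g = 1
  · subst hg
    have h1 : numCycles (1 : Perm D) ≤ Nat.card D :=
      Nat.card_le_card_of_surjective (Quotient.mk _) Quotient.mk_surjective
    have h2 : numCycles f ≤ numOrbits f 1 := by
      refine card_quotient_le (r' := Perm.SameCycle.setoid f) fun x y h => ?_
      have : Perm.SameCycle.setoid f ⊔ Perm.SameCycle.setoid 1 ≤ Perm.SameCycle.setoid f := by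
        refine sup_le le_rfl fun x y hxy => ?_
        rw [show x = y from Perm.sameCycle_one.1 hxy]
      exact this h
    rw [one_mul]
    omega
  · obtain ⟨x, hx⟩ : ∃ x, g x ≠ x := by
      by_contra! h
      exact hg (Perm.ext h)
    -- Split the moved point `x` off its cycle in `g`. The new permutation fixes `x`, so its support
    -- is smaller and it has exactly one more cycle.
    set t := swap x (g x) with ht
    set g' := t * g with hg'
    have htg : g = t * g' := by rw [hg', ← mul_assoc, swap_mul_self, one_mul]
    have h1 := ih _ (by rw [← hn]; exact Perm.card_support_swap_mul hx) g' rfl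
    have hfix : g' x = x := by simp [hg', ht]
    have hns : ¬ g'.SameCycle x (g x) := fun h => hx (h.eq_of_left hfix).symm
    have h2 : numCycles g + 1 = numCycles g' := by
      have := numCycles_swap_mul_of_not_sameCycle hns
      rwa [← ht, ← htg] at this
    set J := Perm.SameCycle.setoid f ⊔ Perm.SameCycle.setoid g' with hJ
    set J' := Perm.SameCycle.setoid f ⊔ Perm.SameCycle.setoid g with hJ'
    have hfJ : ∀ z, J z (f z) := fun z =>
      (le_sup_left : Perm.SameCycle.setoid f ≤ J) (show f.SameCycle z (f z) from ⟨1, by simp⟩)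
    have hgJ : ∀ z, J z (g' z) := fun z =>
      (le_sup_right : Perm.SameCycle.setoid g' ≤ J) (show g'.SameCycle z (g' z) from ⟨1, by simp⟩)
    have hgf : g * f = t * (g' * f) := by rw [← mul_assoc, ← htg]
    have hle : ∀ α : Type, ∀ k : D → α, (∀ z w, J z w → k z = k w) → k x = k (g x) →
      ∀ z w, J' z w → k z = k w := by
      intro α k hk hkx z w hzw
      have : J' ≤ Setoid.ker k := by
        refine sup_le (fun z w h => hk _ _ ((le_sup_left : Perm.SameCycle.setoid f ≤ J) h)) ?_
        refine fun z w h => eq_of_sameCycle (f := g) (fun z => ?_) h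
        have h3 : k (g' z) = k z := (hk _ _ (hgJ z)).symm
        rw [← h3, htg, Perm.mul_apply]
        rcases eq_or_ne (g' z) x with hz | hz
        · rw [hz, ht, swap_apply_left, hkx]
        rcases eq_or_ne (g' z) (g x) with hz' | hz'
        · rw [hz', ht, swap_apply_right, hkx]
        rw [ht, swap_apply_of_ne_of_ne hz hz']
      exact this hzw
    change _ ≤ Nat.card D + 2 * Nat.card (Quotient J')
    change _ ≤ Nat.card D + 2 * Nat.card (Quotient J) at h1
    -- If `x` and `g x` already lie in one orbit of the group generated by `f` and `g'`, the orbits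
    -- are no fewer for `g`, and the product gains at most one cycle. Otherwise one orbit may be
    -- lost, worth 2 on the right, but the product also loses a cycle.
    by_cases hJx : J x (g x)
    · have h3 : Nat.card (Quotient J) ≤ Nat.card (Quotient J') := by
        refine card_quotient_le fun z w h => ?_
        exact Quotient.exact (hle _ (Quotient.mk J) (fun _ _ h => Quotient.sound h)
          (Quotient.sound hJx) z w h)
      have h4 : numCycles (g * f) ≤ numCycles (g' * f) + 1 := by
        have := numCycles_le_swap_mul (t * (g' * f)) x (g x)
        rwa [← ht, ← mul_assoc t t, swap_mul_self, one_mul, ← hgf] at this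
      omega
    · have h3 : Nat.card (Quotient J) ≤ Nat.card (Quotient J') + 1 := card_quotient_le_succ hle
      have h4 : numCycles (g * f) + 1 = numCycles (g' * f) := by
        rw [hgf]
        refine numCycles_swap_mul_of_not_sameCycle fun h => hJx ?_
        exact sameCycle_le (r := J) (fun z => J.trans (hfJ z) (hgJ _)) h
      omega

end PermCycles

open PermCycles

/-! ### Cycles of conjugate permutations, disjoint unions and involutions. -/

namespace PermCycles

variable {D D' A B Q : Type}

theorem mk_eq_mk_iff {f : Perm D} {x y : D} :
    (Quotient.mk _ x : PermOrbit f) = Quotient.mk _ y ↔ f.SameCycle x y :=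
  ⟨fun h => Quotient.exact h, fun h => Quotient.sound h⟩

/-- The cycles of a permutation are the values of any function that separates them. -/
noncomputable def orbitEquiv {f : Perm D} (g : D → Q) (hs : Function.Surjective g)
    (h : ∀ x y, f.SameCycle x y ↔ g x = g y) : PermOrbit f ≃ Q :=
  Equiv.ofBijective (Quotient.lift g fun x y hxy => (h x y).1 hxy)
    ⟨fun p q => Quotient.inductionOn₂ p q fun x y hxy => Quotient.sound ((h x y).2 hxy),
      fun q => (hs q).elim fun x hx => ⟨Quotient.mk _ x, hx⟩⟩

/-- The number of cycles of a given length. -/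
noncomputable def numCyclesOfLength (f : Perm D) (l : ℕ) : ℕ :=
  Nat.card {q : PermOrbit f // Nat.card {d : D // (Quotient.mk _ d : PermOrbit f) = q} = l}

theorem numCyclesOfLength_eq {f : Perm D} (g : D → Q) (hs : Function.Surjective g)
    (h : ∀ x y, f.SameCycle x y ↔ g x = g y) (l : ℕ) :
    numCyclesOfLength f l = Nat.card {q : Q // Nat.card {d : D // g d = q} = l} := by
  refine Nat.card_congr ((orbitEquiv g hs h).subtypeEquiv fun q => ?_)
  rw [Nat.card_congr ((Equiv.refl D).subtypeEquiv fun d => ?_)]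
  rw [← (orbitEquiv g hs h).apply_eq_iff_eq]
  rfl

theorem zpow_apply_congr {f : Perm D} {f' : Perm D'} (e : D ≃ D') (h : ∀ x, e (f x) = f' (e x))
    (k : ℤ) (x : D) : e ((f ^ k) x) = (f' ^ k) (e x) := by
  have hf : f' = e.permCongr f := by
    ext d
    simp [Equiv.permCongr_apply, h]
  have h1 : f' ^ k = e.permCongr (f ^ k) := by
    rw [hf]
    exact (map_zpow e.permCongrHom f k).symm
  simp [h1, Equiv.permCongr_apply]

theorem sameCycle_congr {f : Perm D} {f' : Perm D'} (e : D ≃ D') (h : ∀ x, e (f x) = f' (e x))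
    {a b : D} : f.SameCycle a b ↔ f'.SameCycle (e a) (e b) := by
  constructor
  · rintro ⟨k, rfl⟩
    exact ⟨k, (zpow_apply_congr e h k a).symm⟩
  · rintro ⟨k, hk⟩
    exact ⟨k, e.injective (by rw [zpow_apply_congr e h, hk])⟩

theorem numCycles_congr {f : Perm D} {f' : Perm D'} (e : D ≃ D') (h : ∀ x, e (f x) = f' (e x)) :
    numCycles f = numCycles f' :=
  Nat.card_congr (Quotient.congr e fun _ _ => sameCycle_congr e h)

theorem numCyclesOfLength_congr {f : Perm D} {f' : Perm D'} (e : D ≃ D')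
    (h : ∀ x, e (f x) = f' (e x)) (l : ℕ) : numCyclesOfLength f l = numCyclesOfLength f' l := by
  rw [numCyclesOfLength_eq (fun x => (Quotient.mk _ (e x) : PermOrbit f'))
    (Quotient.mk_surjective.comp e.surjective)
    (fun x y => (sameCycle_congr e h).trans mk_eq_mk_iff.symm)]
  refine Nat.card_congr ((Equiv.refl _).subtypeEquiv fun q => ?_)
  rw [Nat.card_congr (e.subtypeEquiv (q := fun d => (Quotient.mk _ d : PermOrbit f') = q)
    fun d => Iff.rfl)]
  rfl

theorem sameCycle_sumCongr_inl {f : Perm A} {g : Perm B} {a a' : A} :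
    (Perm.sumCongr f g).SameCycle (.inl a) (.inl a') ↔ f.SameCycle a a' := by
  have : ∀ k : ℤ, (Perm.sumCongr f g ^ k) = Perm.sumCongr (f ^ k) (g ^ k) := fun k =>
    (map_zpow (Perm.sumCongrHom A B) (f, g) k).symm
  simp [Perm.SameCycle, this]

theorem sameCycle_sumCongr_inr {f : Perm A} {g : Perm B} {b b' : B} :
    (Perm.sumCongr f g).SameCycle (.inr b) (.inr b') ↔ g.SameCycle b b' := by
  have : ∀ k : ℤ, (Perm.sumCongr f g ^ k) = Perm.sumCongr (f ^ k) (g ^ k) := fun k =>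
    (map_zpow (Perm.sumCongrHom A B) (f, g) k).symm
  simp [Perm.SameCycle, this]

theorem sameCycle_sumCongr {f : Perm A} {g : Perm B} (x y : A ⊕ B) :
    (Perm.sumCongr f g).SameCycle x y ↔
      Sum.map (Quotient.mk _ : A → PermOrbit f) (Quotient.mk _ : B → PermOrbit g) x =
        Sum.map (Quotient.mk _) (Quotient.mk _) y := by
  have : ∀ k : ℤ, (Perm.sumCongr f g ^ k) = Perm.sumCongr (f ^ k) (g ^ k) := fun k =>
    (map_zpow (Perm.sumCongrHom A B) (f, g) k).symm
  rcases x with a | b <;> rcases y with a' | b'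
  · rw [sameCycle_sumCongr_inl, Sum.map_inl, Sum.map_inl, Sum.inl.injEq]
    exact mk_eq_mk_iff.symm
  · simp [Perm.SameCycle, this]
  · simp [Perm.SameCycle, this]
  · rw [sameCycle_sumCongr_inr, Sum.map_inr, Sum.map_inr, Sum.inr.injEq]
    exact mk_eq_mk_iff.symm

theorem numCyclesOfLength_sumCongr [Finite A] [Finite B] (f : Perm A) (g : Perm B) (l : ℕ) :
    numCyclesOfLength (Perm.sumCongr f g) l = numCyclesOfLength f l + numCyclesOfLength g l := by
  rw [numCyclesOfLength_eq _ (Sum.map_surjective.2 ⟨Quotient.mk_surjective, Quotient.mk_surjective⟩)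
    sameCycle_sumCongr, Nat.card_congr Equiv.subtypeSum, Nat.card_sum]
  congr 1
  · refine Nat.card_congr ((Equiv.refl _).subtypeEquiv fun q => ?_)
    rw [Nat.card_congr Equiv.subtypeSum, Nat.card_sum]
    simp
  · refine Nat.card_congr ((Equiv.refl _).subtypeEquiv fun q => ?_)
    rw [Nat.card_congr Equiv.subtypeSum, Nat.card_sum]
    simp

theorem numCycles_sumCongr [Finite A] [Finite B] (f : Perm A) (g : Perm B) :
    numCycles (Perm.sumCongr f g) = numCycles f + numCycles g := by
  rw [numCycles, Nat.card_congr (orbitEquiv _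
    (Sum.map_surjective.2 ⟨Quotient.mk_surjective, Quotient.mk_surjective⟩) sameCycle_sumCongr),
    Nat.card_sum, numCycles, numCycles]

section sigma

variable {K : Type} {Y : K → Type} (f : ∀ i, Perm (Y i))

theorem sigmaCongrRight_zpow (k : ℤ) (i : K) (y : Y i) :
    (Perm.sigmaCongrRight f ^ k) ⟨i, y⟩ = ⟨i, (f i ^ k) y⟩ := by
  have : Perm.sigmaCongrRight f ^ k = Perm.sigmaCongrRight (f ^ k) :=
    (map_zpow (Perm.sigmaCongrRightHom Y) f k).symm
  rw [this]
  rfl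

theorem sameCycle_sigmaCongrRight_mk {i : K} {y y' : Y i} :
    (Perm.sigmaCongrRight f).SameCycle ⟨i, y⟩ ⟨i, y'⟩ ↔ (f i).SameCycle y y' := by
  simp [Perm.SameCycle, sigmaCongrRight_zpow]

theorem sameCycle_sigmaCongrRight (x y : Σ i, Y i) :
    (Perm.sigmaCongrRight f).SameCycle x y ↔
      (⟨x.1, Quotient.mk _ x.2⟩ : Σ i, PermOrbit (f i)) = ⟨y.1, Quotient.mk _ y.2⟩ := by
  rcases x with ⟨i, x⟩
  rcases y with ⟨i', y⟩
  rcases eq_or_ne i i' with rfl | hi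
  · rw [sameCycle_sigmaCongrRight_mk]
    simp only [Sigma.mk.injEq, heq_eq_eq, true_and]
    exact mk_eq_mk_iff.symm
  · simp [Perm.SameCycle, sigmaCongrRight_zpow, hi]

theorem sigma_mk_surjective :
    Function.Surjective fun x : Σ i, Y i => (⟨x.1, Quotient.mk _ x.2⟩ : Σ i, PermOrbit (f i)) := by
  rintro ⟨i, q⟩
  induction q using Quotient.inductionOn with
  | h y => exact ⟨⟨i, y⟩, rfl⟩

variable [Fintype K] [∀ i, Finite (Y i)]

theorem numCycles_sigmaCongrRight :
    numCycles (Perm.sigmaCongrRight f) = ∑ i, numCycles (f i) := by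
  rw [numCycles, Nat.card_congr (orbitEquiv _ (sigma_mk_surjective f)
    (sameCycle_sigmaCongrRight f)), Nat.card_sigma]
  rfl

theorem numCyclesOfLength_sigmaCongrRight (l : ℕ) :
    numCyclesOfLength (Perm.sigmaCongrRight f) l = ∑ i, numCyclesOfLength (f i) l := by
  rw [numCyclesOfLength_eq _ (sigma_mk_surjective f) (sameCycle_sigmaCongrRight f)]
  let e : {q : Σ i, PermOrbit (f i) // Nat.card {d : Σ i, Y i //
      (⟨d.1, Quotient.mk _ d.2⟩ : Σ i, PermOrbit (f i)) = q} = l} ≃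
      Σ i, {q : PermOrbit (f i) // Nat.card {d : Σ i, Y i //
      (⟨d.1, Quotient.mk _ d.2⟩ : Σ i, PermOrbit (f i)) = ⟨i, q⟩} = l} :=
    { toFun := fun q => ⟨q.1.1, q.1.2, q.2⟩
      invFun := fun q => ⟨⟨q.1, q.2.1⟩, q.2.2⟩
      left_inv := fun _ => rfl
      right_inv := fun _ => rfl }
  rw [Nat.card_congr e, Nat.card_sigma]
  refine Finset.sum_congr rfl fun i _ => Nat.card_congr ((Equiv.refl _).subtypeEquiv fun q => ?_)
  have : Nat.card {d : Σ i, Y i // (⟨d.1, Quotient.mk _ d.2⟩ : Σ i, PermOrbit (f i)) = ⟨i, q⟩} =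
      Nat.card {d : Y i // (Quotient.mk _ d : PermOrbit (f i)) = q} := by
    refine (Nat.card_congr (Equiv.ofBijective (fun d => ⟨⟨i, d.1⟩, by rw [d.2]⟩) ⟨?_, ?_⟩)).symm
    · rintro ⟨d, hd⟩ ⟨d', hd'⟩ h
      simpa using h
    · rintro ⟨⟨j, d⟩, hd⟩
      obtain rfl : j = i := congrArg Sigma.fst hd
      exact ⟨⟨d, by simpa using hd⟩, rfl⟩
  rw [this]
  rfl

end sigma

/-- Makes the number of edges a function of the number of half-edges alone, so edge counts after
gluing or cutting need no inspection of the new edges. -/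
theorem two_mul_numCycles_of_involutive [Finite D] {f : Perm D} (h : ∀ d, f (f d) = d)
    (hne : ∀ d, f d ≠ d) : 2 * numCycles f = Nat.card D := by
  classical
  have := Fintype.ofFinite D
  have key : ∀ x y, f.SameCycle x y ↔ y = x ∨ y = f x := by
    intro x y
    constructor
    · intro hxy
      refine mem_of_sameCycle (S := {y | y = x ∨ y = f x}) ?_ hxy (Or.inl rfl)
      rintro z (rfl | rfl)
      · exact Or.inr rfl
      · exact Or.inl (h _)
    · rintro (rfl | rfl)
      · exact Perm.SameCycle.refl _ _
      · exact ⟨1, by simp⟩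
  have := Fintype.ofFinite (PermOrbit f)
  rw [← Nat.card_congr (Equiv.sigmaFiberEquiv (Quotient.mk _ : D → PermOrbit f)), Nat.card_sigma,
    numCycles, Nat.card_eq_fintype_card (α := PermOrbit f)]
  rw [Finset.sum_congr rfl (g := fun _ => 2)]
  · simp [mul_comm]
  · intro q _
    induction q using Quotient.inductionOn with
    | h x =>
      have : {d : D | (Quotient.mk _ d : PermOrbit f) = Quotient.mk _ x} = {x, f x} := by
        ext d
        exact mk_eq_mk_iff.trans <| Perm.sameCycle_comm.trans (key x d)
      change Nat.card ({d : D | (Quotient.mk _ d : PermOrbit f) = Quotient.mk _ x} : Set D) = 2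
      rw [this, Nat.card_coe_set_eq, Set.ncard_pair (hne x).symm]

end PermCycles

/-! ### Gluing two rotation systems along marked half-edges. -/

/-- Two maps without root, on `A` and `B`, with marked half-edges indexed by `P`, to be glued
along the marked half-edges. -/
structure Gluing (A B P : Type) where
  nextA : Perm A
  oppA : Perm A
  nextB : Perm B
  oppB : Perm B
  flip : P → P
  j : P → A
  k : P → B
  oppA_oppA : ∀ a, oppA (oppA a) = a
  oppA_ne : ∀ a, oppA a ≠ a
  oppB_oppB : ∀ b, oppB (oppB b) = b
  oppB_ne : ∀ b, oppB b ≠ b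
  j_inj : Function.Injective j
  oppA_j : ∀ p, oppA (j p) = j (flip p)
  oppB_k : ∀ p, oppB (k p) = k (flip p)
  k_sep : ∀ p p', nextB.SameCycle (k p) (k p') → p = p'

namespace Gluing

variable {A B P : Type} (G : Gluing A B P)

theorem k_inj : Function.Injective G.k := fun p p' h => G.k_sep p p' (by rw [h])

theorem flip_flip (p : P) : G.flip (G.flip p) = p := by
  apply G.j_inj
  rw [← G.oppA_j, ← G.oppA_j, G.oppA_oppA]

open Classical in
/-- The involution that exchanges corresponding marked half-edges. -/
noncomputable def seamFun : A ⊕ B → A ⊕ B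
  | .inl a => if h : ∃ p, G.j p = a then .inr (G.k h.choose) else .inl a
  | .inr b => if h : ∃ p, G.k p = b then .inl (G.j h.choose) else .inr b

theorem seamFun_inl_j (p : P) : G.seamFun (.inl (G.j p)) = .inr (G.k p) := by
  have h : ∃ p', G.j p' = G.j p := ⟨p, rfl⟩
  simp only [seamFun, dif_pos h]
  rw [G.j_inj h.choose_spec]

theorem seamFun_inr_k (p : P) : G.seamFun (.inr (G.k p)) = .inl (G.j p) := by
  have h : ∃ p', G.k p' = G.k p := ⟨p, rfl⟩
  simp only [seamFun, dif_pos h]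
  rw [G.k_inj h.choose_spec]

theorem seamFun_inl {a : A} (h : ∀ p, G.j p ≠ a) : G.seamFun (.inl a) = .inl a := by
  simp [seamFun, h]

theorem seamFun_inr {b : B} (h : ∀ p, G.k p ≠ b) : G.seamFun (.inr b) = .inr b := by
  simp [seamFun, h]

/-- Marked and unmarked half-edges on both sides. -/
theorem sum_cases {motive : A ⊕ B → Prop} (h1 : ∀ p, motive (.inl (G.j p)))
    (h2 : ∀ a, (∀ p, G.j p ≠ a) → motive (.inl a)) (h3 : ∀ p, motive (.inr (G.k p)))
    (h4 : ∀ b, (∀ p, G.k p ≠ b) → motive (.inr b)) (x : A ⊕ B) : motive x := by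
  rcases x with a | b
  · by_cases h : ∃ p, G.j p = a
    · obtain ⟨p, rfl⟩ := h
      exact h1 p
    · exact h2 a (by simpa using h)
  · by_cases h : ∃ p, G.k p = b
    · obtain ⟨p, rfl⟩ := h
      exact h3 p
    · exact h4 b (by simpa using h)

theorem seamFun_seamFun (x : A ⊕ B) : G.seamFun (G.seamFun x) = x := by
  induction x using G.sum_cases with
  | h1 p => rw [seamFun_inl_j, seamFun_inr_k]
  | h2 a h => rw [G.seamFun_inl h, G.seamFun_inl h]
  | h3 p => rw [seamFun_inr_k, seamFun_inl_j]
  | h4 b h => rw [G.seamFun_inr h, G.seamFun_inr h]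

noncomputable def seam : Perm (A ⊕ B) := ⟨G.seamFun, G.seamFun, G.seamFun_seamFun, G.seamFun_seamFun⟩

@[simp] theorem seam_inl_j (p : P) : G.seam (.inl (G.j p)) = .inr (G.k p) := G.seamFun_inl_j p
@[simp] theorem seam_inr_k (p : P) : G.seam (.inr (G.k p)) = .inl (G.j p) := G.seamFun_inr_k p
theorem seam_inl {a : A} (h : ∀ p, G.j p ≠ a) : G.seam (.inl a) = .inl a := G.seamFun_inl h
theorem seam_inr {b : B} (h : ∀ p, G.k p ≠ b) : G.seam (.inr b) = .inr b := G.seamFun_inr h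
theorem seam_seam (x : A ⊕ B) : G.seam (G.seam x) = x := G.seamFun_seamFun x

/-- The same left factor `seam` is used in `next` and in `opp`, so that it cancels in the face
permutation. Matching marked edges of the two sides are thereby cut in half and rejoined crosswise.
-/
noncomputable def next : Perm (A ⊕ B) := G.seam * Perm.sumCongr G.nextA G.nextB

noncomputable def opp : Perm (A ⊕ B) := G.seam * Perm.sumCongr G.oppA G.oppB

theorem next_inl (a : A) : G.next (.inl a) = G.seam (.inl (G.nextA a)) := rfl
theorem next_inr (b : B) : G.next (.inr b) = G.seam (.inr (G.nextB b)) := rfl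

theorem opp_inl_j (p : P) : G.opp (.inl (G.j p)) = .inr (G.k (G.flip p)) := by
  simp [opp, G.oppA_j]

theorem opp_inr_k (p : P) : G.opp (.inr (G.k p)) = .inl (G.j (G.flip p)) := by
  simp [opp, G.oppB_k]

theorem oppA_unmarked {a : A} (h : ∀ p, G.j p ≠ a) (p : P) : G.j p ≠ G.oppA a := by
  intro hp
  apply h (G.flip p)
  rw [← G.oppA_j, hp, G.oppA_oppA]

theorem oppB_unmarked {b : B} (h : ∀ p, G.k p ≠ b) (p : P) : G.k p ≠ G.oppB b := by
  intro hp
  apply h (G.flip p)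
  rw [← G.oppB_k, hp, G.oppB_oppB]

theorem opp_inl {a : A} (h : ∀ p, G.j p ≠ a) : G.opp (.inl a) = .inl (G.oppA a) := by
  simp [opp, G.seam_inl (G.oppA_unmarked h)]

theorem opp_inr {b : B} (h : ∀ p, G.k p ≠ b) : G.opp (.inr b) = .inr (G.oppB b) := by
  simp [opp, G.seam_inr (G.oppB_unmarked h)]

theorem opp_opp (x : A ⊕ B) : G.opp (G.opp x) = x := by
  induction x using G.sum_cases with
  | h1 p => rw [opp_inl_j, opp_inr_k, flip_flip]
  | h2 a h => rw [G.opp_inl h, G.opp_inl (G.oppA_unmarked h), G.oppA_oppA]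
  | h3 p => rw [opp_inr_k, opp_inl_j, flip_flip]
  | h4 b h => rw [G.opp_inr h, G.opp_inr (G.oppB_unmarked h), G.oppB_oppB]

theorem opp_ne (x : A ⊕ B) : G.opp x ≠ x := by
  induction x using G.sum_cases with
  | h1 p => simp [opp_inl_j]
  | h2 a h => simp [G.opp_inl h, G.oppA_ne]
  | h3 p => simp [opp_inr_k]
  | h4 b h => simp [G.opp_inr h, G.oppB_ne]

theorem face_eq : G.next⁻¹ * G.opp =
    Perm.sumCongr (G.nextA⁻¹ * G.oppA) (G.nextB⁻¹ * G.oppB) := by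
  rw [next, opp, mul_inv_rev, mul_assoc, inv_mul_cancel_left, Perm.sumCongr_inv,
    Perm.sumCongr_mul]

open Classical in
/-- The vertex of the glued map that carries a half-edge. -/
noncomputable def vtx : A ⊕ B → PermOrbit G.nextA ⊕ PermOrbit G.nextB
  | .inl a => .inl (Quotient.mk _ a)
  | .inr b => if h : ∃ p, G.nextB.SameCycle (G.k p) b then .inl (Quotient.mk _ (G.j h.choose))
    else .inr (Quotient.mk _ b)

theorem vtx_inl (a : A) : G.vtx (.inl a) = .inl (Quotient.mk _ a) := rfl

theorem vtx_inr_of_sameCycle {p : P} {b : B} (hp : G.nextB.SameCycle (G.k p) b) :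
    G.vtx (.inr b) = .inl (Quotient.mk _ (G.j p)) := by
  have h : ∃ p, G.nextB.SameCycle (G.k p) b := ⟨p, hp⟩
  simp only [vtx, dif_pos h]
  rw [G.k_sep _ _ (hp.trans h.choose_spec.symm)]

theorem vtx_inr {b : B} (h : ∀ p, ¬ G.nextB.SameCycle (G.k p) b) :
    G.vtx (.inr b) = .inr (Quotient.mk _ b) := by
  simp [vtx, h]

theorem vtx_inr_k (p : P) : G.vtx (.inr (G.k p)) = .inl (Quotient.mk _ (G.j p)) :=
  G.vtx_inr_of_sameCycle (Perm.SameCycle.refl _ _)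

theorem vtx_seam (x : A ⊕ B) : G.vtx (G.seam x) = G.vtx x := by
  induction x using G.sum_cases with
  | h1 p => rw [seam_inl_j, vtx_inr_k, vtx_inl]
  | h2 a h => rw [G.seam_inl h]
  | h3 p => rw [seam_inr_k, vtx_inr_k, vtx_inl]
  | h4 b h => rw [G.seam_inr h]

theorem vtx_inl_nextA (a : A) : G.vtx (.inl (G.nextA a)) = G.vtx (.inl a) := by
  rw [vtx_inl, vtx_inl, Sum.inl.injEq]
  exact Quotient.sound (Perm.sameCycle_apply_left.2 (Perm.SameCycle.refl _ _))

theorem vtx_inr_congr {b b' : B} (hb : G.nextB.SameCycle b b') :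
    G.vtx (.inr b) = G.vtx (.inr b') := by
  by_cases h : ∃ p, G.nextB.SameCycle (G.k p) b
  · obtain ⟨p, hp⟩ := h
    rw [G.vtx_inr_of_sameCycle hp, G.vtx_inr_of_sameCycle (hp.trans hb)]
  · push Not at h
    rw [G.vtx_inr h, G.vtx_inr fun p hp => h p (hp.trans hb.symm)]
    exact congrArg _ (Quotient.sound hb)

theorem vtx_inr_nextB (b : B) : G.vtx (.inr (G.nextB b)) = G.vtx (.inr b) :=
  G.vtx_inr_congr (Perm.sameCycle_apply_left.2 (Perm.SameCycle.refl _ _))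

theorem vtx_next (x : A ⊕ B) : G.vtx (G.next x) = G.vtx x := by
  rcases x with a | b
  · rw [next_inl, vtx_seam, vtx_inl_nextA]
  · rw [next_inr, vtx_seam, vtx_inr_nextB]

variable [Finite B]

/-- By `k_sep` the only marked half-edge around this vertex of `B` is `k p` itself, so the rotation
there is undisturbed until it comes back to `k p`. -/
theorem sameCycle_inr_k (p : P) {b : B} (hb : G.nextB.SameCycle (G.k p) b) :
    G.next.SameCycle (.inr (G.k p)) (.inr b) := by
  obtain ⟨n, rfl⟩ := hb.exists_nat_pow_eq
  clear hb
  induction n with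
  | zero => exact Perm.SameCycle.refl _ _
  | succ n ih =>
    rw [pow_succ', Perm.mul_apply]
    set b := (G.nextB ^ n) (G.k p) with hb
    by_cases h : ∃ p', G.k p' = G.nextB b
    · obtain ⟨p', hp'⟩ := h
      rw [← hp', G.k_sep p p' ⟨n + 1, ?_⟩]
      rw [hp', hb, zpow_add_one, ← Perm.mul_apply, ← zpow_natCast, ← zpow_one_add, add_comm,
        zpow_add_one]
    · push Not at h
      have := Perm.sameCycle_apply_right.2 ih
      rwa [next_inr, G.seam_inr h] at this

theorem sameCycle_k_j (p : P) : G.next.SameCycle (.inr (G.k p)) (.inl (G.j p)) := by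
  have h := G.sameCycle_inr_k p (b := G.nextB⁻¹ (G.k p)) ⟨-1, by simp⟩
  have := Perm.sameCycle_apply_right.2 h
  rwa [next_inr, show G.nextB (G.nextB⁻¹ (G.k p)) = G.k p by simp, seam_inr_k] at this

theorem sameCycle_seam (x : A ⊕ B) : G.next.SameCycle (G.seam x) x := by
  induction x using G.sum_cases with
  | h1 p => rw [seam_inl_j]; exact G.sameCycle_k_j p
  | h2 a h => rw [G.seam_inl h]
  | h3 p => rw [seam_inr_k]; exact (G.sameCycle_k_j p).symm
  | h4 b h => rw [G.seam_inr h]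

variable [Finite A]

theorem sameCycle_sumCongr_le {x y : A ⊕ B}
    (h : (Perm.sumCongr G.nextA G.nextB).SameCycle x y) : G.next.SameCycle x y := by
  refine sameCycle_le (r := Perm.SameCycle.setoid G.next) (fun x => ?_) h
  have h1 : G.next.SameCycle x (G.next x) := Perm.sameCycle_apply_right.2 (Perm.SameCycle.refl _ _)
  exact h1.trans (G.sameCycle_seam _)

/-- `vtx` is constant along `next`. Conversely each half-edge is in the cycle of a half-edge of `A`,
or sits at an unmarked vertex of `B`, and two half-edges in the same cycle of either piece stay
together. -/
theorem sameCycle_iff (x y : A ⊕ B) : G.next.SameCycle x y ↔ G.vtx x = G.vtx y := by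
  refine ⟨fun h => eq_of_sameCycle G.vtx_next h, fun h => ?_⟩
  have key : ∀ x, (∃ a, G.next.SameCycle x (.inl a) ∧ G.vtx x = .inl (Quotient.mk _ a)) ∨
      ∃ b, x = .inr b ∧ G.vtx x = .inr (Quotient.mk _ b) := by
    rintro (a | b)
    · exact Or.inl ⟨a, Perm.SameCycle.refl _ _, rfl⟩
    · by_cases h : ∃ p, G.nextB.SameCycle (G.k p) b
      · obtain ⟨p, hp⟩ := h
        refine Or.inl ⟨G.j p, ?_, G.vtx_inr_of_sameCycle hp⟩
        exact (G.sameCycle_sumCongr_le (sameCycle_sumCongr_inr.2 hp.symm)).trans (G.sameCycle_k_j p)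
      · push Not at h
        exact Or.inr ⟨b, rfl, G.vtx_inr h⟩
  rcases key x with ⟨a, ha, hxa⟩ | ⟨b, rfl, hxb⟩ <;> rcases key y with ⟨a', ha', hya⟩ | ⟨b', rfl, hyb⟩
  · rw [hxa, hya, Sum.inl.injEq] at h
    exact (ha.trans (G.sameCycle_sumCongr_le (sameCycle_sumCongr_inl.2 (mk_eq_mk_iff.1 h)))).trans
      ha'.symm
  · simp [hxa, hyb] at h
  · simp [hxb, hya] at h
  · rw [hxb, hyb, Sum.inr.injEq] at h
    exact G.sameCycle_sumCongr_le (sameCycle_sumCongr_inr.2 (mk_eq_mk_iff.1 h))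

/-- Each marked vertex of `B` is absorbed by a vertex of `A`, and `k_sep` makes the marked vertices
of `B` distinct: exactly one vertex is lost per mark. -/
theorem numCycles_next [Finite P] :
    numCycles G.next + Nat.card P = numCycles G.nextA + numCycles G.nextB := by
  have h1 : numCycles G.next = (Set.range G.vtx).ncard := by
    refine Nat.card_congr (orbitEquiv (Set.rangeFactorization G.vtx)
      Set.rangeFactorization_surjective fun x y => ?_)
    rw [G.sameCycle_iff, Subtype.ext_iff]
    rfl
  let ι : P → PermOrbit G.nextA ⊕ PermOrbit G.nextB := fun p => .inr (Quotient.mk _ (G.k p))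
  have hι : Function.Injective ι := fun p p' h =>
    G.k_sep _ _ (mk_eq_mk_iff.1 (Sum.inr_injective h))
  have h2 : Set.range G.vtx = (Set.range ι)ᶜ := by
    ext q
    constructor
    · rintro ⟨x, rfl⟩ ⟨p, hp⟩
      rcases x with a | b
      · simp [vtx_inl, ι] at hp
      · by_cases h : ∃ p, G.nextB.SameCycle (G.k p) b
        · obtain ⟨p, h⟩ := h
          simp [G.vtx_inr_of_sameCycle h, ι] at hp
        · push Not at h
          rw [G.vtx_inr h, Sum.inr.injEq] at hp
          exact h p (mk_eq_mk_iff.1 hp)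
    · intro hq
      rcases q with q | q <;> induction q using Quotient.inductionOn with
      | h x => ?_
      · exact ⟨.inl x, rfl⟩
      · refine ⟨.inr x, G.vtx_inr fun p hp => hq ⟨p, ?_⟩⟩
        exact congrArg Sum.inr (Quotient.sound hp)
  have h3 : (Set.range ι).ncard = Nat.card P := by
    rw [← Nat.card_coe_set_eq, Nat.card_range_of_injective hι]
  rw [h1, h2, ← h3, add_comm, Set.ncard_add_ncard_compl, Nat.card_sum]
  rfl

/-- Additivity of the Euler characteristic, in the form needed here. -/
theorem euler [Finite P] : numCycles G.next + numCycles (G.next⁻¹ * G.opp) + numCycles G.oppA +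
      numCycles G.oppB + Nat.card P =
    numCycles G.nextA + numCycles (G.nextA⁻¹ * G.oppA) + (numCycles G.nextB +
      numCycles (G.nextB⁻¹ * G.oppB)) + numCycles G.opp := by
  have h1 := G.numCycles_next
  have h2 := two_mul_numCycles_of_involutive G.opp_opp G.opp_ne
  have h3 := two_mul_numCycles_of_involutive G.oppA_oppA G.oppA_ne
  have h4 := two_mul_numCycles_of_involutive G.oppB_oppB G.oppB_ne
  rw [Nat.card_sum] at h2
  rw [face_eq, numCycles_sumCongr]
  omega

theorem mem_of_closed {S : Set (A ⊕ B)} (h : ∀ x ∈ S, G.next x ∈ S) {x y : A ⊕ B}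
    (hxy : G.vtx x = G.vtx y) (hx : x ∈ S) : y ∈ S :=
  mem_of_sameCycle h ((G.sameCycle_iff x y).2 hxy) hx

theorem seam_mem_of_closed {S : Set (A ⊕ B)} (h : ∀ x ∈ S, G.next x ∈ S) {x : A ⊕ B} (hx : x ∈ S) :
    G.seam x ∈ S :=
  G.mem_of_closed h (G.vtx_seam x).symm hx

theorem nextA_mem_of_closed {S : Set (A ⊕ B)} (h : ∀ x ∈ S, G.next x ∈ S) {a : A}
    (ha : .inl a ∈ S) : .inl (G.nextA a) ∈ S :=
  G.mem_of_closed h (G.vtx_inl_nextA a).symm ha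

theorem nextB_mem_of_closed {S : Set (A ⊕ B)} (h : ∀ x ∈ S, G.next x ∈ S) {b : B}
    (hb : .inr b ∈ S) : .inr (G.nextB b) ∈ S :=
  G.mem_of_closed h (G.vtx_inr_nextB b).symm hb

theorem oppA_mem_of_closed {S : Set (A ⊕ B)} (h : ∀ x ∈ S, G.next x ∈ S)
    (h' : ∀ x ∈ S, G.opp x ∈ S) {a : A} (ha : .inl a ∈ S) : .inl (G.oppA a) ∈ S := by
  have := G.seam_mem_of_closed h (h' _ ha)
  rwa [opp, Perm.mul_apply, seam_seam] at this

theorem oppB_mem_of_closed {S : Set (A ⊕ B)} (h : ∀ x ∈ S, G.next x ∈ S)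
    (h' : ∀ x ∈ S, G.opp x ∈ S) {b : B} (hb : .inr b ∈ S) : .inr (G.oppB b) ∈ S := by
  have := G.seam_mem_of_closed h (h' _ hb)
  rwa [opp, Perm.mul_apply, seam_seam] at this

end Gluing

/-! ### Rotation systems and their properties. -/

/-- A rooted rotation system, without any condition on its surface. -/
structure PreMap (D : Type) where
  next : Perm D
  opp : Perm D
  root : D
  opp_opp : ∀ d, opp (opp d) = d
  opp_ne : ∀ d, opp d ≠ d

namespace PreMap

variable {D D' : Type} (m : PreMap D) (m' : PreMap D')

/-- The origin of a half-edge. -/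
def vtx (d : D) : PermOrbit m.next := Quotient.mk _ d

theorem vtx_eq_iff {x y : D} : m.vtx x = m.vtx y ↔ m.next.SameCycle x y := mk_eq_mk_iff

theorem vtx_next (x : D) : m.vtx (m.next x) = m.vtx x :=
  m.vtx_eq_iff.2 (Perm.sameCycle_apply_left.2 (Perm.SameCycle.refl _ _))

def face : Perm D := m.next⁻¹ * m.opp

def Connected : Prop :=
  ∀ S : Set D, S.Nonempty → (∀ x ∈ S, m.next x ∈ S) → (∀ x ∈ S, m.opp x ∈ S) → ∀ x, x ∈ S

def Planar : Prop := numCycles m.next + numCycles m.face = numCycles m.opp + 2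

def Loopless : Prop := ∀ d, m.vtx d ≠ m.vtx (m.opp d)

/-- The two half-edges have the same origin and the same end. -/
def Parallel (x y : D) : Prop := m.vtx x = m.vtx y ∧ m.vtx (m.opp x) = m.vtx (m.opp y)

def Simple : Prop := m.Loopless ∧ ∀ x y, m.Parallel x y → x = y

/-- At least two vertices are common to the two parts of any partition of the edges. -/
def TwoConnected : Prop := ∀ S : Set D, (∀ x ∈ S, m.opp x ∈ S) → (∃ x, x ∈ S) → (∃ x, x ∉ S) →
  ∃ x y x' y', x ∈ S ∧ y ∉ S ∧ m.vtx x = m.vtx y ∧ x' ∈ S ∧ y' ∉ S ∧ m.vtx x' = m.vtx y' ∧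
    m.vtx x ≠ m.vtx x'

variable {m} in
theorem opp_mem_iff {S : Set D} (h : ∀ x ∈ S, m.opp x ∈ S) (x : D) : m.opp x ∈ S ↔ x ∈ S :=
  ⟨fun hx => by simpa [m.opp_opp] using h _ hx, h x⟩

/-- An isomorphism of rooted rotation systems. -/
structure IsIso (e : D ≃ D') : Prop where
  next : ∀ d, e (m.next d) = m'.next (e d)
  opp : ∀ d, e (m.opp d) = m'.opp (e d)
  root : e m.root = m'.root

end PreMap

/-! ### Insertion of maps in the edges of a core. -/

/-- Maps on `Y i`, to be inserted at the half-edges `o i` of a core map. -/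
structure Decoration {A K : Type} (c : PreMap A) (Y : K → Type) where
  o : K → A
  o_inj : Function.Injective o
  opp_o_ne : ∀ i i', c.opp (o i) ≠ o i'
  n : ∀ i, PreMap (Y i)
  root_sep : ∀ i, (n i).vtx (n i).root ≠ (n i).vtx ((n i).opp (n i).root)

namespace Decoration

variable {A K : Type} {c : PreMap A} {Y : K → Type} (d : Decoration c Y)

/-- The marked half-edges of the core. -/
def coreMark (p : K × Bool) : A := if p.2 then d.o p.1 else c.opp (d.o p.1)

/-- The root of an inserted map and its opposite. -/
def innerEnd (i : K) (ε : Bool) : Y i := if ε then (d.n i).root else (d.n i).opp (d.n i).root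

/-- The marked half-edges of the inserted maps. -/
def innerMark (p : K × Bool) : Σ i, Y i := ⟨p.1, d.innerEnd p.1 p.2⟩

theorem coreMark_inj : Function.Injective d.coreMark := by
  rintro ⟨i, _ | _⟩ ⟨i', _ | _⟩ h
  · simp only [coreMark, Bool.false_eq_true, if_false] at h
    rw [d.o_inj (c.opp.injective h)]
  · simp only [coreMark, Bool.false_eq_true, if_false, if_true] at h
    exact absurd h (d.opp_o_ne _ _)
  · simp only [coreMark, Bool.false_eq_true, if_false, if_true] at h
    exact absurd h.symm (d.opp_o_ne _ _)
  · simp only [coreMark, if_true] at h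
    rw [d.o_inj h]

noncomputable def gluing : Gluing A (Σ i, Y i) (K × Bool) where
  nextA := c.next
  oppA := c.opp
  nextB := Perm.sigmaCongrRight fun i => (d.n i).next
  oppB := Perm.sigmaCongrRight fun i => (d.n i).opp
  flip p := (p.1, !p.2)
  j := d.coreMark
  k := d.innerMark
  oppA_oppA := c.opp_opp
  oppA_ne := c.opp_ne
  oppB_oppB := fun ⟨i, y⟩ => by simp [(d.n i).opp_opp]
  oppB_ne := fun ⟨i, y⟩ => by simp [(d.n i).opp_ne]
  j_inj := d.coreMark_inj
  oppA_j := by rintro ⟨i, _ | _⟩ <;> simp [coreMark, c.opp_opp]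
  oppB_k := by rintro ⟨i, _ | _⟩ <;> simp [innerMark, innerEnd, (d.n i).opp_opp]
  k_sep := by
    rintro ⟨i, ε⟩ ⟨i', ε'⟩ h
    obtain rfl : i = i' := congrArg Sigma.fst ((sameCycle_sigmaCongrRight _ _ _).1 h)
    have h' := (sameCycle_sigmaCongrRight_mk _).1 h
    have h1 := d.root_sep i
    rw [Ne, (d.n i).vtx_eq_iff] at h1
    rcases ε with _ | _ <;> rcases ε' with _ | _ <;> simp [innerEnd] at h' ⊢
    · exact h1 h'.symm
    · exact h1 h'

/-- The map obtained by opening the edges of `o i` and inserting the maps `n i`. -/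
noncomputable def glue : PreMap (A ⊕ Σ i, Y i) where
  next := d.gluing.next
  opp := d.gluing.opp
  root := .inl c.root
  opp_opp := d.gluing.opp_opp
  opp_ne := d.gluing.opp_ne

theorem face_glue : d.glue.face =
    Perm.sumCongr c.face (Perm.sigmaCongrRight fun i => (d.n i).face) := by
  change d.gluing.next⁻¹ * d.gluing.opp = _
  rw [d.gluing.face_eq]
  rfl

theorem numCyclesOfLength_face [Finite A] [Fintype K] [∀ i, Finite (Y i)] (l : ℕ) :
    numCyclesOfLength d.glue.face l =
      numCyclesOfLength c.face l + ∑ i, numCyclesOfLength (d.n i).face l := by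
  rw [face_glue, numCyclesOfLength_sumCongr, numCyclesOfLength_sigmaCongrRight]

/-- Each inserted map brings Euler characteristic 2, and gluing it at the two ends of its root edge
costs two vertices. The total is the characteristic of the core. -/
theorem planar_glue_iff [Finite A] [Finite K] [∀ i, Finite (Y i)] (h : ∀ i, (d.n i).Planar) :
    d.glue.Planar ↔ c.Planar := by
  have := Fintype.ofFinite K
  have h1 := d.gluing.euler
  have h2 : numCycles d.gluing.nextB + numCycles (d.gluing.nextB⁻¹ * d.gluing.oppB) =
      numCycles d.gluing.oppB + 2 * Nat.card K := by
    change numCycles (Perm.sigmaCongrRight fun i => (d.n i).next) +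
      numCycles (Perm.sigmaCongrRight fun i => (d.n i).face) =
      numCycles (Perm.sigmaCongrRight fun i => (d.n i).opp) + _
    simp only [numCycles_sigmaCongrRight]
    rw [← Finset.sum_add_distrib, Finset.sum_congr rfl fun i _ => h i, Finset.sum_add_distrib]
    simp [mul_comm]
  have h3 : Nat.card (K × Bool) = 2 * Nat.card K := by simp [mul_comm]
  have e1 : numCycles c.next = numCycles d.gluing.nextA := rfl
  have e2 : numCycles c.face = numCycles (d.gluing.nextA⁻¹ * d.gluing.oppA) := rfl
  have e3 : numCycles c.opp = numCycles d.gluing.oppA := rfl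
  have e4 : numCycles d.glue.next = numCycles d.gluing.next := rfl
  have e5 : numCycles d.glue.face = numCycles (d.gluing.next⁻¹ * d.gluing.opp) := rfl
  have e6 : numCycles d.glue.opp = numCycles d.gluing.opp := rfl
  rw [PreMap.Planar, PreMap.Planar]
  omega

theorem opp_coreMark (i : K) (ε : Bool) : c.opp (d.coreMark (i, ε)) = d.coreMark (i, !ε) :=
  d.gluing.oppA_j (i, ε)

theorem opp_innerMark (i : K) (ε : Bool) :
    (d.n i).opp (d.innerEnd i ε) = (d.innerEnd i (!ε)) :=
  eq_of_heq (Sigma.mk.inj (d.gluing.oppB_k (i, ε))).2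

theorem eq_of_vtx_coreMark (hc : c.Loopless) {i : K} {ε ε' : Bool}
    (h : c.vtx (d.coreMark (i, ε)) = c.vtx (d.coreMark (i, ε'))) : ε = ε' := by
  by_contra hne
  obtain rfl : ε' = !ε := by
    cases ε <;> cases ε' <;> first | rfl | exact absurd rfl hne
  rw [← d.opp_coreMark] at h
  exact hc _ h

theorem sameCycle_nextB_mk {i : K} {y y' : Y i} :
    d.gluing.nextB.SameCycle ⟨i, y⟩ ⟨i, y'⟩ ↔ (d.n i).vtx y = (d.n i).vtx y' :=
  (sameCycle_sigmaCongrRight_mk fun i => (d.n i).next).trans (d.n i).vtx_eq_iff.symm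

theorem fst_eq_of_sameCycle_nextB {x y : Σ i, Y i} (h : d.gluing.nextB.SameCycle x y) :
    x.1 = y.1 :=
  (Sigma.mk.inj ((sameCycle_sigmaCongrRight (fun i => (d.n i).next) _ _).1 h)).1

/-- The vertices of the glued map. -/
noncomputable def vtx : A ⊕ (Σ i, Y i) → PermOrbit c.next ⊕ PermOrbit d.gluing.nextB :=
  d.gluing.vtx

theorem vtx_inl (a : A) : d.vtx (.inl a) = .inl (c.vtx a) := rfl

/-- Either the origin of an inserted half-edge is interior, or it is a vertex of the core. -/
theorem vtx_inr_cases (i : K) (y : Y i) :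
    (∃ ε, (d.n i).vtx (d.innerEnd i ε) = (d.n i).vtx y ∧
      d.vtx (.inr ⟨i, y⟩) = .inl (c.vtx (d.coreMark (i, ε)))) ∨
    d.vtx (.inr ⟨i, y⟩) = .inr (Quotient.mk _ ⟨i, y⟩) := by
  by_cases h : ∃ p, d.gluing.nextB.SameCycle (d.gluing.k p) ⟨i, y⟩
  · obtain ⟨⟨i', ε⟩, hp⟩ := h
    obtain rfl : i' = i := d.fst_eq_of_sameCycle_nextB hp
    refine Or.inl ⟨ε, d.sameCycle_nextB_mk.1 hp, ?_⟩
    exact d.gluing.vtx_inr_of_sameCycle hp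
  · push Not at h
    exact Or.inr (d.gluing.vtx_inr h)

variable [Finite A] [Finite K] [∀ i, Finite (Y i)]

/-- A closed set spreads over the whole of any piece it meets, and crosses the seams because `seam`
keeps a half-edge at its vertex. -/
theorem connected_glue (hc : c.Connected) (hn : ∀ i, (d.n i).Connected) : d.glue.Connected := by
  intro S hS h1 h2
  change ∀ x ∈ S, d.gluing.next x ∈ S at h1
  change ∀ x ∈ S, d.gluing.opp x ∈ S at h2
  have hY : ∀ i y, .inr ⟨i, y⟩ ∈ S → ∀ y', .inr ⟨i, y'⟩ ∈ S := by
    intro i y hy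
    refine hn i {y : Y i | (.inr ⟨i, y⟩ : A ⊕ Σ i, Y i) ∈ S} ⟨y, hy⟩ (fun y hy => ?_) fun y hy => ?_
    · exact d.gluing.nextB_mem_of_closed h1 (b := ⟨i, y⟩) hy
    · exact d.gluing.oppB_mem_of_closed h1 h2 (b := ⟨i, y⟩) hy
  have hA : ∀ a, .inl a ∈ S → ∀ a', .inl a' ∈ S := by
    intro a ha
    refine hc {a : A | (.inl a : A ⊕ Σ i, Y i) ∈ S} ⟨a, ha⟩ (fun a ha => ?_) fun a ha => ?_
    · exact d.gluing.nextA_mem_of_closed h1 ha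
    · exact d.gluing.oppA_mem_of_closed h1 h2 ha
  have hA' : ∀ a, .inl a ∈ S := by
    obtain ⟨x, hx⟩ := hS
    rcases x with a | ⟨i, y⟩
    · exact hA a hx
    · have h3 := hY i y hx (d.innerEnd i true)
      have h4 := d.gluing.seam_mem_of_closed h1 h3
      exact hA _ ((d.gluing.seam_inr_k (i, true)) ▸ h4)
  rintro (a | ⟨i, y⟩)
  · exact hA' a
  · have h4 := d.gluing.seam_mem_of_closed h1 (hA' (d.coreMark (i, true)))
    exact hY i (d.innerEnd i true) ((d.gluing.seam_inl_j (i, true)) ▸ h4) y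

theorem vtx_glue_iff {x y : A ⊕ Σ i, Y i} :
    d.glue.vtx x = d.glue.vtx y ↔ d.vtx x = d.vtx y :=
  d.glue.vtx_eq_iff.trans (d.gluing.sameCycle_iff x y)

theorem vtx_glue_inl_iff {a a' : A} :
    d.glue.vtx (.inl a) = d.glue.vtx (.inl a') ↔ c.vtx a = c.vtx a' := by
  rw [vtx_glue_iff, d.vtx_inl, d.vtx_inl, Sum.inl.injEq]

theorem vtx_glue_seam (x : A ⊕ Σ i, Y i) : d.glue.vtx (d.gluing.seam x) = d.glue.vtx x :=
  d.vtx_glue_iff.2 (d.gluing.vtx_seam x)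

theorem vtx_glue_opp_inl (a : A) : d.glue.vtx (d.glue.opp (.inl a)) = d.glue.vtx (.inl (c.opp a)) :=
  d.vtx_glue_seam (.inl (c.opp a))

theorem vtx_glue_opp_inr (i : K) (y : Y i) :
    d.glue.vtx (d.glue.opp (.inr ⟨i, y⟩)) = d.glue.vtx (.inr ⟨i, (d.n i).opp y⟩) :=
  d.vtx_glue_seam (.inr ⟨i, (d.n i).opp y⟩)

theorem vtx_glue_inr_of_eq {i : K} {y y' : Y i} (h : (d.n i).vtx y = (d.n i).vtx y') :
    d.glue.vtx (.inr ⟨i, y⟩) = d.glue.vtx (.inr ⟨i, y'⟩) :=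
  d.vtx_glue_iff.2 (d.gluing.vtx_inr_congr
    (d.sameCycle_nextB_mk.2 h))

theorem vtx_glue_innerMark (p : K × Bool) :
    d.glue.vtx (.inr (d.innerMark p)) = d.glue.vtx (.inl (d.coreMark p)) :=
  d.vtx_glue_iff.2 (d.gluing.vtx_inr_k p)

/-- Inserted half-edges with the same origin in the glued map. -/
theorem vtx_inr_eq_cases {i i' : K} {y : Y i} {y' : Y i'}
    (h : d.glue.vtx (.inr ⟨i, y⟩) = d.glue.vtx (.inr ⟨i', y'⟩)) :
    (∃ ε ε', (d.n i).vtx (d.innerEnd i ε) = (d.n i).vtx y ∧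
      (d.n i').vtx (d.innerEnd i' ε') = (d.n i').vtx y' ∧
      c.vtx (d.coreMark (i, ε)) = c.vtx (d.coreMark (i', ε'))) ∨
    ∃ e : i = i', (d.n i').vtx (e ▸ y) = (d.n i').vtx y' := by
  rw [vtx_glue_iff] at h
  rcases d.vtx_inr_cases i y with ⟨ε, h1, h2⟩ | h2 <;>
    rcases d.vtx_inr_cases i' y' with ⟨ε', h1', h2'⟩ | h2'
  · rw [h2, h2', Sum.inl.injEq] at h
    exact Or.inl ⟨ε, ε', h1, h1', h⟩
  · simp [h2, h2'] at h
  · simp [h2, h2'] at h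
  · rw [h2, h2', Sum.inr.injEq] at h
    have h3 := mk_eq_mk_iff.1 h
    obtain rfl : i = i' := d.fst_eq_of_sameCycle_nextB h3
    exact Or.inr ⟨rfl, d.sameCycle_nextB_mk.1 h3⟩

/-- Distinct vertices of an inserted map remain distinct. -/
theorem vtx_glue_inr_iff (hc : c.Loopless) {i : K} {y y' : Y i} :
    d.glue.vtx (.inr ⟨i, y⟩) = d.glue.vtx (.inr ⟨i, y'⟩) ↔ (d.n i).vtx y = (d.n i).vtx y' := by
  refine ⟨fun h => ?_, d.vtx_glue_inr_of_eq⟩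
  rcases d.vtx_inr_eq_cases h with ⟨ε, ε', h1, h2, h3⟩ | ⟨_, h⟩
  · rw [d.eq_of_vtx_coreMark hc h3] at h1
    exact h1.symm.trans h2
  · exact h

theorem loopless_glue (hc : c.Loopless) (hn : ∀ i, (d.n i).Loopless) : d.glue.Loopless := by
  rintro (a | ⟨i, y⟩) h
  · rw [vtx_glue_opp_inl, vtx_glue_inl_iff] at h
    exact hc a h
  · rw [vtx_glue_opp_inr, vtx_glue_inr_iff _ hc] at h
    exact hn i y h

/-- In the glued map, a half-edge of a simple core is parallel only to itself and, if it is
marked, to half-edges of the inserted map that start at the root vertex. -/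
theorem eq_or_of_parallel_inl (hc : c.Simple) (hn : ∀ i, (d.n i).Loopless) {a : A}
    {x : A ⊕ Σ i, Y i} (h : d.glue.Parallel x (.inl a)) : x = .inl a ∨ ∃ i ε y,
      a = d.coreMark (i, ε) ∧ x = .inr ⟨i, y⟩ ∧
        (d.n i).vtx (d.innerEnd i ε) = (d.n i).vtx y := by
  obtain ⟨h1, h2⟩ := h
  rw [vtx_glue_opp_inl] at h2
  rcases x with a' | ⟨i, y⟩
  · rw [vtx_glue_opp_inl, vtx_glue_inl_iff] at h2
    rw [vtx_glue_inl_iff] at h1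
    exact Or.inl (congrArg _ (hc.2 _ _ ⟨h1, h2⟩))
  · right
    rw [vtx_glue_opp_inr, vtx_glue_iff] at h2
    rw [vtx_glue_iff] at h1
    rcases d.vtx_inr_cases i y with ⟨ε, h3, h4⟩ | h4
    · rcases d.vtx_inr_cases i ((d.n i).opp y) with ⟨ε', h5, h6⟩ | h6
      · have hε : ε' = !ε := by
          have : ε ≠ ε' := by
            rintro rfl
            exact hn i y (h3.symm.trans h5)
          cases ε <;> cases ε' <;> simp_all
        subst hε
        rw [h4, d.vtx_inl, Sum.inl.injEq] at h1
        rw [h6, ← d.opp_coreMark, d.vtx_inl, Sum.inl.injEq] at h2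
        exact ⟨i, ε, y, (hc.2 _ _ ⟨h1, h2⟩).symm, rfl, h3⟩
      · rw [h6, d.vtx_inl] at h2
        simp at h2
    · rw [h4, d.vtx_inl] at h1
      simp at h1

end Decoration

/-! ### 2-connectedness of a glued map and of its pieces. -/

namespace Decoration

variable {A K : Type} {c : PreMap A} {Y : K → Type} (d : Decoration c Y)

/-- A set that respects the seam and the edges of all the pieces respects the edges of the glued
map. -/
theorem opp_mem_of_seam {S : Set (A ⊕ Σ i, Y i)}
    (h1 : ∀ p, .inl (d.coreMark p) ∈ S ↔ .inr (d.innerMark p) ∈ S)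
    (h2 : ∀ a, .inl a ∈ S → .inl (c.opp a) ∈ S)
    (h3 : ∀ i y, .inr ⟨i, y⟩ ∈ S → .inr ⟨i, (d.n i).opp y⟩ ∈ S) :
    ∀ x ∈ S, d.glue.opp x ∈ S := by
  have hs : ∀ x ∈ S, d.gluing.seam x ∈ S := by
    intro x
    induction x using d.gluing.sum_cases with
    | h1 p => rw [Gluing.seam_inl_j]; exact (h1 p).1
    | h2 a h => rw [d.gluing.seam_inl h]; exact id
    | h3 p => rw [Gluing.seam_inr_k]; exact (h1 p).2
    | h4 b h => rw [d.gluing.seam_inr h]; exact id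
  rintro (a | ⟨i, y⟩) hx
  · exact hs _ (h2 a hx)
  · exact hs _ (h3 i y hx)

variable [Finite A] [Finite K] [∀ i, Finite (Y i)]

/-- If a set of edges and its complement shared at most one vertex, the set could not split a seam,
hence would induce a set of edges on each piece. Vertices of a piece stay distinct after gluing, so
each piece would lie on one side, and the seams would force all pieces onto the same side. -/
theorem twoConnected_glue (hc : c.Loopless) (h2c : c.TwoConnected)
    (h2n : ∀ i, (d.n i).TwoConnected) : d.glue.TwoConnected := by
  intro S hS hne hne'
  by_contra! H
  have hmix : ∀ x y x' y', x ∈ S → y ∉ S → d.glue.vtx x = d.glue.vtx y → x' ∈ S → y' ∉ S →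
      d.glue.vtx x' = d.glue.vtx y' → d.glue.vtx x = d.glue.vtx x' := fun x y x' y' => H x y x' y'
  have hoj : ∀ i ε, d.glue.opp (.inl (d.coreMark (i, ε))) = .inr (d.innerMark (i, !ε)) :=
    fun i ε => d.gluing.opp_inl_j (i, ε)
  have hok : ∀ i ε, d.glue.opp (.inr (d.innerMark (i, ε))) = .inl (d.coreMark (i, !ε)) :=
    fun i ε => d.gluing.opp_inr_k (i, ε)
  have hcm : ∀ i ε, d.glue.vtx (.inl (d.coreMark (i, ε))) ≠
      d.glue.vtx (.inl (d.coreMark (i, !ε))) := by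
    intro i ε h
    rw [vtx_glue_inl_iff] at h
    have := d.eq_of_vtx_coreMark hc h
    cases ε <;> cases this
  -- If `S` separates the two half-edges at a mark, it also separates their opposites, which sit at
  -- the other end of the seam. These are two shared vertices, distinct because the core is
  -- loopless.
  have h1 : ∀ p, .inl (d.coreMark p) ∈ S ↔ .inr (d.innerMark p) ∈ S := by
    rintro ⟨i, ε⟩
    have e1 := PreMap.opp_mem_iff hS (.inl (d.coreMark (i, ε)))
    have e2 := PreMap.opp_mem_iff hS (.inr (d.innerMark (i, ε)))
    rw [hoj] at e1
    rw [hok] at e2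
    by_contra hne
    by_cases hj : .inl (d.coreMark (i, ε)) ∈ S
    · have hk : .inr (d.innerMark (i, ε)) ∉ S := fun hk => hne (iff_of_true hj hk)
      refine hcm i ε ((hmix _ _ _ _ hj hk (d.vtx_glue_innerMark _).symm (e1.2 hj)
        (fun h => hk (e2.1 h)) (d.vtx_glue_innerMark _)).trans (d.vtx_glue_innerMark _))
    · have hk : .inr (d.innerMark (i, ε)) ∈ S := by
        by_contra hk
        exact hne (iff_of_false hj hk)
      refine hcm i ε ((d.vtx_glue_innerMark _).symm.trans (hmix _ _ _ _ hk hj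
        (d.vtx_glue_innerMark _) (e2.2 hk) (fun h => hj (e1.1 h)) (d.vtx_glue_innerMark _).symm))
  have hs : ∀ x ∈ S, d.gluing.seam x ∈ S := by
    intro x
    induction x using d.gluing.sum_cases with
    | h1 p => rw [Gluing.seam_inl_j]; exact (h1 p).1
    | h2 a h => rw [d.gluing.seam_inl h]; exact id
    | h3 p => rw [Gluing.seam_inr_k]; exact (h1 p).2
    | h4 b h => rw [d.gluing.seam_inr h]; exact id
  have hA : (∀ a, .inl a ∈ S) ∨ ∀ a, .inl a ∉ S := by
    by_contra! hA
    obtain ⟨⟨a, ha⟩, a', ha'⟩ := hA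
    obtain ⟨x, y, x', y', hx, hy, hxy, hx', hy', hxy', hne⟩ := h2c {a | (.inl a : A ⊕ Σ i, Y i) ∈ S}
      (fun a ha => by
        have := hs _ (hS _ ha)
        rwa [show d.glue.opp (.inl a) = d.gluing.seam (.inl (c.opp a)) from rfl,
          Gluing.seam_seam] at this) ⟨a', ha'⟩ ⟨a, ha⟩
    exact hne (d.vtx_glue_inl_iff.1 (hmix _ _ _ _ hx hy (d.vtx_glue_inl_iff.2 hxy) hx' hy'
      (d.vtx_glue_inl_iff.2 hxy')))
  have hB : ∀ i, (∀ y, .inr ⟨i, y⟩ ∈ S) ∨ ∀ y, .inr ⟨i, y⟩ ∉ S := by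
    intro i
    by_contra! hB
    obtain ⟨⟨a, ha⟩, a', ha'⟩ := hB
    obtain ⟨x, y, x', y', hx, hy, hxy, hx', hy', hxy', hne⟩ :=
      h2n i {y | (.inr ⟨i, y⟩ : A ⊕ Σ i, Y i) ∈ S}
      (fun a ha => by
        have := hs _ (hS _ ha)
        rwa [show d.glue.opp (.inr ⟨i, a⟩) = d.gluing.seam (.inr ⟨i, (d.n i).opp a⟩) from rfl,
          Gluing.seam_seam] at this) ⟨a', ha'⟩ ⟨a, ha⟩
    exact hne ((d.vtx_glue_inr_iff hc).1 (hmix _ _ _ _ hx hy ((d.vtx_glue_inr_iff hc).2 hxy) hx' hy'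
      ((d.vtx_glue_inr_iff hc).2 hxy')))
  obtain ⟨x, hx⟩ := hne
  obtain ⟨x', hx'⟩ := hne'
  rcases hA with hA | hA
  · rcases x' with a | ⟨i, y⟩
    · exact hx' (hA a)
    · rcases hB i with hB | hB
      · exact hx' (hB y)
      · exact hB _ ((h1 (i, true)).1 (hA _))
  · rcases x with a | ⟨i, y⟩
    · exact hA _ hx
    · rcases hB i with hB | hB
      · exact hA _ ((h1 (i, true)).2 (hB _))
      · exact hB y hx

/-- Extend a set of core edges by letting each inserted map follow the core edge that carries it.
Interior vertices of inserted maps are then not shared by the two parts, so the shared vertices are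
core vertices. -/
theorem twoConnected_core (h : d.glue.TwoConnected) : c.TwoConnected := by
  rintro S hS ⟨a, ha⟩ ⟨a', ha'⟩
  let T : Set (A ⊕ Σ i, Y i) := {x | Sum.elim (· ∈ S) (fun b => d.o b.1 ∈ S) x}
  have hcm : ∀ p, d.coreMark p ∈ S ↔ d.o p.1 ∈ S := by
    rintro ⟨i, _ | _⟩
    · exact PreMap.opp_mem_iff hS _
    · rfl
  have key : ∀ x y, x ∈ T → y ∉ T → d.glue.vtx x = d.glue.vtx y →
      ∃ a b, a ∈ S ∧ b ∉ S ∧ c.vtx a = c.vtx b ∧ d.glue.vtx x = d.glue.vtx (.inl a) := by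
    have lift : ∀ x, (∃ a, d.glue.vtx x = d.glue.vtx (.inl a) ∧ (a ∈ S ↔ x ∈ T)) ∨
        ∃ b, x = .inr b ∧ d.vtx x = .inr (Quotient.mk _ b) := by
      rintro (a | ⟨i, y⟩)
      · exact Or.inl ⟨a, rfl, Iff.rfl⟩
      · rcases d.vtx_inr_cases i y with ⟨ε, h1, h2⟩ | h1
        · exact Or.inl ⟨_, d.vtx_glue_iff.2 h2, hcm _⟩
        · exact Or.inr ⟨_, rfl, h1⟩
    intro x y hx hy hxy
    rcases lift x with ⟨a, h1, h2⟩ | ⟨b, rfl, h1⟩ <;> rcases lift y with ⟨a', h1', h2'⟩ | ⟨b', rfl, h1'⟩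
    · exact ⟨a, a', h2.2 hx, fun h => hy (h2'.1 h),
        d.vtx_glue_inl_iff.1 (h1.symm.trans (hxy.trans h1')), h1⟩
    · have := d.vtx_glue_iff.1 (hxy.symm.trans h1)
      simp [h1', vtx_inl] at this
    · have := d.vtx_glue_iff.1 (hxy.trans h1')
      simp [h1, vtx_inl] at this
    · rw [vtx_glue_iff, h1, h1', Sum.inr.injEq] at hxy
      have h3 := d.fst_eq_of_sameCycle_nextB (mk_eq_mk_iff.1 hxy)
      refine absurd ?_ hy
      change d.o b'.1 ∈ S
      rw [← h3]
      exact hx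
  obtain ⟨x, y, x', y', hx, hy, hxy, hx', hy', hxy', hne⟩ := h T
    (d.opp_mem_of_seam hcm (fun a => hS a) fun i y => id) ⟨.inl a, ha⟩ ⟨.inl a', ha'⟩
  obtain ⟨a, b, h1, h2, h3, h4⟩ := key x y hx hy hxy
  obtain ⟨a', b', h1', h2', h3', h4'⟩ := key x' y' hx' hy' hxy'
  refine ⟨a, b, a', b', h1, h2, h3, h1', h2', h3', fun h => hne ?_⟩
  rw [h4, h4', vtx_glue_inl_iff, h]

/-- Extend a set of edges of one inserted map by letting everything outside follow its root edge. A
shared vertex is then seen inside the inserted map, where the root edge stands in for the outside.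
-/
theorem twoConnected_inserted (hc : c.Loopless) (h : d.glue.TwoConnected) (i : K) :
    (d.n i).TwoConnected := by
  rintro S hS ⟨y₁, hy₁⟩ ⟨y₂, hy₂⟩
  let T : Set (A ⊕ Σ i, Y i) := {x | (∃ y ∈ S, x = .inr ⟨i, y⟩) ∨
    (¬ ∃ y, x = .inr ⟨i, y⟩) ∧ (d.n i).root ∈ S}
  have hT : ∀ y, .inr ⟨i, y⟩ ∈ T ↔ y ∈ S := by
    intro y
    simp [T]
  have hT' : ∀ x : A ⊕ Σ i, Y i, (¬ ∃ y, x = .inr ⟨i, y⟩) → (x ∈ T ↔ (d.n i).root ∈ S) := by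
    intro x hx
    have : ¬ ∃ y ∈ S, x = .inr ⟨i, y⟩ := fun ⟨y, _, h⟩ => hx ⟨y, h⟩
    exact ⟨fun h => (h.resolve_left this).2, fun h => Or.inr ⟨hx, h⟩⟩
  have him : ∀ ε, (d.innerEnd i ε) ∈ S ↔ (d.n i).root ∈ S := by
    rintro (_ | _)
    · exact PreMap.opp_mem_iff hS _
    · rfl
  have hother : ∀ i' y, i' ≠ i → (.inr ⟨i', y⟩ ∈ T ↔ (d.n i).root ∈ S) := by
    intro i' y hi
    refine hT' _ ?_
    rintro ⟨y, h⟩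
    exact hi (congrArg Sigma.fst (Sum.inr_injective h))
  have hcore : ∀ a, .inl a ∈ T ↔ (d.n i).root ∈ S := fun a => hT' _ (by simp)
  have hclosed : ∀ x ∈ T, d.glue.opp x ∈ T := by
    refine d.opp_mem_of_seam ?_ ?_ ?_
    · rintro ⟨i', ε⟩
      rw [hcore]
      rcases eq_or_ne i' i with rfl | hi
      · exact (him ε).symm.trans (hT _).symm
      · exact (hother i' _ hi).symm
    · intro a ha
      rw [hcore] at ha ⊢
      exact ha
    · intro i' y hy
      rcases eq_or_ne i' i with rfl | hi
      · rw [hT] at hy ⊢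
        exact hS _ hy
      · rw [hother _ _ hi] at hy ⊢
        exact hy
  have key : ∀ y x, (.inr ⟨i, y⟩ ∈ T ↔ x ∉ T) → d.glue.vtx (.inr ⟨i, y⟩) = d.glue.vtx x →
      ∃ z, (z ∈ S ↔ x ∈ T) ∧ (d.n i).vtx y = (d.n i).vtx z := by
    intro y x hyx hv
    by_cases hx : ∃ z, x = .inr ⟨i, z⟩
    · obtain ⟨z, rfl⟩ := hx
      exact ⟨z, (hT z).symm, (d.vtx_glue_inr_iff hc).1 hv⟩
    · have h1 := hT' x hx
      rcases d.vtx_inr_cases i y with ⟨ε, h2, -⟩ | h2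
      · exact ⟨_, (him ε).trans h1.symm, h2.symm⟩
      · exfalso
        rcases x with a | ⟨i', z⟩
        · rw [vtx_glue_iff, h2, vtx_inl] at hv
          simp at hv
        · rcases d.vtx_inr_cases i' z with ⟨ε, -, h3⟩ | h3
          · rw [vtx_glue_iff, h2, h3] at hv
            simp at hv
          · rw [vtx_glue_iff, h2, h3, Sum.inr.injEq] at hv
            obtain rfl : i = i' := d.fst_eq_of_sameCycle_nextB (mk_eq_mk_iff.1 hv)
            exact hx ⟨z, rfl⟩
  have key' : ∀ x y, x ∈ T → y ∉ T → d.glue.vtx x = d.glue.vtx y → ∃ z w, z ∈ S ∧ w ∉ S ∧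
      (d.n i).vtx z = (d.n i).vtx w ∧ d.glue.vtx x = d.glue.vtx (.inr ⟨i, z⟩) := by
    intro x y hx hy hxy
    by_cases hxi : ∃ z, x = .inr ⟨i, z⟩
    · obtain ⟨z, rfl⟩ := hxi
      obtain ⟨w, hw, hzw⟩ := key z y (iff_of_true hx hy) hxy
      exact ⟨z, w, (hT z).1 hx, fun h => hy (hw.1 h), hzw, rfl⟩
    · have h1 := (hT' x hxi).1 hx
      by_cases hyi : ∃ z, y = .inr ⟨i, z⟩
      · obtain ⟨w, rfl⟩ := hyi
        obtain ⟨z, hz, hzw⟩ := key w x (iff_of_false hy (fun h => h hx)) hxy.symm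
        exact ⟨z, w, hz.2 hx, fun h => hy ((hT w).2 h), hzw.symm, hxy.trans (d.vtx_glue_inr_of_eq hzw)⟩
      · exact absurd ((hT' y hyi).2 h1) hy
  obtain ⟨x, y, x', y', hx, hy, hxy, hx', hy', hxy', hne⟩ := h T hclosed
    ⟨_, (hT y₁).2 hy₁⟩ ⟨_, fun h => hy₂ ((hT y₂).1 h)⟩
  obtain ⟨z, w, h1, h2, h3, h4⟩ := key' x y hx hy hxy
  obtain ⟨z', w', h1', h2', h3', h4'⟩ := key' x' y' hx' hy' hxy'
  refine ⟨z, w, z', w', h1, h2, h3, h1', h2', h3', fun h => hne ?_⟩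
  rw [h4, h4', d.vtx_glue_inr_of_eq h]

end Decoration

/-! ### Parallel half-edges and the core of a map. -/

namespace PreMap

variable {D D' : Type} (m : PreMap D)

theorem parallel_refl (x : D) : m.Parallel x x := ⟨rfl, rfl⟩

variable {m} in
theorem Parallel.symm {x y : D} (h : m.Parallel x y) : m.Parallel y x := ⟨h.1.symm, h.2.symm⟩

variable {m} in
theorem Parallel.trans {x y z : D} (h : m.Parallel x y) (h' : m.Parallel y z) : m.Parallel x z :=
  ⟨h.1.trans h'.1, h.2.trans h'.2⟩

variable {m} in
theorem Parallel.opp {x y : D} (h : m.Parallel x y) : m.Parallel (m.opp x) (m.opp y) :=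
  ⟨h.2, by simpa [m.opp_opp] using h.1⟩

variable [Finite D]

theorem exists_parallel (x : D) : ∃ j, 0 < j ∧ m.Parallel ((m.next ^ j) x) x :=
  ⟨orderOf m.next, orderOf_pos _, by rw [pow_orderOf_eq_one]; exact m.parallel_refl x⟩

open Classical in
/-- The distance, around the origin, to the next parallel half-edge. -/
noncomputable def gap (x : D) : ℕ := Nat.find (m.exists_parallel x)

/-- The next half-edge around the origin that is parallel to the given one. -/
noncomputable def nextParallel (x : D) : D := (m.next ^ m.gap x) x

theorem gap_pos (x : D) : 0 < m.gap x := by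
  classical exact (Nat.find_spec (m.exists_parallel x)).1

theorem nextParallel_parallel (x : D) : m.Parallel (m.nextParallel x) x := by
  classical exact (Nat.find_spec (m.exists_parallel x)).2

theorem not_parallel_of_lt_gap {x : D} {i : ℕ} (h0 : 0 < i) (h : i < m.gap x) :
    ¬ m.Parallel ((m.next ^ i) x) x := by
  classical exact fun hp => Nat.find_min (m.exists_parallel x) h ⟨h0, hp⟩

theorem gap_eq {x : D} {j : ℕ} (h0 : 0 < j) (hj : m.Parallel ((m.next ^ j) x) x)
    (h : ∀ i, 0 < i → i < j → ¬ m.Parallel ((m.next ^ i) x) x) : m.gap x = j := by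
  rcases lt_trichotomy (m.gap x) j with h1 | h1 | h1
  · exact absurd (m.nextParallel_parallel x) (h _ (m.gap_pos x) h1)
  · exact h1
  · exact absurd hj (m.not_parallel_of_lt_gap h0 h1)

/-- The next parallel half-edge of `x` is `b` when the half-edges parallel to `x` form an arc
that goes from `b` to `x`. -/
theorem nextParallel_eq_of_arc {x b : D} {n : ℕ}
    (hb : m.Parallel b x) (hmin : ∀ i < n, (m.next ^ i) b ≠ x)
    (h : ∀ z, m.Parallel z x → ∃ i ≤ n, z = (m.next ^ i) b) : m.nextParallel x = b := by
  obtain ⟨i, hi, hib⟩ := h _ (m.nextParallel_parallel x)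
  have hg := m.gap_pos x
  have hib' : (m.next ^ m.gap x) x = (m.next ^ i) b := hib
  rcases Nat.eq_zero_or_pos i with rfl | hi0
  · exact hib
  rcases Nat.le_total (m.gap x) i with hle | hle
  · exfalso
    refine hmin (i - m.gap x) (by omega) ?_
    apply (m.next ^ m.gap x).injective
    rw [hib', ← Perm.mul_apply, ← pow_add]
    congr 2
    omega
  · exfalso
    have h1 : (m.next ^ (m.gap x - i)) x = b := by
      apply (m.next ^ i).injective
      rw [← hib', ← Perm.mul_apply, ← pow_add]
      congr 2
      omega
    rcases Nat.eq_or_lt_of_le hle with he | hlt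
    · have hxb : x = b := by simpa [he] using h1
      have hn0 : n = 0 := by
        by_contra hn0
        exact hmin 0 (by omega) (by simpa using hxb.symm)
      omega
    · exact m.not_parallel_of_lt_gap (x := x) (i := m.gap x - i) (by omega) (by omega)
        (by rw [h1]; exact hb)

/-- The end of the cut edge: the composition of `opp` with the passage to the next parallel
half-edge. -/
noncomputable def cutOpp (x : D) : D := m.opp (m.nextParallel x)

/-- The half-edges of the core: those that can be reached from the root along the faces and the
cut edges. -/
def core : Set D :=
  {x | ∀ S : Set D, m.root ∈ S → (∀ y ∈ S, m.face y ∈ S) → (∀ y ∈ S, m.cutOpp y ∈ S) → x ∈ S}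

theorem root_mem_core : m.root ∈ m.core := fun _ h _ _ => h

theorem face_mem_core {x : D} (h : x ∈ m.core) : m.face x ∈ m.core :=
  fun S h1 h2 h3 => h2 _ (h S h1 h2 h3)

theorem cutOpp_mem_core {x : D} (h : x ∈ m.core) : m.cutOpp x ∈ m.core :=
  fun S h1 h2 h3 => h3 _ (h S h1 h2 h3)

theorem core_subset {S : Set D} (h1 : m.root ∈ S) (h2 : ∀ y ∈ S, m.face y ∈ S)
    (h3 : ∀ y ∈ S, m.cutOpp y ∈ S) : m.core ⊆ S := fun _ hx => hx S h1 h2 h3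

/-- The face permutation and the involution generate a transitive action as well. -/
theorem Connected.face_induction {m : PreMap D} (h : m.Connected) {S : Set D} (hS : S.Nonempty)
    (h1 : ∀ x ∈ S, m.face x ∈ S) (h2 : ∀ x ∈ S, m.opp x ∈ S) (x : D) : x ∈ S := by
  refine h S hS (fun y hy => ?_) h2 x
  rw [← opp_mem_iff h2, ← apply_mem_iff h1]
  simpa [face, m.opp_opp] using hy

end PreMap

/-! ### The core of a glued map is the map in which the insertions were made. -/

namespace Decoration

variable {A K : Type} {c : PreMap A} {Y : K → Type} (d : Decoration c Y)
theorem face_inl (a : A) : d.glue.face (.inl a) = .inl (c.face a) := by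
  rw [face_glue]
  rfl

theorem next_pow_innerMark (i : K) (ε : Bool) (n : ℕ)
    (h : ∀ l, 0 < l → l ≤ n → ((d.n i).next ^ l) (d.innerEnd i ε) ≠ (d.innerEnd i ε)) :
    (d.glue.next ^ n) (.inr ⟨i, d.innerEnd i ε⟩) =
      .inr ⟨i, ((d.n i).next ^ n) (d.innerEnd i ε)⟩ := by
  induction n with
  | zero => rfl
  | succ n ih =>
    rw [pow_succ', Perm.mul_apply, ih fun l h0 hl => h l h0 (by omega)]
    change d.gluing.seam (.inr ⟨i, (d.n i).next (((d.n i).next ^ n) (d.innerEnd i ε))⟩) = _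
    rw [← Perm.mul_apply, ← pow_succ']
    refine d.gluing.seam_inr fun p hp => h (n + 1) (by omega) le_rfl ?_
    have : p = (i, ε) := by
      refine d.gluing.k_sep _ _ ?_
      rw [hp]
      exact d.sameCycle_nextB_mk.2 ((d.n i).vtx_eq_iff.2 (Perm.sameCycle_pow_left.2 (Perm.SameCycle.refl _ _)))
    subst this
    exact (eq_of_heq (Sigma.mk.inj hp).2).symm

variable [Finite A] [Finite K] [∀ i, Finite (Y i)]

/-- By simplicity of the core, the half-edges parallel to a marked core half-edge are itself and
some half-edges at an end of the inserted root edge. Around the glued vertex they lie on the arc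
that starts at the inner mark, turns once around that end and exits at the core half-edge. From
there the next one met is the start of the arc. -/
theorem nextParallel_coreMark (hc : c.Simple) (hn : ∀ i, (d.n i).Loopless) (p : K × Bool) :
    d.glue.nextParallel (.inl (d.coreMark p)) = .inr (d.innerMark p) := by
  obtain ⟨i, ε⟩ := p
  set k := d.innerEnd i ε
  have hex : ∃ N, 0 < N ∧ ((d.n i).next ^ N) k = k :=
    ⟨orderOf (d.n i).next, orderOf_pos _, by rw [pow_orderOf_eq_one]; rfl⟩
  classical
  -- `N` is the first return time at the inner mark, that is, the degree of that vertex inside the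
  -- inserted map.
  obtain ⟨hN, hNk⟩ := Nat.find_spec hex
  set N := Nat.find hex
  have hmin : ∀ l, 0 < l → l < N → ((d.n i).next ^ l) k ≠ k := fun l h0 hl h =>
    Nat.find_min hex hl ⟨h0, h⟩
  have hpow : ∀ l < N, (d.glue.next ^ l) (.inr (d.innerMark (i, ε))) =
      .inr ⟨i, ((d.n i).next ^ l) k⟩ := fun l hl =>
    d.next_pow_innerMark i ε l fun l' h0 hl' => hmin l' h0 (by omega)
  refine d.glue.nextParallel_eq_of_arc (n := N) ?_ ?_ ?_
  · refine ⟨d.vtx_glue_innerMark _, ?_⟩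
    have h1 : d.glue.opp (.inl (d.coreMark (i, ε))) = .inr (d.innerMark (i, !ε)) :=
      d.gluing.opp_inl_j (i, ε)
    have h2 : d.glue.opp (.inr (d.innerMark (i, ε))) = .inl (d.coreMark (i, !ε)) :=
      d.gluing.opp_inr_k (i, ε)
    rw [h1, h2]
    exact (d.vtx_glue_innerMark _).symm
  · intro l hl
    rw [hpow l hl]
    simp
  · intro z hz
    rcases d.eq_or_of_parallel_inl hc hn hz with rfl | ⟨i', ε', y, h1, rfl, h2⟩
    · refine ⟨N, le_rfl, ?_⟩
      obtain ⟨M, hM⟩ : ∃ M, N = M + 1 := ⟨N - 1, by omega⟩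
      rw [hM, pow_succ', Perm.mul_apply, hpow M (by omega)]
      change _ = d.gluing.seam (.inr ⟨i, (d.n i).next (((d.n i).next ^ M) k)⟩)
      rw [← Perm.mul_apply, ← pow_succ', ← hM, hNk]
      exact (d.gluing.seam_inr_k (i, ε)).symm
    · obtain ⟨rfl, rfl⟩ := Prod.mk.inj (d.coreMark_inj h1)
      obtain ⟨l, hl, hmin'⟩ := exists_min_pow (x := k) ((d.n i).vtx_eq_iff.1 h2)
      have hlN : l < N := by
        by_contra hlN
        refine hmin' (l - N) (by omega) ?_
        rw [← hl]
        nth_rw 1 [← hNk]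
        rw [← Perm.mul_apply, ← pow_add]
        congr 2
        omega
      exact ⟨l, hlN.le, by rw [hpow l hlN, ← hl]⟩

theorem nextParallel_inl (hc : c.Simple) (hn : ∀ i, (d.n i).Loopless) {a : A}
    (h : ∀ p, d.coreMark p ≠ a) : d.glue.nextParallel (.inl a) = .inl a := by
  rcases d.eq_or_of_parallel_inl hc hn (d.glue.nextParallel_parallel (.inl a)) with
    h1 | ⟨i, ε, y, h1, -⟩
  · exact h1
  · exact absurd h1.symm (h _)

/-- The involution of the core is visible in the glued map alone: at a mark, `nextParallel` moves to
the inner mark, whose opposite is the other half of the core edge. -/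
theorem cutOpp_inl (hc : c.Simple) (hn : ∀ i, (d.n i).Loopless) (a : A) :
    d.glue.cutOpp (.inl a) = .inl (c.opp a) := by
  by_cases h : ∃ p, d.coreMark p = a
  · obtain ⟨⟨i, ε⟩, rfl⟩ := h
    rw [PreMap.cutOpp, d.nextParallel_coreMark hc hn, d.opp_coreMark]
    exact d.gluing.opp_inr_k (i, ε)
  · push Not at h
    rw [PreMap.cutOpp, d.nextParallel_inl hc hn h]
    exact d.gluing.opp_inl h

/-- `face` and `cutOpp` preserve the core half-edges and act on them as the face permutation and the
involution of the core, which is connected. -/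
theorem core_glue (hc : c.Simple) (hcc : c.Connected) (hn : ∀ i, (d.n i).Loopless) :
    d.glue.core = Set.range Sum.inl := by
  refine Set.Subset.antisymm (d.glue.core_subset ⟨c.root, rfl⟩ ?_ ?_) ?_
  · rintro _ ⟨a, rfl⟩
    exact ⟨_, (d.face_inl a).symm⟩
  · rintro _ ⟨a, rfl⟩
    exact ⟨_, (d.cutOpp_inl hc hn a).symm⟩
  · rintro _ ⟨a, rfl⟩
    refine hcc.face_induction (S := {a : A | (.inl a : A ⊕ Σ i, Y i) ∈ d.glue.core})
      ⟨c.root, d.glue.root_mem_core⟩ (fun a ha => ?_) (fun a ha => ?_) a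
    · have := d.glue.face_mem_core ha
      rwa [face_inl] at this
    · have := d.glue.cutOpp_mem_core ha
      rwa [d.cutOpp_inl hc hn] at this

end Decoration

/-! ### Euler's inequality, and restriction to unions of components. -/

namespace PreMap

variable {D : Type}

/-- The genus inequality with a single orbit: `opp * next` is the inverse of the face permutation,
and the half-edges number twice the edges. -/
theorem Connected.euler_le [Finite D] {m : PreMap D} (h : m.Connected) :
    numCycles m.next + numCycles m.face ≤ numCycles m.opp + 2 := by
  have h1 := genus_inequality m.next m.opp
  have h2 := two_mul_numCycles_of_involutive m.opp_opp m.opp_ne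
  have h3 : m.opp * m.next = m.face⁻¹ := by
    rw [face, mul_inv_rev, inv_inv]
    congr 1
    rw [eq_inv_iff_mul_eq_one]
    ext x
    simp [m.opp_opp]
  rw [h3, numCycles_inv] at h1
  have h4 : numOrbits m.next m.opp ≤ 1 := by
    refine Finite.card_le_one_iff_subsingleton.2 ⟨fun p q => ?_⟩
    induction p using Quotient.inductionOn with | h x => ?_
    induction q using Quotient.inductionOn with | h y => ?_
    set r := Perm.SameCycle.setoid m.next ⊔ Perm.SameCycle.setoid m.opp with hr
    refine Quotient.sound (h {z | r x z} ⟨x, r.refl x⟩ (fun z hz => ?_) (fun z hz => ?_) y)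
    · exact r.trans hz ((le_sup_left : Perm.SameCycle.setoid m.next ≤ r)
        (show m.next.SameCycle z (m.next z) from ⟨1, by simp⟩))
    · exact r.trans hz ((le_sup_right : Perm.SameCycle.setoid m.opp ≤ r)
        (show m.opp.SameCycle z (m.opp z) from ⟨1, by simp⟩))
  omega

/-- The restriction of a rotation system to a union of components. -/
def restrict (m : PreMap D) (X : Set D) (h1 : ∀ x, m.next x ∈ X ↔ x ∈ X)
    (h2 : ∀ x, m.opp x ∈ X ↔ x ∈ X) (r : X) : PreMap X where
  next := m.next.subtypePerm h1
  opp := m.opp.subtypePerm h2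
  root := r
  opp_opp d := Subtype.ext (m.opp_opp d)
  opp_ne d h := m.opp_ne d (congrArg Subtype.val h)

end PreMap

namespace PermCycles

theorem numCycles_subtypePerm_add {D : Type} [Finite D] (f : Perm D) (X : Set D)
    (h : ∀ x, f x ∈ X ↔ x ∈ X) (h' : ∀ x, f x ∈ Xᶜ ↔ x ∈ Xᶜ) :
    numCycles (D := X) (f.subtypePerm h) + numCycles (D := (Xᶜ : Set D)) (f.subtypePerm h') =
      numCycles f := by
  classical
  rw [← numCycles_sumCongr]
  refine numCycles_congr (Equiv.Set.sumCompl X) ?_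
  rintro (x | x) <;> rfl

theorem sameCycle_of_agree {D : Type} [Finite D] {f g : Perm D} {S : Set D}
    (hS : ∀ z ∈ S, f z ∈ S) (hfg : ∀ z ∈ S, g z = f z) {x y : D} (hx : x ∈ S)
    (h : f.SameCycle x y) : g.SameCycle x y := by
  have : y ∈ {z | z ∈ S ∧ g.SameCycle x z} := by
    refine mem_of_sameCycle (S := {z | z ∈ S ∧ g.SameCycle x z}) (fun z hz => ⟨hS z hz.1, ?_⟩) h ⟨hx, Perm.SameCycle.refl _ _⟩
    rw [← hfg z hz.1]
    exact Perm.sameCycle_apply_right.2 hz.2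
  exact this.2

end PermCycles

/-! ### Bigons separate the sphere. -/

/-- Two distinct half-edges with the same origin and the same end. -/
structure Bigon {D : Type} (m : PreMap D) where
  a : D
  b : D
  ne : a ≠ b
  parallel : m.Parallel a b

namespace Bigon

variable {D : Type} {m : PreMap D} (B : Bigon m)

open Classical in
/-- The exchange of the two edges of a bigon. -/
noncomputable def seam : Perm D := swap B.a B.b * swap (m.opp B.a) (m.opp B.b)

theorem seam_of_ne {x : D} (h1 : x ≠ B.a) (h2 : x ≠ B.b) (h3 : x ≠ m.opp B.a)
    (h4 : x ≠ m.opp B.b) : B.seam x = x := by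
  classical
  rw [seam, Perm.mul_apply, swap_apply_of_ne_of_ne h3 h4, swap_apply_of_ne_of_ne h1 h2]

variable (hm : m.Loopless)
include hm

theorem a_ne_opp_b : B.a ≠ m.opp B.b := fun h => hm B.b (by rw [← h, B.parallel.1])
theorem b_ne_opp_a : B.b ≠ m.opp B.a := fun h => hm B.a (by rw [← h, B.parallel.1])

theorem seam_a : B.seam B.a = B.b := by
  classical
  rw [seam, Perm.mul_apply, swap_apply_of_ne_of_ne (m.opp_ne _).symm (B.a_ne_opp_b hm),
    swap_apply_left]

theorem seam_b : B.seam B.b = B.a := by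
  classical
  rw [seam, Perm.mul_apply, swap_apply_of_ne_of_ne (B.b_ne_opp_a hm) (m.opp_ne _).symm,
    swap_apply_right]

theorem seam_opp_a : B.seam (m.opp B.a) = m.opp B.b := by
  classical
  rw [seam, Perm.mul_apply, swap_apply_left,
    swap_apply_of_ne_of_ne (B.a_ne_opp_b hm).symm (m.opp_ne _)]

theorem seam_opp_b : B.seam (m.opp B.b) = m.opp B.a := by
  classical
  rw [seam, Perm.mul_apply, swap_apply_right,
    swap_apply_of_ne_of_ne (m.opp_ne _) (B.b_ne_opp_a hm).symm]

omit hm in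
theorem seam_cases {motive : D → Prop} (h1 : motive B.a) (h2 : motive B.b)
    (h3 : motive (m.opp B.a)) (h4 : motive (m.opp B.b))
    (h5 : ∀ x, x ≠ B.a → x ≠ B.b → x ≠ m.opp B.a → x ≠ m.opp B.b → motive x) (x : D) :
    motive x := by
  rcases eq_or_ne x B.a with rfl | ha
  · exact h1
  rcases eq_or_ne x B.b with rfl | hb
  · exact h2
  rcases eq_or_ne x (m.opp B.a) with rfl | ha'
  · exact h3
  rcases eq_or_ne x (m.opp B.b) with rfl | hb'
  · exact h4
  exact h5 x ha hb ha' hb'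

theorem seam_seam (x : D) : B.seam (B.seam x) = x := by
  induction x using B.seam_cases with
  | h1 => rw [B.seam_a hm, B.seam_b hm]
  | h2 => rw [B.seam_b hm, B.seam_a hm]
  | h3 => rw [B.seam_opp_a hm, B.seam_opp_b hm]
  | h4 => rw [B.seam_opp_b hm, B.seam_opp_a hm]
  | h5 x h1 h2 h3 h4 => rw [B.seam_of_ne h1 h2 h3 h4, B.seam_of_ne h1 h2 h3 h4]

theorem seam_opp (x : D) : B.seam (m.opp x) = m.opp (B.seam x) := by
  induction x using B.seam_cases with
  | h1 => rw [B.seam_opp_a hm, B.seam_a hm]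
  | h2 => rw [B.seam_opp_b hm, B.seam_b hm]
  | h3 => rw [B.seam_opp_a hm, m.opp_opp, m.opp_opp, B.seam_a hm]
  | h4 => rw [B.seam_opp_b hm, m.opp_opp, m.opp_opp, B.seam_b hm]
  | h5 x h1 h2 h3 h4 =>
    rw [B.seam_of_ne h1 h2 h3 h4, B.seam_of_ne]
    · exact fun h => h3 (by rw [← h, m.opp_opp])
    · exact fun h => h4 (by rw [← h, m.opp_opp])
    · exact fun h => h1 (m.opp.injective h)
    · exact fun h => h2 (m.opp.injective h)

theorem vtx_seam (x : D) : m.vtx (B.seam x) = m.vtx x := by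
  induction x using B.seam_cases with
  | h1 => rw [B.seam_a hm, B.parallel.1]
  | h2 => rw [B.seam_b hm, B.parallel.1]
  | h3 => rw [B.seam_opp_a hm, B.parallel.2]
  | h4 => rw [B.seam_opp_b hm, B.parallel.2]
  | h5 x h1 h2 h3 h4 => rw [B.seam_of_ne h1 h2 h3 h4]

omit hm in
/-- The rotation system cut along the bigon. -/
noncomputable def cut (hm : m.Loopless) : PreMap D where
  next := B.seam * m.next
  opp := B.seam * m.opp
  root := B.b
  opp_opp d := by
    rw [Perm.mul_apply, Perm.mul_apply, ← B.seam_opp hm, m.opp_opp, B.seam_seam hm]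
  opp_ne d := by
    rw [Perm.mul_apply]
    induction d using B.seam_cases with
    | h1 => rw [B.seam_opp_a hm]; exact (B.a_ne_opp_b hm).symm
    | h2 => rw [B.seam_opp_b hm]; exact (B.b_ne_opp_a hm).symm
    | h3 => rw [m.opp_opp, B.seam_a hm]; exact B.b_ne_opp_a hm
    | h4 => rw [m.opp_opp, B.seam_b hm]; exact B.a_ne_opp_b hm
    | h5 x h1 h2 h3 h4 =>
      rw [B.seam_of_ne]
      · exact m.opp_ne x
      · exact fun h => h3 (by rw [← h, m.opp_opp])
      · exact fun h => h4 (by rw [← h, m.opp_opp])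
      · exact fun h => h1 (m.opp.injective h)
      · exact fun h => h2 (m.opp.injective h)

theorem cut_next (x : D) : (B.cut hm).next x = B.seam (m.next x) := rfl
theorem cut_opp (x : D) : (B.cut hm).opp x = B.seam (m.opp x) := rfl

theorem cut_face : (B.cut hm).face = m.face := by
  change (B.seam * m.next)⁻¹ * (B.seam * m.opp) = _
  rw [mul_inv_rev, mul_assoc, inv_mul_cancel_left, PreMap.face]

theorem cut_opp_a : (B.cut hm).opp B.a = m.opp B.b := B.seam_opp_a hm
theorem cut_opp_b : (B.cut hm).opp B.b = m.opp B.a := B.seam_opp_b hm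

variable [Finite D]

theorem vtx_eq_of_cut {x y : D} (h : (B.cut hm).vtx x = (B.cut hm).vtx y) : m.vtx x = m.vtx y :=
  eq_of_sameCycle (fun x => by rw [cut_next, B.vtx_seam hm, m.vtx_next])
    ((B.cut hm).vtx_eq_iff.1 h)

/-- Each transposition splits one end of the bigon. The ends are different vertices since there is
no loop, so the first split leaves `a` and `b` in a common cycle. -/
theorem numCycles_cut_next : numCycles (B.cut hm).next = numCycles m.next + 2 := by
  classical
  have h1 : numCycles (swap (m.opp B.a) (m.opp B.b) * m.next) = numCycles m.next + 1 :=
    numCycles_swap_mul_of_sameCycle (m.vtx_eq_iff.1 B.parallel.2)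
      fun h => B.ne (m.opp.injective h)
  have h2 : (swap (m.opp B.a) (m.opp B.b) * m.next).SameCycle B.a B.b := by
    refine sameCycle_of_agree (f := m.next) (S := {z | m.vtx z = m.vtx B.a})
      (fun z hz => (m.vtx_next z).trans hz) (fun z hz => ?_) rfl (m.vtx_eq_iff.1 B.parallel.1)
    have hz' : m.vtx (m.next z) = m.vtx B.a := (m.vtx_next z).trans hz
    rw [Perm.mul_apply, swap_apply_of_ne_of_ne]
    · intro h
      rw [h] at hz'
      exact hm _ hz'.symm
    · intro h
      rw [h, ← B.parallel.2] at hz'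
      exact hm _ hz'.symm
  have h3 := numCycles_swap_mul_of_sameCycle h2 B.ne
  rw [h1, ← mul_assoc] at h3
  convert h3 using 3
  change B.seam * m.next = _
  rw [seam]

omit [Finite D] in
/-- A nonempty union of components of the cut map contains one of the two half-edges. -/
theorem a_or_b_mem (hc : m.Connected) {Z : Set D} (hZ : Z.Nonempty)
    (h1 : ∀ x ∈ Z, (B.cut hm).next x ∈ Z) (h2 : ∀ x ∈ Z, (B.cut hm).opp x ∈ Z) :
    B.a ∈ Z ∨ B.b ∈ Z := by
  by_contra! h
  obtain ⟨ha, hb⟩ := h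
  have ha' : m.opp B.a ∉ Z := by
    rw [← B.cut_opp_b hm, PreMap.opp_mem_iff h2]
    exact hb
  have hb' : m.opp B.b ∉ Z := by
    rw [← B.cut_opp_a hm, PreMap.opp_mem_iff h2]
    exact ha
  have hs : ∀ x, B.seam x ∈ Z → x ∈ Z := by
    intro x
    induction x using B.seam_cases with
    | h1 => rw [B.seam_a hm]; exact fun h => absurd h hb
    | h2 => rw [B.seam_b hm]; exact fun h => absurd h ha
    | h3 => rw [B.seam_opp_a hm]; exact fun h => absurd h hb'
    | h4 => rw [B.seam_opp_b hm]; exact fun h => absurd h ha'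
    | h5 x h1 h2 h3 h4 => rw [B.seam_of_ne h1 h2 h3 h4]; exact id
  exact ha (hc Z hZ (fun x hx => hs _ (h1 x hx)) (fun x hx => hs _ (h2 x hx)) B.a)

omit hm [Finite D] in
/-- The side of the bigon that contains the half-edge `a`, in the cut map. -/
def side (hm : m.Loopless) : Set D := {x | ∀ S : Set D, B.a ∈ S →
  (∀ y ∈ S, (B.cut hm).next y ∈ S) → (∀ y ∈ S, (B.cut hm).opp y ∈ S) → x ∈ S}

omit [Finite D] in
theorem a_mem_side : B.a ∈ B.side hm := fun _ h _ _ => h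

theorem next_mem_side (x : D) : (B.cut hm).next x ∈ B.side hm ↔ x ∈ B.side hm :=
  apply_mem_iff (fun _ hx S h1 h2 h3 => h2 _ (hx S h1 h2 h3)) x

omit [Finite D] in
theorem opp_mem_side (x : D) : (B.cut hm).opp x ∈ B.side hm ↔ x ∈ B.side hm :=
  PreMap.opp_mem_iff (fun _ hx S h1 h2 h3 => h3 _ (hx S h1 h2 h3)) x

omit [Finite D] in
theorem opp_b_mem_side : m.opp B.b ∈ B.side hm := by
  rw [← B.cut_opp_a hm, opp_mem_side]
  exact B.a_mem_side hm

variable (hc : m.Connected) (hp : m.Planar)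
include hc hp

/-- A bigon separates the sphere. -/
theorem b_notMem_side : B.b ∉ B.side hm := by
  intro hb
  have hall : ∀ x, x ∈ B.side hm := by
    by_contra! h
    rcases B.a_or_b_mem hm hc (Z := (B.side hm)ᶜ) h
      (fun x hx => (not_congr (B.next_mem_side hm x)).2 hx)
      (fun x hx => (not_congr (B.opp_mem_side hm x)).2 hx) with h | h
    · exact h (B.a_mem_side hm)
    · exact h hb
  -- If `b` were on the side of `a`, the cut map would be connected. Its Euler characteristic is
  -- that of the sphere plus the two new vertices, against `euler_le`.
  have hconn : (B.cut hm).Connected := by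
    intro S hS h1 h2 x
    have hS' : ∀ y ∈ Sᶜ, (B.cut hm).next y ∈ Sᶜ := fun y hy => (not_congr (apply_mem_iff h1 y)).2 hy
    have hS'' : ∀ y ∈ Sᶜ, (B.cut hm).opp y ∈ Sᶜ :=
      fun y hy => (not_congr (PreMap.opp_mem_iff h2 y)).2 hy
    by_cases ha : B.a ∈ S
    · exact hall x S ha h1 h2
    · obtain ⟨y, hy⟩ := hS
      exact absurd hy (hall y Sᶜ ha hS' hS'')
  have h1 := hconn.euler_le
  have h2 := two_mul_numCycles_of_involutive m.opp_opp m.opp_ne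
  have h3 := two_mul_numCycles_of_involutive (B.cut hm).opp_opp (B.cut hm).opp_ne
  rw [B.cut_face, B.numCycles_cut_next] at h1
  rw [PreMap.Planar] at hp
  omega

theorem opp_a_notMem_side : m.opp B.a ∉ B.side hm := by
  rw [← B.cut_opp_b hm, opp_mem_side]
  exact B.b_notMem_side hm hc hp

omit hm hc hp in
/-- The part of the map that lies on the other side of the bigon, with the bigon closed. -/
noncomputable def inner (hm : m.Loopless) (hc : m.Connected) (hp : m.Planar) :
    PreMap ((B.side hm)ᶜ : Set D) :=
  (B.cut hm).restrict (B.side hm)ᶜ (fun x => not_congr (B.next_mem_side hm x))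
    (fun x => not_congr (B.opp_mem_side hm x)) ⟨B.b, B.b_notMem_side hm hc hp⟩

/-- Every component of the cut map contains `a` or `b`, and `a` is on the other side; so each
nonempty closed set here contains the root `b`, and so would its complement. -/
theorem inner_connected : (B.inner hm hc hp).Connected := by
  intro S hS h1 h2
  have key : ∀ T : Set ((B.side hm)ᶜ : Set D), T.Nonempty →
      (∀ x ∈ T, (B.inner hm hc hp).next x ∈ T) → (∀ x ∈ T, (B.inner hm hc hp).opp x ∈ T) →
      (B.inner hm hc hp).root ∈ T := by
    rintro T ⟨y, hy⟩ h1 h2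
    rcases B.a_or_b_mem hm hc (Z := Subtype.val '' T) ⟨_, y, hy, rfl⟩
      (by rintro _ ⟨x, hx, rfl⟩; exact ⟨_, h1 x hx, rfl⟩)
      (by rintro _ ⟨x, hx, rfl⟩; exact ⟨_, h2 x hx, rfl⟩) with ⟨x, hx, hxa⟩ | ⟨x, hx, hxb⟩
    · exact absurd (hxa ▸ B.a_mem_side hm) x.2
    · rwa [show (B.inner hm hc hp).root = x from Subtype.ext hxb.symm]
  have hr := key S hS h1 h2
  by_contra! h
  refine key Sᶜ h (fun x hx => ?_) (fun x hx => ?_) hr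
  · exact (not_congr (apply_mem_iff h1 x)).2 hx
  · exact (not_congr (PreMap.opp_mem_iff h2 x)).2 hx

/-- The two sides have Euler characteristics at most 2 that add up to 4, so both equal 2. -/
theorem inner_planar : (B.inner hm hc hp).Planar := by
  let O : PreMap (B.side hm) := (B.cut hm).restrict (B.side hm) (B.next_mem_side hm)
    (B.opp_mem_side hm) ⟨B.a, B.a_mem_side hm⟩
  have hO : O.Connected := by
    intro S hS h1 h2
    have key : ∀ T : Set (B.side hm), T.Nonempty → (∀ x ∈ T, O.next x ∈ T) →
        (∀ x ∈ T, O.opp x ∈ T) → O.root ∈ T := by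
      rintro T ⟨y, hy⟩ h1 h2
      rcases B.a_or_b_mem hm hc (Z := Subtype.val '' T) ⟨_, y, hy, rfl⟩
        (by rintro _ ⟨x, hx, rfl⟩; exact ⟨_, h1 x hx, rfl⟩)
        (by rintro _ ⟨x, hx, rfl⟩; exact ⟨_, h2 x hx, rfl⟩) with ⟨x, hx, hxa⟩ | ⟨x, hx, hxb⟩
      · rwa [show O.root = x from Subtype.ext hxa.symm]
      · exact absurd (hxb ▸ x.2) (B.b_notMem_side hm hc hp)
    have hr := key S hS h1 h2
    by_contra! h
    refine key Sᶜ h (fun x hx => ?_) (fun x hx => ?_) hr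
    · exact (not_congr (apply_mem_iff h1 x)).2 hx
    · exact (not_congr (PreMap.opp_mem_iff h2 x)).2 hx
  have h1 := hO.euler_le
  have h2 := (B.inner_connected hm hc hp).euler_le
  have e1 : numCycles O.next + numCycles (B.inner hm hc hp).next = numCycles (B.cut hm).next :=
    numCycles_subtypePerm_add _ _ (B.next_mem_side hm) fun x => not_congr (B.next_mem_side hm x)
  have e2 : numCycles O.opp + numCycles (B.inner hm hc hp).opp = numCycles (B.cut hm).opp :=
    numCycles_subtypePerm_add _ _ (B.opp_mem_side hm) fun x => not_congr (B.opp_mem_side hm x)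
  have e3 : numCycles O.face + numCycles (B.inner hm hc hp).face = numCycles (B.cut hm).face :=
    numCycles_subtypePerm_add (B.cut hm).face (B.side hm)
      (fun x => by
        rw [← B.next_mem_side hm]
        simp [PreMap.face, B.opp_mem_side hm])
      (fun x => not_congr (by
        rw [← B.next_mem_side hm]
        simp [PreMap.face, B.opp_mem_side hm]))
  have h3 := two_mul_numCycles_of_involutive m.opp_opp m.opp_ne
  have h4 := two_mul_numCycles_of_involutive (B.cut hm).opp_opp (B.cut hm).opp_ne
  rw [B.cut_face] at e3
  rw [B.numCycles_cut_next] at e1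
  rw [PreMap.Planar] at hp ⊢
  omega

end Bigon

theorem PermCycles.pow_sub_apply {D : Type} {f : Perm D} {x y : D} {l n : ℕ} (h : (f ^ l) x = y)
    (hn : (f ^ n) x = x) (hle : n ≤ l) : (f ^ (l - n)) x = y := by
  rw [← h]
  nth_rw 1 [← hn]
  rw [← Perm.mul_apply, ← pow_add]
  congr 2
  omega

/-! ### The core lies on one side of each bigon. -/

namespace Bigon

variable {D : Type} {m : PreMap D} (B : Bigon m)

theorem seam_of_vtx {x : D} (h1 : m.vtx x ≠ m.vtx B.a) (h2 : m.vtx x ≠ m.vtx (m.opp B.a)) :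
    B.seam x = x := by
  refine B.seam_of_ne ?_ ?_ ?_ ?_
  · rintro rfl; exact h1 rfl
  · rintro rfl; exact h1 B.parallel.1.symm
  · rintro rfl; exact h2 rfl
  · rintro rfl; exact h2 B.parallel.2.symm

theorem seam_of_not_parallel {x : D} (h1 : ¬ m.Parallel x B.a) (h2 : ¬ m.Parallel x (m.opp B.a)) :
    B.seam x = x := by
  refine B.seam_of_ne ?_ ?_ ?_ ?_
  · rintro rfl; exact h1 (m.parallel_refl _)
  · rintro rfl; exact h1 B.parallel.symm
  · rintro rfl; exact h2 (m.parallel_refl _)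
  · rintro rfl; exact h2 B.parallel.opp.symm

variable (hm : m.Loopless)
include hm

theorem seam_of_vtx_eq {x z : D} (hx : m.Parallel x B.a ∨ m.Parallel x (m.opp B.a))
    (hz : m.vtx z = m.vtx x) (hzx : ¬ m.Parallel z x) : B.seam z = z := by
  rcases hx with hx | hx
  · refine B.seam_of_not_parallel (fun h => hzx (h.trans hx.symm)) fun h => ?_
    exact hm B.a (hx.1.symm.trans (hz.symm.trans h.1))
  · refine B.seam_of_not_parallel (fun h => ?_) (fun h => hzx (h.trans hx.symm))
    exact hm B.a (h.1.symm.trans (hz.trans hx.1))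

variable [Finite D] {S : Set D} (h1 : ∀ x, (B.cut hm).next x ∈ S ↔ x ∈ S)
  (h2 : ∀ x, (B.cut hm).opp x ∈ S ↔ x ∈ S)
include h1

omit [Finite D] in
theorem pow_mem {x : D} (hx : x ∈ S) (j : ℕ)
    (h : ∀ i, 0 < i → i ≤ j → B.seam ((m.next ^ i) x) = (m.next ^ i) x) : (m.next ^ j) x ∈ S := by
  induction j with
  | zero => exact hx
  | succ j ih =>
    have h3 := (h1 _).2 (ih fun i h0 hi => h i h0 (by omega))
    rwa [B.cut_next, ← Perm.mul_apply m.next, ← pow_succ', h (j + 1) (by omega) le_rfl] at h3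

theorem mem_of_vtx_eq {y z : D} (hy : y ∈ S) (ha : m.vtx y ≠ m.vtx B.a)
    (ha' : m.vtx y ≠ m.vtx (m.opp B.a)) (hz : m.vtx z = m.vtx y) : z ∈ S := by
  obtain ⟨j, rfl⟩ := (m.vtx_eq_iff.1 hz.symm).exists_nat_pow_eq
  refine B.pow_mem hm h1 hy j fun i _ _ => ?_
  have hi : m.vtx ((m.next ^ i) y) = m.vtx y :=
    m.vtx_eq_iff.2 (Perm.sameCycle_pow_left.2 (Perm.SameCycle.refl _ _))
  exact B.seam_of_vtx (by rwa [hi]) (by rwa [hi])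

/-- Turning from `x` to the next parallel half-edge meets no half-edge of the bigon before the last
step, so the cut rotation agrees with the original one up to there and differs by `seam` at the end.
-/
theorem seam_nextParallel_mem_of_parallel {x : D} (hx : x ∈ S)
    (hxa : m.Parallel x B.a ∨ m.Parallel x (m.opp B.a)) : B.seam (m.nextParallel x) ∈ S := by
  obtain ⟨n, hn⟩ : ∃ n, m.gap x = n + 1 := ⟨m.gap x - 1, by have := m.gap_pos x; omega⟩
  rw [PreMap.nextParallel, hn, pow_succ', Perm.mul_apply, ← B.cut_next hm, h1]
  refine B.pow_mem hm h1 hx n fun i h0 hi => B.seam_of_vtx_eq hm hxa ?_ ?_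
  · exact m.vtx_eq_iff.2 (Perm.sameCycle_pow_left.2 (Perm.SameCycle.refl _ _))
  · exact m.not_parallel_of_lt_gap h0 (by omega)

include h2

/-- A bigon does not divide any other parallel class. One end of `y` is off the bigon, since
otherwise `y` would be a loop or be parallel to the bigon; the rotation around that end is unchanged
by the cut. -/
theorem mem_of_parallel {y z : D} (hy : y ∈ S) (ha : ¬ m.Parallel y B.a)
    (ha' : ¬ m.Parallel y (m.opp B.a)) (hz : m.Parallel z y) : z ∈ S := by
  by_cases hv : m.vtx y ≠ m.vtx B.a ∧ m.vtx y ≠ m.vtx (m.opp B.a)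
  · exact B.mem_of_vtx_eq hm h1 hy hv.1 hv.2 hz.1
  · have hw : m.vtx (m.opp y) ≠ m.vtx B.a ∧ m.vtx (m.opp y) ≠ m.vtx (m.opp B.a) := by
      constructor
      · intro h
        refine hv ⟨fun h' => hm y (h'.trans h.symm), fun h' => ha' ⟨h', ?_⟩⟩
        rw [h, m.opp_opp]
      · intro h
        exact hv ⟨fun h' => ha ⟨h', h⟩, fun h' => hm y (h'.trans h.symm)⟩
    have hyS : m.opp y ∈ S := by
      have := (h2 y).2 hy
      rwa [B.cut_opp, B.seam_opp hm, B.seam_of_not_parallel ha ha'] at this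
    have hzS := B.mem_of_vtx_eq hm h1 hyS hw.1 hw.2 hz.2
    have := (h2 _).2 hzS
    rwa [B.cut_opp, m.opp_opp, B.seam_of_not_parallel (fun h => ha (hz.symm.trans h))
      (fun h => ha' (hz.symm.trans h))] at this

/-- `cutOpp` is also the cut involution after `seam` and `nextParallel`, as `seam` commutes with
`opp` and is an involution. It thus suffices that `seam` of the next parallel half-edge stays in
`S`. -/
theorem cutOpp_mem {x : D} (hx : x ∈ S) : m.cutOpp x ∈ S := by
  have h3 : B.seam (m.nextParallel x) ∈ S := by
    by_cases hxa : m.Parallel x B.a ∨ m.Parallel x (m.opp B.a)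
    · exact B.seam_nextParallel_mem_of_parallel hm h1 hx hxa
    · push Not at hxa
      have hp := m.nextParallel_parallel x
      rw [B.seam_of_not_parallel (fun h => hxa.1 (hp.symm.trans h))
        (fun h => hxa.2 (hp.symm.trans h))]
      exact B.mem_of_parallel hm h1 h2 hx hxa.1 hxa.2 hp
  have h4 := (h2 _).2 h3
  rwa [B.cut_opp, B.seam_opp hm, B.seam_seam hm] at h4

omit [Finite D] in
theorem face_mem {x : D} (hx : x ∈ S) : m.face x ∈ S := by
  rw [← B.cut_face hm, ← h1]
  simpa [PreMap.face] using (h2 x).2 hx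

omit h1 h2

/-- Both sides of a bigon are closed under `face` and `cutOpp`, so the core stays on the side of the
root; as `a` is in the core, this is the side of `a`. -/
theorem core_subset_side (h : B.a ∈ m.core) : m.core ⊆ B.side hm := by
  by_cases hr : m.root ∈ B.side hm
  · exact m.core_subset hr
      (fun _ => B.face_mem hm (B.next_mem_side hm) (B.opp_mem_side hm))
      (fun _ => B.cutOpp_mem hm (B.next_mem_side hm) (B.opp_mem_side hm))
  · have h1 : ∀ x, (B.cut hm).next x ∈ (B.side hm)ᶜ ↔ x ∈ (B.side hm)ᶜ := fun x =>
      not_congr (B.next_mem_side hm x)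
    have h2 : ∀ x, (B.cut hm).opp x ∈ (B.side hm)ᶜ ↔ x ∈ (B.side hm)ᶜ := fun x =>
      not_congr (B.opp_mem_side hm x)
    exact absurd (B.a_mem_side hm) (m.core_subset (S := (B.side hm)ᶜ) hr
      (fun _ => B.face_mem hm h1 h2) (fun _ => B.cutOpp_mem hm h1 h2) h)

end Bigon

/-! ### `cutOpp` is an involution. -/

namespace PreMap

variable {D : Type} [Finite D] {m : PreMap D} (hm : m.Loopless) (hc : m.Connected) (hp : m.Planar)
include hm hc hp

/-- The core contains at most one half-edge of every parallel class. -/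
theorem eq_of_parallel_of_mem_core {x y : D} (hx : x ∈ m.core) (hy : y ∈ m.core)
    (h : m.Parallel x y) : x = y := by
  by_contra hne
  let B : Bigon m := ⟨x, y, hne, h⟩
  exact B.b_notMem_side hm hc hp (B.core_subset_side hm hx hy)

/-- Consecutive parallel edges at one end are consecutive, in the reverse order, at the other end. A
parallel edge `c` violating this would be on both sides of the bigon formed by `a` and its
successor. -/
theorem nextParallel_cutOpp (a : D) : m.nextParallel (m.cutOpp a) = m.opp a := by
  by_contra hne
  have hpar := m.nextParallel_parallel (m.cutOpp a)
  have hpar' : m.Parallel (m.nextParallel (m.cutOpp a)) (m.opp a) :=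
    hpar.trans (m.nextParallel_parallel a).opp
  set c := m.opp (m.nextParallel (m.cutOpp a)) with hcdef
  have hca : m.Parallel c a := by
    have := hpar'.opp
    rwa [m.opp_opp] at this
  have hopc : m.opp c = m.nextParallel (m.cutOpp a) := by rw [hcdef, m.opp_opp]
  have hne' : c ≠ a := fun h => hne (by rw [← hopc, h])
  obtain ⟨l, hl, hmin⟩ := exists_min_pow (m.vtx_eq_iff.1 hca.1.symm)
  have hl0 : 0 < l := Nat.pos_of_ne_zero fun h0 => hne' (by rw [← hl, h0]; rfl)
  have hgl : m.gap a ≤ l := by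
    by_contra h
    exact m.not_parallel_of_lt_gap (x := a) hl0 (by omega) (by rw [hl]; exact hca)
  have hg0 := m.gap_pos a
  -- When `a` is its own successor its gap closes up a turn, so a parallel `c ≠ a` would have been
  -- met earlier.
  by_cases hab : m.nextParallel a = a
  · exact hmin (l - m.gap a) (by omega) (pow_sub_apply hl hab hgl)
  let B : Bigon m := ⟨a, m.nextParallel a, Ne.symm hab, (m.nextParallel_parallel a).symm⟩
  have h1 := B.next_mem_side hm
  have h2 := B.opp_mem_side hm
  have hcb : c ≠ B.b := by
    intro h
    have h3 := B.seam_nextParallel_mem_of_parallel hm h1 (B.opp_b_mem_side hm)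
      (Or.inr B.parallel.opp.symm)
    have h4 : m.nextParallel (m.opp B.b) = m.opp B.b :=
      hopc.symm.trans (congrArg m.opp h)
    rw [h4, B.seam_opp_b hm] at h3
    exact B.opp_a_notMem_side hm hc hp h3
  have hcs : B.seam c = c := by
    refine B.seam_of_ne hne' hcb (fun h => ?_) (fun h => ?_)
    · exact hm a (hca.1.symm.trans (by rw [h]))
    · exact hm a (hca.1.symm.trans (by rw [h, B.parallel.2]))
  -- Seen from the far end: turning from `opp b`, which is on the side of `a`, the next parallel
  -- half-edge is `opp c`.
  have hcX : c ∈ B.side hm := by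
    have h3 := B.seam_nextParallel_mem_of_parallel hm h1 (B.opp_b_mem_side hm)
      (Or.inr B.parallel.opp.symm)
    have h4 : m.nextParallel (m.opp B.b) = m.opp c := hopc.symm
    rw [h4, ← B.cut_opp hm, h2] at h3
    exact h3
  -- Seen from the near end: turning from `b` leads to `c` before either `a` or `b` recurs, so the
  -- seam is never crossed.
  have hcY : c ∈ (B.side hm)ᶜ := by
    have hbc : (m.next ^ (l - m.gap a)) B.b = c := by
      change (m.next ^ (l - m.gap a)) ((m.next ^ m.gap a) a) = c
      rw [← Perm.mul_apply, ← pow_add, Nat.sub_add_cancel hgl, hl]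
    rw [← hbc]
    refine B.pow_mem hm (fun x => not_congr (h1 x)) (B.b_notMem_side hm hc hp) _
      fun i h0 hi => ?_
    have hbi : (m.next ^ i) B.b = (m.next ^ (i + m.gap a)) a := by
      change (m.next ^ i) ((m.next ^ m.gap a) a) = _
      rw [← Perm.mul_apply, ← pow_add]
    have hv : m.vtx ((m.next ^ i) B.b) = m.vtx a := by
      rw [hbi]
      exact m.vtx_eq_iff.2 (Perm.sameCycle_pow_left.2 (Perm.SameCycle.refl _ _))
    refine B.seam_of_ne (fun h => ?_) (fun h => ?_) (fun h => ?_) (fun h => ?_)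
    · rw [hbi] at h
      exact hmin (l - (i + m.gap a)) (by omega) (pow_sub_apply hl h (by omega))
    · rw [hbi, add_comm, pow_add, Perm.mul_apply] at h
      exact hmin (l - i) (by omega) (pow_sub_apply hl ((m.next ^ m.gap a).injective h) (by omega))
    · rw [h] at hv
      exact hm a hv.symm
    · rw [h, ← B.parallel.2] at hv
      exact hm a hv.symm
  exact hcY hcX

theorem cutOpp_cutOpp (a : D) : m.cutOpp (m.cutOpp a) = a := by
  rw [cutOpp, nextParallel_cutOpp hm hc hp, m.opp_opp]

omit hc hp in
theorem cutOpp_ne (a : D) : m.cutOpp a ≠ a := by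
  intro h
  refine hm a ((m.nextParallel_parallel a).1.symm.trans ?_)
  nth_rw 2 [← h]
  rw [cutOpp, m.opp_opp]

end PreMap

/-! ### The core as a simple connected map. -/

namespace PreMap

variable {D D' : Type} {m : PreMap D} {m' : PreMap D'}

theorem next_face (m : PreMap D) (x : D) : m.next (m.face x) = m.opp x := by simp [face]

theorem isIso_of_face {e : D ≃ D'} (h1 : ∀ x, e (m.face x) = m'.face (e x))
    (h2 : ∀ x, e (m.opp x) = m'.opp (e x)) (h3 : e m.root = m'.root) : m.IsIso m' e := by
  refine ⟨fun x => ?_, h2, h3⟩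
  have h4 := h1 (m.opp (m.next x))
  rw [h2, show m.face (m.opp (m.next x)) = x by simp [face, m.opp_opp]] at h4
  rw [h4, next_face, m'.opp_opp]

theorem IsIso.face {e : D ≃ D'} (h : m.IsIso m' e) (x : D) : e (m.face x) = m'.face (e x) := by
  apply m'.next.injective
  rw [← h.next, next_face, next_face, h.opp]

theorem IsIso.symm {e : D ≃ D'} (h : m.IsIso m' e) : m'.IsIso m e.symm := by
  refine ⟨fun d => ?_, fun d => ?_, ?_⟩
  · rw [Equiv.symm_apply_eq, h.next, Equiv.apply_symm_apply]
  · rw [Equiv.symm_apply_eq, h.opp, Equiv.apply_symm_apply]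
  · rw [Equiv.symm_apply_eq, h.root]

theorem IsIso.planar {e : D ≃ D'} (h : m.IsIso m' e) (hm : m.Planar) : m'.Planar := by
  rw [Planar, ← numCycles_congr e h.next, ← numCycles_congr e h.opp, ← numCycles_congr e h.face]
  exact hm

section core

variable [Finite D] (hm : m.Loopless) (hc : m.Connected) (hp : m.Planar)

/-- The map obtained by cutting along all pairs of consecutive parallel edges. -/
noncomputable def cutAll : PreMap D :=
  let t : Perm D := ⟨m.cutOpp, m.cutOpp, cutOpp_cutOpp hm hc hp, cutOpp_cutOpp hm hc hp⟩
  { next := t * m.face⁻¹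
    opp := t
    root := m.root
    opp_opp := cutOpp_cutOpp hm hc hp
    opp_ne := cutOpp_ne hm }

theorem face_mem_core_iff (x : D) : m.face x ∈ m.core ↔ x ∈ m.core :=
  apply_mem_iff (fun _ => m.face_mem_core) x

theorem cutAll_opp (x : D) : (cutAll hm hc hp).opp x = m.cutOpp x := rfl

theorem cutAll_next (x : D) : (cutAll hm hc hp).next x = m.cutOpp (m.face⁻¹ x) := rfl

theorem cutAll_face : (cutAll hm hc hp).face = m.face := by
  rw [face, cutAll]
  simp only [mul_inv_rev, inv_inv, mul_assoc, inv_mul_cancel, mul_one]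

theorem vtx_cutOpp (x : D) : m.vtx (m.cutOpp x) = m.vtx (m.opp x) :=
  (m.nextParallel_parallel x).2

theorem vtx_cutAll_next (x : D) : m.vtx ((cutAll hm hc hp).next x) = m.vtx x := by
  rw [cutAll_next, vtx_cutOpp, ← next_face, show m.face (m.face⁻¹ x) = x by simp, vtx_next]

theorem cutAll_opp_mem (x : D) : (cutAll hm hc hp).opp x ∈ m.core ↔ x ∈ m.core :=
  opp_mem_iff (fun _ h => m.cutOpp_mem_core h) x

theorem cutAll_next_mem (x : D) : (cutAll hm hc hp).next x ∈ m.core ↔ x ∈ m.core := by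
  rw [cutAll_next, ← cutAll_opp hm hc hp, cutAll_opp_mem, ← face_mem_core_iff]
  simp

/-- The simple core of a loopless planar map. -/
noncomputable def coreMap : PreMap m.core :=
  (cutAll hm hc hp).restrict m.core (cutAll_next_mem hm hc hp) (cutAll_opp_mem hm hc hp)
    ⟨m.root, m.root_mem_core⟩

theorem coreMap_face (x : m.core) : ((coreMap hm hc hp).face x : D) = m.face x := by
  rw [← cutAll_face hm hc hp]
  rfl

theorem vtx_of_coreMap {x y : m.core} (h : (coreMap hm hc hp).vtx x = (coreMap hm hc hp).vtx y) :
    m.vtx x = m.vtx y :=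
  eq_of_sameCycle (g := fun x : m.core => m.vtx x) (fun x => vtx_cutAll_next hm hc hp x)
    ((coreMap hm hc hp).vtx_eq_iff.1 h)

/-- A vertex of the core lies over a single vertex of `m`, and `cutOpp` ends where `opp` does; loops
and parallel pairs of the core would therefore already be present in `m`, within the core. -/
theorem coreMap_simple : (coreMap hm hc hp).Simple := by
  refine ⟨fun x h => ?_, fun x y h => ?_⟩
  · exact hm x ((vtx_of_coreMap hm hc hp h).trans (vtx_cutOpp x.1))
  · refine Subtype.ext (eq_of_parallel_of_mem_core hm hc hp x.2 y.2
      ⟨vtx_of_coreMap hm hc hp h.1, ?_⟩)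
    exact (vtx_cutOpp x.1).symm.trans ((vtx_of_coreMap hm hc hp h.2).trans (vtx_cutOpp y.1))

theorem coreMap_connected : (coreMap hm hc hp).Connected := by
  have key : ∀ S : Set m.core, (coreMap hm hc hp).root ∈ S →
      (∀ x ∈ S, (coreMap hm hc hp).next x ∈ S) → (∀ x ∈ S, (coreMap hm hc hp).opp x ∈ S) →
      ∀ x, x ∈ S := by
    intro S hr h1 h2 x
    obtain ⟨y, hy, hyx⟩ := m.core_subset (S := Subtype.val '' S) ⟨_, hr, rfl⟩ (by
      rintro _ ⟨y, hy, rfl⟩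
      refine ⟨(coreMap hm hc hp).face y, ?_, coreMap_face hm hc hp y⟩
      rw [← apply_mem_iff h1, next_face]
      exact h2 _ hy) (by
      rintro _ ⟨y, hy, rfl⟩
      exact ⟨_, h2 _ hy, rfl⟩) x.2
    rwa [Subtype.ext hyx] at hy
  intro S hS h1 h2 x
  by_cases hr : (coreMap hm hc hp).root ∈ S
  · exact key S hr h1 h2 x
  · obtain ⟨y, hy⟩ := hS
    exact absurd hy (key Sᶜ hr (fun x hx => (not_congr (apply_mem_iff h1 x)).2 hx)
      (fun x hx => (not_congr (opp_mem_iff h2 x)).2 hx) y)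

end core

end PreMap

namespace Bigon

variable {D : Type} [Finite D] {m : PreMap D} (B : Bigon m) (hm : m.Loopless) (hc : m.Connected)
  (hp : m.Planar)

theorem inner_loopless : (B.inner hm hc hp).Loopless := by
  intro x h
  have h1 : (B.cut hm).vtx x.1 = (B.cut hm).vtx ((B.cut hm).opp x.1) :=
    eq_of_sameCycle (g := fun x : ((B.side hm)ᶜ : Set D) => (B.cut hm).vtx x.1)
      (fun x => (B.cut hm).vtx_next x.1) ((B.inner hm hc hp).vtx_eq_iff.1 h)
  exact hm x.1 ((B.vtx_eq_of_cut hm h1).trans (B.vtx_seam hm _))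

theorem inner_face (x : ((B.side hm)ᶜ : Set D)) : ((B.inner hm hc hp).face x : D) = m.face x := by
  rw [← B.cut_face hm]
  rfl

end Bigon

/-! ### Decomposition of a map into its core and inserted maps. -/

/-- A choice of orientation for the edges of the core that carry an inserted map. -/
structure CoreOrientation {D : Type} [Finite D] (m : PreMap D) (K : Type) where
  o : K → D
  o_inj : Function.Injective o
  mem : ∀ i, o i ∈ m.core
  cutOpp_ne : ∀ i i', m.cutOpp (o i) ≠ o i'
  nextParallel_ne : ∀ i, m.nextParallel (o i) ≠ o i
  exhaustive : ∀ x ∈ m.core, m.nextParallel x ≠ x → ∃ i, x = o i ∨ x = m.cutOpp (o i)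

namespace CoreOrientation

open PreMap

variable {D K : Type} [Finite D] {m : PreMap D} (O : CoreOrientation m K) (hm : m.Loopless)
  (hc : m.Connected) (hp : m.Planar)

/-- The bigon that carries an inserted map. -/
noncomputable def bigon (i : K) : Bigon m where
  a := O.o i
  b := m.nextParallel (O.o i)
  ne := (O.nextParallel_ne i).symm
  parallel := (m.nextParallel_parallel _).symm

theorem core_subset (i : K) : m.core ⊆ (O.bigon i).side hm :=
  (O.bigon i).core_subset_side hm (O.mem i)

include hc hp in
theorem mem_side_of_parallel {i : K} {x y : D} (hx : x ∈ m.core) (h1 : x ≠ O.o i)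
    (h2 : x ≠ m.cutOpp (O.o i)) (h : m.Parallel y x) : y ∈ (O.bigon i).side hm := by
  refine (O.bigon i).mem_of_parallel hm ((O.bigon i).next_mem_side hm)
    ((O.bigon i).opp_mem_side hm) (O.core_subset hm i hx) (fun h' => h1 ?_) (fun h' => h2 ?_) h
  · exact eq_of_parallel_of_mem_core hm hc hp hx (O.mem i) h'
  · exact eq_of_parallel_of_mem_core hm hc hp hx (m.cutOpp_mem_core (O.mem i))
      (h'.trans (O.bigon i).parallel.opp)

include hc hp in
-- The part enclosed by the bigon `i` is connected and starts on the outer side of the bigon `i'`.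
-- It cannot cross `i'`: the half-edges of that bigon are either core half-edges, hence not in this
-- part, or enclosed by `i'` itself.
theorem disjoint {i i' : K} (hi : i ≠ i') {x : D} (hx : x ∉ (O.bigon i).side hm) :
    x ∈ (O.bigon i').side hm := by
  have ha1 : O.o i ≠ O.o i' := fun h => hi (O.o_inj h)
  have ha2 : O.o i ≠ m.cutOpp (O.o i') := (O.cutOpp_ne i' i).symm
  have hb1 : m.cutOpp (O.o i) ≠ O.o i' := O.cutOpp_ne i i'
  have hb2 : m.cutOpp (O.o i) ≠ m.cutOpp (O.o i') := fun h => ha1 (by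
    rw [← cutOpp_cutOpp hm hc hp (O.o i), h, cutOpp_cutOpp hm hc hp])
  have hb : (O.bigon i).b ∈ (O.bigon i').side hm :=
    O.mem_side_of_parallel hm hc hp (O.mem i) ha1 ha2 (O.bigon i).parallel.symm
  have ha : m.opp (O.bigon i).a ∈ (O.bigon i').side hm :=
    O.mem_side_of_parallel hm hc hp (m.cutOpp_mem_core (O.mem i)) hb1 hb2 (O.bigon i).parallel.opp
  refine ((O.bigon i).inner_connected hm hc hp).face_induction
    (S := {y | y.1 ∈ (O.bigon i').side hm}) ⟨((O.bigon i).inner hm hc hp).root, hb⟩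
    (fun y hy => ?_) (fun y hy => ?_) ⟨x, hx⟩
  · rw [Set.mem_ofPred_eq, Bigon.inner_face]
    exact (O.bigon i').face_mem hm ((O.bigon i').next_mem_side hm) ((O.bigon i').opp_mem_side hm) hy
  · change (O.bigon i).seam (m.opp y.1) ∈ (O.bigon i').side hm
    have hya : y.1 ≠ (O.bigon i).a := fun h => y.2 (h ▸ (O.bigon i).a_mem_side hm)
    have hyb : y.1 ≠ m.opp (O.bigon i).b := fun h => y.2 (h ▸ (O.bigon i).opp_b_mem_side hm)
    by_cases h1 : y.1 = (O.bigon i).b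
    · rw [h1, (O.bigon i).seam_opp_b hm]
      exact ha
    by_cases h2 : y.1 = m.opp (O.bigon i).a
    · rw [h2, m.opp_opp, (O.bigon i).seam_a hm]
      exact hb
    rw [(O.bigon i).seam_opp hm, (O.bigon i).seam_of_ne hya h1 h2 hyb]
    have h3 := ((O.bigon i').opp_mem_side hm y.1).2 hy
    rwa [(O.bigon i').cut_opp, (O.bigon i').seam_opp hm, (O.bigon i').seam_of_ne] at h3
    · exact fun h => y.2 (O.core_subset hm i (h ▸ O.mem i'))
    · exact fun h => (O.bigon i').b_notMem_side hm hc hp (h ▸ hy)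
    · exact fun h => (O.bigon i').opp_a_notMem_side hm hc hp (h ▸ hy)
    · exact fun h => y.2 (O.core_subset hm i (h ▸ m.cutOpp_mem_core (O.mem i')))

include hc hp in
-- The core and the enclosed parts together are closed under `face` and `opp`, which suffices by
-- connectedness.
theorem mem_core_or (x : D) : x ∈ m.core ∨ ∃ i, x ∉ (O.bigon i).side hm := by
  refine hc.face_induction (S := {x | x ∈ m.core ∨ ∃ i, x ∉ (O.bigon i).side hm})
    ⟨m.root, Or.inl m.root_mem_core⟩ ?_ ?_ x
  · rintro y (hy | ⟨i, hy⟩)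
    · exact Or.inl (m.face_mem_core hy)
    · refine Or.inr ⟨i, ?_⟩
      exact (O.bigon i).face_mem (S := ((O.bigon i).side hm)ᶜ) hm
        (fun x => not_congr ((O.bigon i).next_mem_side hm x))
        (fun x => not_congr ((O.bigon i).opp_mem_side hm x)) hy
  · rintro y (hy | ⟨i, hy⟩)
    · have h1 := nextParallel_cutOpp hm hc hp y
      have h2 := m.cutOpp_mem_core hy
      by_cases h3 : m.nextParallel (m.cutOpp y) = m.cutOpp y
      · exact Or.inl (by rwa [← h1, h3])
      · obtain ⟨i, h4 | h4⟩ := O.exhaustive _ h2 h3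
        · refine Or.inr ⟨i, ?_⟩
          rw [← h1, h4]
          exact (O.bigon i).b_notMem_side hm hc hp
        · refine Or.inr ⟨i, ?_⟩
          rw [← h1, h4, nextParallel_cutOpp hm hc hp]
          exact (O.bigon i).opp_a_notMem_side hm hc hp
    · by_cases h1 : m.opp y = (O.bigon i).a
      · exact Or.inl (h1 ▸ O.mem i)
      by_cases h2 : m.opp y = m.opp (O.bigon i).b
      · exact Or.inl (h2 ▸ m.cutOpp_mem_core (O.mem i))
      refine Or.inr ⟨i, ?_⟩
      by_cases h3 : m.opp y = (O.bigon i).b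
      · exact h3 ▸ (O.bigon i).b_notMem_side hm hc hp
      by_cases h4 : m.opp y = m.opp (O.bigon i).a
      · exact h4 ▸ (O.bigon i).opp_a_notMem_side hm hc hp
      have h5 := (not_congr ((O.bigon i).opp_mem_side hm y)).2 hy
      rwa [(O.bigon i).cut_opp, (O.bigon i).seam_of_ne h1 h3 h4 h2] at h5

/-- The maps inserted in the core. -/
noncomputable def decoration :
    Decoration (coreMap hm hc hp) fun i : K => (((O.bigon i).side hm)ᶜ : Set D) where
  o i := ⟨O.o i, O.mem i⟩
  o_inj _ _ h := O.o_inj (congrArg Subtype.val h)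
  opp_o_ne i i' h := O.cutOpp_ne i i' (congrArg Subtype.val h)
  n i := (O.bigon i).inner hm hc hp
  root_sep i := (O.bigon i).inner_loopless hm hc hp _

noncomputable def glueEquiv :
    m.core ⊕ (Σ i : K, (((O.bigon i).side hm)ᶜ : Set D)) ≃ D :=
  Equiv.ofBijective (Sum.elim Subtype.val fun y => y.2.1) <| by
    constructor
    · rintro (⟨x, hx⟩ | ⟨i, x, hx⟩) (⟨y, hy⟩ | ⟨i', y, hy⟩) h
      · obtain rfl : x = y := h
        rfl
      · obtain rfl : x = y := h
        exact absurd (O.core_subset hm i' hx) hy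
      · obtain rfl : x = y := h
        exact absurd (O.core_subset hm i hy) hx
      · obtain rfl : x = y := h
        rcases eq_or_ne i i' with rfl | hi
        · rfl
        · exact absurd (O.disjoint hm hc hp hi hx) hy
    · intro x
      rcases O.mem_core_or hm hc hp x with h | ⟨i, h⟩
      · exact ⟨.inl ⟨x, h⟩, rfl⟩
      · exact ⟨.inr ⟨i, x, h⟩, rfl⟩

theorem glueEquiv_inl (x : m.core) : O.glueEquiv hm hc hp (.inl x) = x := rfl

theorem glueEquiv_inr (i : K) (y : (((O.bigon i).side hm)ᶜ : Set D)) :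
    O.glueEquiv hm hc hp (.inr ⟨i, y⟩) = y := rfl

theorem opp_coreMark (i : K) (ε : Bool) : m.opp ((O.decoration hm hc hp).coreMark (i, ε)) =
    (O.decoration hm hc hp).innerEnd i (!ε) := by
  cases ε
  · change m.opp (m.cutOpp (O.o i)) = m.nextParallel (O.o i)
    rw [cutOpp, m.opp_opp]
  · exact ((O.bigon i).cut_opp_b hm).symm

/-- A loopless planar map is obtained from its core by insertion. -/
theorem isIso_glue : (O.decoration hm hc hp).glue.IsIso m (O.glueEquiv hm hc hp) := by
  refine isIso_of_face ?_ ?_ rfl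
  · rw [Decoration.face_glue]
    rintro (x | ⟨i, y⟩)
    · exact coreMap_face hm hc hp x
    · exact (O.bigon i).inner_face hm hc hp y
  · intro x
    induction x using (O.decoration hm hc hp).gluing.sum_cases with
    | h1 p =>
      obtain ⟨i, ε⟩ := p
      have h1 : (O.decoration hm hc hp).glue.opp
        (.inl ((O.decoration hm hc hp).gluing.j (i, ε))) =
          .inr ⟨i, (O.decoration hm hc hp).innerEnd i (!ε)⟩ :=
        (O.decoration hm hc hp).gluing.opp_inl_j (i, ε)
      rw [h1, glueEquiv_inr]
      exact (O.opp_coreMark hm hc hp i ε).symm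
    | h3 p =>
      obtain ⟨i, ε⟩ := p
      have h1 : (O.decoration hm hc hp).glue.opp
        (.inr ((O.decoration hm hc hp).gluing.k (i, ε))) =
          .inl ((O.decoration hm hc hp).coreMark (i, !ε)) :=
        (O.decoration hm hc hp).gluing.opp_inr_k (i, ε)
      rw [h1, glueEquiv_inl]
      apply m.opp.injective
      rw [m.opp_opp]
      refine (O.opp_coreMark hm hc hp i (!ε)).trans ?_
      rw [Bool.not_not]
      rfl
    | h2 x hx =>
      have h1 : (O.decoration hm hc hp).glue.opp (.inl x) = .inl ((coreMap hm hc hp).opp x) :=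
        (O.decoration hm hc hp).gluing.opp_inl hx
      rw [h1, glueEquiv_inl, glueEquiv_inl]
      change m.cutOpp x = m.opp x
      rw [← nextParallel_cutOpp hm hc hp x]
      by_contra hne
      obtain ⟨i, h2 | h2⟩ := O.exhaustive _ (m.cutOpp_mem_core x.2) (Ne.symm hne)
      · refine hx (i, false) (Subtype.ext ?_)
        change m.cutOpp (O.o i) = x
        rw [← h2, cutOpp_cutOpp hm hc hp]
      · refine hx (i, true) (Subtype.ext ?_)
        change O.o i = x
        rw [← cutOpp_cutOpp hm hc hp x, h2, cutOpp_cutOpp hm hc hp]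
    | h4 y hy =>
      obtain ⟨i, y⟩ := y
      have h1 : (O.decoration hm hc hp).glue.opp (.inr ⟨i, y⟩) =
        .inr ⟨i, ((O.bigon i).inner hm hc hp).opp y⟩ :=
        (O.decoration hm hc hp).gluing.opp_inr hy
      rw [h1, glueEquiv_inr, glueEquiv_inr]
      change (O.bigon i).seam (m.opp y) = m.opp y
      rw [(O.bigon i).seam_opp hm, (O.bigon i).seam_of_ne]
      · exact fun h => y.2 (h ▸ (O.bigon i).a_mem_side hm)
      · exact fun h => hy (i, true) (congrArg (Sigma.mk i) (Subtype.ext h.symm))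
      · refine fun h => hy (i, false) (congrArg (Sigma.mk i) (Subtype.ext ?_))
        rw [h]
        exact (O.bigon i).cut_opp_b hm
      · exact fun h => y.2 (h ▸ (O.bigon i).opp_b_mem_side hm)

include O in
-- The whole map and the enclosed parts are planar, so planarity of the core follows from the
-- additivity of the Euler characteristic.
theorem coreMap_planar [Finite K] : (coreMap hm hc hp).Planar :=
  ((O.decoration hm hc hp).planar_glue_iff fun i => (O.bigon i).inner_planar hm hc hp).1
    ((O.isIso_glue hm hc hp).symm.planar hp)

end CoreOrientation

/-! ### Isomorphisms preserve the core and the properties of maps. -/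

namespace PreMap

variable {D D' : Type} {m : PreMap D} {m' : PreMap D'} {e : D ≃ D'}

namespace IsIso

theorem vtx_iff (h : m.IsIso m' e) {x y : D} : m'.vtx (e x) = m'.vtx (e y) ↔ m.vtx x = m.vtx y := by
  rw [vtx_eq_iff, vtx_eq_iff]
  exact (sameCycle_congr e h.next).symm

theorem parallel_iff (h : m.IsIso m' e) {x y : D} :
    m'.Parallel (e x) (e y) ↔ m.Parallel x y := by
  rw [Parallel, Parallel, h.vtx_iff, ← h.opp, ← h.opp, h.vtx_iff]

theorem loopless (h : m.IsIso m' e) (hm : m.Loopless) : m'.Loopless := by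
  intro x hx
  obtain ⟨x, rfl⟩ := e.surjective x
  rw [← h.opp, h.vtx_iff] at hx
  exact hm x hx

theorem simple (h : m.IsIso m' e) (hm : m.Simple) : m'.Simple := by
  refine ⟨h.loopless hm.1, fun x y hxy => ?_⟩
  obtain ⟨x, rfl⟩ := e.surjective x
  obtain ⟨y, rfl⟩ := e.surjective y
  rw [hm.2 x y (h.parallel_iff.1 hxy)]

theorem connected (h : m.IsIso m' e) (hm : m.Connected) : m'.Connected := by
  intro S hS h1 h2 x
  obtain ⟨y, hy⟩ := hS
  have := hm {x | e x ∈ S} ⟨e.symm y, by simpa using hy⟩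
    (fun z hz => by rw [Set.mem_ofPred_eq, h.next]; exact h1 _ hz)
    (fun z hz => by rw [Set.mem_ofPred_eq, h.opp]; exact h2 _ hz) (e.symm x)
  simpa using this

theorem twoConnected (h : m.IsIso m' e) (hm : m.TwoConnected) : m'.TwoConnected := by
  rintro S hS ⟨y, hy⟩ ⟨y', hy'⟩
  obtain ⟨a, b, a', b', h1, h2, h3, h4, h5, h6, h7⟩ := hm {x | e x ∈ S}
    (fun z hz => by rw [Set.mem_ofPred_eq, h.opp]; exact hS _ hz)
    ⟨e.symm y, by simpa using hy⟩ ⟨e.symm y', by simpa using hy'⟩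
  exact ⟨e a, e b, e a', e b', h1, h2, h.vtx_iff.2 h3, h4, h5, h.vtx_iff.2 h6,
    fun h' => h7 (h.vtx_iff.1 h')⟩

theorem trans {D'' : Type} {m'' : PreMap D''} {e' : D' ≃ D''} (h : m.IsIso m' e)
    (h' : m'.IsIso m'' e') : m.IsIso m'' (e.trans e') :=
  ⟨fun d => by simp [h.next, h'.next], fun d => by simp [h.opp, h'.opp], by simp [h.root, h'.root]⟩

/-- Rooted maps have no automorphisms. -/
theorem apply_eq_self {e : D ≃ D} (h : m.IsIso m e) (hm : m.Connected) (x : D) : e x = x := by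
  refine hm {x | e x = x} ⟨m.root, h.root⟩ (fun y hy => ?_) (fun y hy => ?_) x
  · rw [Set.mem_ofPred_eq, h.next, hy]
  · rw [Set.mem_ofPred_eq, h.opp, hy]

variable [Finite D] [Finite D']

theorem nextParallel (h : m.IsIso m' e) (x : D) : e (m.nextParallel x) = m'.nextParallel (e x) := by
  have hpow : ∀ j : ℕ, (m'.next ^ j) (e x) = e ((m.next ^ j) x) := fun j =>
    (zpow_apply_congr e h.next j x).symm
  have hgap : m'.gap (e x) = m.gap x := by
    refine m'.gap_eq (m.gap_pos x) ?_ fun i h0 hi => ?_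
    · rw [hpow, h.parallel_iff]
      exact m.nextParallel_parallel x
    · rw [hpow, h.parallel_iff]
      exact m.not_parallel_of_lt_gap h0 hi
  rw [PreMap.nextParallel, PreMap.nextParallel, hgap, hpow]

theorem cutOpp (h : m.IsIso m' e) (x : D) : e (m.cutOpp x) = m'.cutOpp (e x) := by
  rw [PreMap.cutOpp, PreMap.cutOpp, h.opp, h.nextParallel]

theorem mem_core (h : m.IsIso m' e) {x : D} (hx : x ∈ m.core) : e x ∈ m'.core := by
  refine m.core_subset (S := {x | e x ∈ m'.core}) ?_ (fun y hy => ?_) (fun y hy => ?_) hx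
  · rw [Set.mem_ofPred_eq, h.root]
    exact m'.root_mem_core
  · rw [Set.mem_ofPred_eq, h.face]
    exact m'.face_mem_core hy
  · rw [Set.mem_ofPred_eq, h.cutOpp]
    exact m'.cutOpp_mem_core hy

end IsIso

end PreMap

/-! ### Uniqueness of the core and of the inserted maps. -/

namespace Decoration

variable {A A' K K' : Type} {c : PreMap A} {c' : PreMap A'} {Y : K → Type} {Y' : K' → Type}
  (d : Decoration c Y) (d' : Decoration c' Y')

theorem opp_glue_coreMark (i : K) (ε : Bool) :
    d.glue.opp (.inl (d.coreMark (i, ε))) = .inr ⟨i, d.innerEnd i (!ε)⟩ :=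
  d.gluing.opp_inl_j (i, ε)

theorem opp_glue_innerEnd (i : K) (ε : Bool) :
    d.glue.opp (.inr ⟨i, d.innerEnd i ε⟩) = .inl (d.coreMark (i, !ε)) :=
  d.gluing.opp_inr_k (i, ε)

theorem opp_glue_inl {a : A} (h : ∀ p, d.coreMark p ≠ a) :
    d.glue.opp (.inl a) = .inl (c.opp a) :=
  d.gluing.opp_inl h

theorem opp_glue_inr {i : K} {y : Y i} (h : ∀ ε, d.innerEnd i ε ≠ y) :
    d.glue.opp (.inr ⟨i, y⟩) = .inr ⟨i, (d.n i).opp y⟩ := by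
  refine d.gluing.opp_inr (b := ⟨i, y⟩) ?_
  rintro ⟨i', ε⟩ h'
  obtain rfl : i' = i := congrArg Sigma.fst h'
  exact h ε (eq_of_heq (Sigma.mk.inj h').2)

theorem face_inr (i : K) (y : Y i) : d.glue.face (.inr ⟨i, y⟩) = .inr ⟨i, (d.n i).face y⟩ := by
  rw [face_glue]
  rfl

/-- Gluing respects isomorphisms of the pieces. -/
theorem glue_congr {Z : K → Type} (d'' : Decoration c' Z) {eA : A ≃ A'} (hA : c.IsIso c' eA)
    (ho : ∀ i, eA (d.o i) = d''.o i) (eY : ∀ i, Y i ≃ Z i)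
    (hY : ∀ i, (d.n i).IsIso (d''.n i) (eY i)) :
    d.glue.IsIso d''.glue (Equiv.sumCongr eA (Equiv.sigmaCongrRight eY)) := by
  have hcm : ∀ p, eA (d.coreMark p) = d''.coreMark p := by
    rintro ⟨i, _ | _⟩
    · change eA (c.opp (d.o i)) = c'.opp (d''.o i)
      rw [hA.opp, ho]
    · exact ho i
  have hie : ∀ i ε, eY i (d.innerEnd i ε) = d''.innerEnd i ε := by
    rintro i (_ | _)
    · change eY i ((d.n i).opp (d.n i).root) = (d''.n i).opp (d''.n i).root
      rw [(hY i).opp, (hY i).root]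
    · exact (hY i).root
  refine PreMap.isIso_of_face ?_ ?_ ?_
  · rintro (a | ⟨i, y⟩)
    · rw [face_inl]
      change _ = d''.glue.face (.inl (eA a))
      rw [face_inl, ← hA.face]
      rfl
    · rw [face_inr]
      change _ = d''.glue.face (.inr ⟨i, eY i y⟩)
      rw [face_inr, ← (hY i).face]
      rfl
  · intro x
    induction x using d.gluing.sum_cases with
    | h1 p =>
      obtain ⟨i, ε⟩ := p
      rw [show d.gluing.j (i, ε) = d.coreMark (i, ε) from rfl, opp_glue_coreMark]
      change .inr ⟨i, eY i _⟩ = d''.glue.opp (.inl (eA _))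
      rw [hcm, hie, opp_glue_coreMark]
    | h3 p =>
      obtain ⟨i, ε⟩ := p
      rw [show d.gluing.k (i, ε) = ⟨i, d.innerEnd i ε⟩ from rfl, opp_glue_innerEnd]
      change .inl (eA _) = d''.glue.opp (.inr ⟨i, eY i _⟩)
      rw [hcm, hie, opp_glue_innerEnd]
    | h2 a h =>
      rw [d.opp_glue_inl h]
      change .inl (eA _) = d''.glue.opp (.inl (eA _))
      rw [d''.opp_glue_inl, hA.opp]
      intro p hp
      rw [← hcm] at hp
      exact h p (eA.injective hp)
    | h4 y h =>
      obtain ⟨i, y⟩ := y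
      rw [d.opp_glue_inr fun ε hε => h (i, ε) (congrArg (Sigma.mk i) hε)]
      change .inr ⟨i, eY i _⟩ = d''.glue.opp (.inr ⟨i, eY i _⟩)
      rw [d''.opp_glue_inr, (hY i).opp]
      intro ε hε
      rw [← hie] at hε
      exact h (i, ε) (congrArg (Sigma.mk i) ((eY i).injective hε))
  · exact congrArg Sum.inl hA.root

section uniqueness

variable [Finite A] [Finite K] [∀ i, Finite (Y i)] [Finite A'] [Finite K'] [∀ i, Finite (Y' i)]
  {e : (A ⊕ Σ i, Y i) ≃ (A' ⊕ Σ i, Y' i)}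
  (he : d.glue.IsIso d'.glue e) (hc : c.Simple) (hcc : c.Connected) (hn : ∀ i, (d.n i).Loopless)
  (hc' : c'.Simple) (hcc' : c'.Connected) (hn' : ∀ i, (d'.n i).Loopless)
include he hc hcc hn hc' hcc' hn'

/-- An isomorphism between glued maps restricts to the cores. -/
theorem exists_core_iso : ∃ eA : A ≃ A', c.IsIso c' eA ∧ ∀ a, e (.inl a) = .inl (eA a) := by
  have h1 : ∀ a, ∃ a', e (.inl a) = .inl a' := by
    intro a
    have := he.mem_core (x := .inl a) (by rw [d.core_glue hc hcc hn]; exact ⟨a, rfl⟩)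
    rw [d'.core_glue hc' hcc' hn'] at this
    obtain ⟨a', ha'⟩ := this
    exact ⟨a', ha'.symm⟩
  have h2 : ∀ a', ∃ a, e.symm (.inl a') = .inl a := by
    intro a'
    have := he.symm.mem_core (x := .inl a') (by rw [d'.core_glue hc' hcc' hn']; exact ⟨a', rfl⟩)
    rw [d.core_glue hc hcc hn] at this
    obtain ⟨a, ha⟩ := this
    exact ⟨a, ha.symm⟩
  choose f hf using h1
  choose g hg using h2
  have hgf : ∀ a, g (f a) = a := fun a => Sum.inl_injective (β := Σ i, Y i) (by
    rw [← hg, ← hf, Equiv.symm_apply_apply])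
  have hfg : ∀ a, f (g a) = a := fun a => Sum.inl_injective (β := Σ i, Y' i) (by
    rw [← hf, ← hg, Equiv.apply_symm_apply])
  refine ⟨⟨f, g, hgf, hfg⟩, PreMap.isIso_of_face (fun a => ?_) (fun a => ?_) ?_, hf⟩
  · apply Sum.inl_injective (β := Σ i, Y' i)
    change Sum.inl (f (c.face a)) = Sum.inl (c'.face (f a))
    rw [← hf, ← face_inl, ← face_inl, ← hf, he.face]
  · apply Sum.inl_injective (β := Σ i, Y' i)
    change Sum.inl (f (c.opp a)) = Sum.inl (c'.opp (f a))
    rw [← hf, ← d.cutOpp_inl hc hn, ← d'.cutOpp_inl hc' hn', ← hf, he.cutOpp]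
  · apply Sum.inl_injective (β := Σ i, Y' i)
    change Sum.inl (f c.root) = Sum.inl c'.root
    rw [← hf]
    exact he.root

omit hcc hcc' in
/-- An isomorphism between glued maps preserves the marked half-edges. -/
theorem exists_coreMark_of_isIso {p : K × Bool} {a' : A'} (h : e (.inl (d.coreMark p)) = .inl a') :
    ∃ p', d'.coreMark p' = a' := by
  by_contra! h'
  have h1 := he.nextParallel (.inl (d.coreMark p))
  rw [h, d'.nextParallel_inl hc' hn' h', ← h, d.nextParallel_coreMark hc hn] at h1
  simpa using e.injective h1

omit hc hcc hn hc' hcc' hn' [Finite A] [Finite K] [∀ i, Finite (Y i)] [Finite A'] [Finite K']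
  [∀ i, Finite (Y' i)] in
-- Propagates from the root of the inserted map by `face` and `opp`. The glued `opp` leaves the
-- piece only at the two marks, where the image is prescribed by `h`.
theorem exists_inner_map {i : K} {i' : K'} (hi : (d.n i).Connected) [Finite (Y i)]
    (h : ∀ ε, e (.inr ⟨i, d.innerEnd i ε⟩) = .inr ⟨i', d'.innerEnd i' ε⟩) (y : Y i) :
    ∃ y', e (.inr ⟨i, y⟩) = .inr ⟨i', y'⟩ := by
  refine hi.face_induction (S := {y | ∃ y', e (.inr ⟨i, y⟩) = .inr ⟨i', y'⟩})
    ⟨(d.n i).root, _, h true⟩ ?_ ?_ y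
  · rintro y ⟨y', hy⟩
    refine ⟨(d'.n i').face y', ?_⟩
    rw [← face_inr, he.face, hy, face_inr]
  · rintro y ⟨y', hy⟩
    by_cases hm : ∃ ε, d.innerEnd i ε = y
    · obtain ⟨ε, rfl⟩ := hm
      refine ⟨d'.innerEnd i' (!ε), ?_⟩
      rw [d.opp_innerMark, h]
    · push Not at hm
      refine ⟨(d'.n i').opp y', ?_⟩
      rw [← d.opp_glue_inr hm, he.opp, hy, d'.opp_glue_inr]
      intro ε hε
      rw [← hε, ← h] at hy
      have := Sum.inr_injective (e.injective hy)
      exact hm ε (eq_of_heq (Sigma.mk.inj this).2).symm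

omit hcc hcc' in
/-- Corresponding inserted maps are isomorphic. -/
theorem exists_inner_iso {i : K} {i' : K'} (hi : (d.n i).Connected) (hi' : (d'.n i').Connected)
    (h : ∀ ε, e (.inl (d.coreMark (i, ε))) = .inl (d'.coreMark (i', ε))) :
    ∃ eY : Y i ≃ Y' i', (d.n i).IsIso (d'.n i') eY := by
  have h1 : ∀ ε, e (.inr ⟨i, d.innerEnd i ε⟩) = .inr ⟨i', d'.innerEnd i' ε⟩ := by
    intro ε
    have h2 := he.nextParallel (.inl (d.coreMark (i, ε)))
    rw [h, d'.nextParallel_coreMark hc' hn', d.nextParallel_coreMark hc hn] at h2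
    exact h2
  choose f hf using d.exists_inner_map d' he hi h1
  choose g hg using d'.exists_inner_map d he.symm hi' fun ε => by rw [← h1, Equiv.symm_apply_apply]
  have hinj : ∀ y y' : Y i, (.inr ⟨i, y⟩ : A ⊕ Σ i, Y i) = .inr ⟨i, y'⟩ → y = y' := fun y y' h =>
    eq_of_heq (Sigma.mk.inj (Sum.inr_injective h)).2
  have hinj' : ∀ y y' : Y' i', (.inr ⟨i', y⟩ : A' ⊕ Σ i, Y' i) = .inr ⟨i', y'⟩ → y = y' :=
    fun y y' h => eq_of_heq (Sigma.mk.inj (Sum.inr_injective h)).2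
  have hgf : ∀ y, g (f y) = y := fun y => hinj _ _ (by
    rw [← hg, ← hf, Equiv.symm_apply_apply])
  have hfg : ∀ y, f (g y) = y := fun y => hinj' _ _ (by
    rw [← hf, ← hg, Equiv.apply_symm_apply])
  have hfe : ∀ ε, f (d.innerEnd i ε) = d'.innerEnd i' ε := fun ε => hinj' _ _ (by rw [← hf, h1])
  refine ⟨⟨f, g, hgf, hfg⟩, PreMap.isIso_of_face (fun y => ?_) (fun y => ?_) (hfe true)⟩
  · apply hinj'
    change (.inr ⟨i', f ((d.n i).face y)⟩ : A' ⊕ Σ i, Y' i) = .inr ⟨i', (d'.n i').face (f y)⟩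
    rw [← hf, ← face_inr, ← face_inr, ← hf, he.face]
  · change f ((d.n i).opp y) = (d'.n i').opp (f y)
    by_cases hm : ∃ ε, d.innerEnd i ε = y
    · obtain ⟨ε, rfl⟩ := hm
      rw [d.opp_innerMark, hfe, hfe, d'.opp_innerMark]
    · push Not at hm
      apply hinj'
      rw [← hf, ← d.opp_glue_inr hm, he.opp, hf, d'.opp_glue_inr]
      intro ε hε
      rw [← hfe] at hε
      exact hm ε (by rw [← hgf (d.innerEnd i ε), hε, hgf])

end uniqueness

end Decoration

namespace PermCycles

theorem eq_or_eq_of_involutive {D : Type} {f : Perm D} (h : ∀ d, f (f d) = d) {x y : D}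
    (hxy : f.SameCycle x y) : y = x ∨ y = f x := by
  obtain ⟨k, rfl⟩ := hxy
  have h2 : f ^ (2 : ℤ) = 1 := by
    ext d
    simp [zpow_ofNat, pow_two, h]
  obtain ⟨l, rfl | rfl⟩ := Int.even_or_odd' k
  · left
    rw [zpow_mul, h2, one_zpow, Perm.one_apply]
  · right
    rw [zpow_add, zpow_mul, h2, one_zpow, one_mul, zpow_one]

end PermCycles

/-! ### Passage between rooted planar maps and rotation systems. -/

namespace RootedPlanarMap

variable {D D' : Type}

/-- The underlying rotation system. -/
def toPre (m : RootedPlanarMap D) : PreMap D where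
  next := m.next
  opp := m.opp
  root := m.root
  opp_opp := m.opp_opp
  opp_ne := m.opp_ne

theorem toPre_connected (m : RootedPlanarMap D) : m.toPre.Connected := by
  have := m.finite
  rintro S ⟨x, hx⟩ h1 h2 y
  obtain ⟨⟨g, hg⟩, rfl⟩ := m.connected.exists_smul_eq x y
  have key : ∀ z, g z ∈ S ↔ z ∈ S := by
    induction hg using Subgroup.closure_induction with
    | mem g hg =>
      rcases hg with rfl | rfl
      · exact apply_mem_iff h1
      · exact apply_mem_iff h2
    | one => exact fun z => Iff.rfl
    | mul g g' _ _ ih ih' => exact fun z => (ih (g' z)).trans (ih' z)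
    | inv g _ ih => exact fun z => by rw [← ih]; simp
  exact (key x).2 hx

theorem toPre_planar (m : RootedPlanarMap D) : m.toPre.Planar := m.planar

theorem iso_iff {m : RootedPlanarMap D} {m' : RootedPlanarMap D'} :
    Iso m m' ↔ ∃ e, m.toPre.IsIso m'.toPre e :=
  ⟨fun ⟨e, h1, h2, h3⟩ => ⟨e, h1, h2, h3⟩, fun ⟨e, h⟩ => ⟨e, h.next, h.opp, h.root⟩⟩

theorem simple_iff (m : RootedPlanarMap D) : m.Simple ↔ m.toPre.Simple := by
  refine and_congr_right fun hl => ⟨fun h x y hxy => ?_, fun h x y h1 h2 => ?_⟩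
  · rcases eq_or_eq_of_involutive m.opp_opp (mk_eq_mk_iff.1 (h x y hxy.1 hxy.2)) with rfl | rfl
    · rfl
    · exact absurd hxy.1 (hl x)
  · rw [h x y ⟨h1, h2⟩]

/-- Not having exactly one shared vertex amounts to having at least two, because connectedness rules
out zero. -/
theorem twoConnected_iff (m : RootedPlanarMap D) : m.TwoConnected ↔ m.toPre.TwoConnected := by
  have hedge : ∀ {x y : D}, m.edgeOf x = m.edgeOf y → y = x ∨ y = m.opp x := fun h =>
    eq_or_eq_of_involutive m.opp_opp (mk_eq_mk_iff.1 h)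
  have hopp : ∀ x, m.edgeOf (m.opp x) = m.edgeOf x := fun x =>
    Quotient.sound (Perm.sameCycle_apply_left.2 (Perm.SameCycle.refl _ _))
  constructor
  · rintro h S hS ⟨x, hx⟩ ⟨y, hy⟩
    by_contra! H
    refine h ⟨m.edgeOf '' S, (m.edgeOf '' S)ᶜ, ⟨_, x, hx, rfl⟩, ⟨m.edgeOf y, ?_⟩,
      disjoint_compl_right, Set.union_compl_self _, ?_⟩
    · rintro ⟨z, hz, hzy⟩
      rcases hedge hzy with rfl | rfl
      · exact hy hz
      · exact hy (hS _ hz)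
    have hmem : ∀ z, m.edgeOf z ∈ m.edgeOf '' S ↔ z ∈ S := by
      refine fun z => ⟨?_, fun hz => ⟨z, hz, rfl⟩⟩
      rintro ⟨w, hw, hwz⟩
      rcases hedge hwz with rfl | rfl
      · exact hw
      · exact hS _ hw
    -- Connectedness gives a vertex where the rotation leaves `S`; this is the shared vertex needed
    -- for separability.
    obtain ⟨z, hz, hz'⟩ : ∃ z ∈ S, m.next z ∉ S := by
      by_contra! h'
      exact hy (m.toPre_connected S ⟨x, hx⟩ h' hS y)
    have hzv : m.vertexOf (m.next z) = m.vertexOf z := m.toPre.vtx_next z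
    refine ⟨m.vertexOf z, ⟨⟨_, ⟨z, hz, rfl⟩, z, rfl, rfl⟩, ⟨m.edgeOf (m.next z), ?_, _, hzv, rfl⟩⟩, ?_⟩
    · exact (not_congr (hmem _)).2 hz'
    · rintro v ⟨⟨e, he, w, rfl, rfl⟩, ⟨e', he', w', hw', rfl⟩⟩
      exact H w w' z (m.next z) ((hmem w).1 he) ((not_congr (hmem w')).1 he') hw'.symm hz hz' hzv.symm
  · rintro h ⟨E₁, E₂, ⟨e₁, he₁⟩, ⟨e₂, he₂⟩, hd, hu, v, -, hv⟩
    induction e₁ using Quotient.inductionOn with | h z₁ => ?_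
    induction e₂ using Quotient.inductionOn with | h z₂ => ?_
    obtain ⟨x, y, x', y', hx, hy, hxy, hx', hy', hxy', hne⟩ := h {x | m.edgeOf x ∈ E₁}
      (fun x hx => by
        rw [Set.mem_ofPred_eq]
        exact (hopp x).symm ▸ hx) ⟨z₁, he₁⟩ ⟨z₂, fun h => Set.disjoint_left.1 hd h he₂⟩
    have hE₂ : ∀ y, m.edgeOf y ∉ E₁ → m.edgeOf y ∈ E₂ := fun y hy =>
      (hu.symm ▸ Set.mem_univ (m.edgeOf y) : m.edgeOf y ∈ E₁ ∪ E₂).resolve_left hy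
    exact hne ((hv (m.vertexOf x) ⟨⟨_, hx, x, rfl, rfl⟩, ⟨_, hE₂ y hy, y, hxy.symm, rfl⟩⟩).trans
      (hv (m.vertexOf x') ⟨⟨_, hx', x', rfl, rfl⟩, ⟨_, hE₂ y' hy', y', hxy'.symm, rfl⟩⟩).symm)

end RootedPlanarMap

namespace PreMap

variable {D : Type}

/-- A connected planar rotation system is a rooted planar map. -/
def toRooted [Finite D] (m : PreMap D) (hc : m.Connected) (hp : m.Planar) : RootedPlanarMap D where
  finite := inferInstance
  next := m.next
  opp := m.opp
  root := m.root
  opp_opp := m.opp_opp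
  opp_ne := m.opp_ne
  connected := by
    refine ⟨fun x y => ?_⟩
    refine hc {y | ∃ g : Subgroup.closure {m.next, m.opp}, g • x = y} ⟨x, 1, one_smul _ _⟩ ?_ ?_ y
    · rintro _ ⟨g, rfl⟩
      exact ⟨⟨m.next, Subgroup.subset_closure (by simp)⟩ * g, mul_smul _ _ _⟩
    · rintro _ ⟨g, rfl⟩
      exact ⟨⟨m.opp, Subgroup.subset_closure (by simp)⟩ * g, mul_smul _ _ _⟩
  planar := hp

/-- A rotation system, transported along a bijection. -/
def transport {D' : Type} (m : PreMap D) (e : D ≃ D') : PreMap D' where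
  next := e.permCongr m.next
  opp := e.permCongr m.opp
  root := e m.root
  opp_opp d := by simp [m.opp_opp]
  opp_ne d h := m.opp_ne (e.symm d) (by
    rw [Equiv.permCongr_apply, ← Equiv.eq_symm_apply] at h
    exact h)

theorem isIso_transport {D' : Type} (m : PreMap D) (e : D ≃ D') : m.IsIso (m.transport e) e :=
  ⟨fun d => by simp [transport], fun d => by simp [transport], rfl⟩

end PreMap

theorem PreMap.opp_out_ne {A : Type} (c : PreMap A) (η η' : PermOrbit c.opp) :
    c.opp (Quotient.out η) ≠ Quotient.out η' := by
  intro h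
  have h1 : η = η' := by
    rw [← Quotient.out_eq η, ← Quotient.out_eq η', ← h]
    exact (mk_eq_mk_iff.2 (Perm.sameCycle_apply_left.2 (Perm.SameCycle.refl _ _))).symm
  rw [h1] at h
  exact c.opp_ne _ h

/-- The orientation of the core of a map given by an isomorphism with the core. -/
noncomputable def CoreOrientation.ofIsIso {D A : Type} [Finite D] {m : PreMap D} (hm : m.Loopless)
    (hc : m.Connected) (hp : m.Planar) {c : PreMap A} {e : m.core ≃ A}
    (he : (PreMap.coreMap hm hc hp).IsIso c e) {P : PermOrbit c.opp → Prop}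
    (hP : ∀ η, P η ↔ m.nextParallel (e.symm (Quotient.out η)) ≠ e.symm (Quotient.out η)) :
    CoreOrientation m {η // P η} where
  o i := e.symm (Quotient.out i.1)
  o_inj i i' h := Subtype.ext (Quotient.out_injective (e.symm.injective (Subtype.ext h)))
  mem i := (e.symm _).2
  cutOpp_ne i i' h := by
    refine c.opp_out_ne i.1 i'.1 (e.symm.injective ?_)
    rw [he.symm.opp]
    exact Subtype.ext h
  nextParallel_ne i := (hP i.1).1 i.2
  exhaustive x hx hne := by
    let η : PermOrbit c.opp := Quotient.mk _ (e ⟨x, hx⟩)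
    have key : x = e.symm (Quotient.out η) ∨ x = m.cutOpp (e.symm (Quotient.out η)) := by
      rcases eq_or_eq_of_involutive c.opp_opp (mk_eq_mk_iff.1 (Quotient.out_eq η)) with h | h
      · left
        rw [← h, Equiv.symm_apply_apply]
      · right
        have h1 := congrArg e.symm h
        rw [he.symm.opp, Equiv.symm_apply_apply] at h1
        exact congrArg Subtype.val h1
    refine ⟨⟨η, (hP η).2 fun h => hne ?_⟩, key⟩
    rcases key with h1 | h1
    · rw [h1, h]
    · rw [h1, PreMap.nextParallel_cutOpp hm hc hp, PreMap.cutOpp, h]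

/-! ### Insertion as a bijection on isomorphism classes. -/

/-- A property of rotation systems. -/
abbrev PreFamily : Type 1 := ∀ D : Type, PreMap D → Prop

namespace PreFamily

/-- The corresponding family of rooted planar maps. -/
def family (p : PreFamily) : RootedPlanarMap.Family := fun D m => p D m.toPre

/-- The isomorphism classes of the rooted planar maps of a family. -/
abbrev Obj (p : PreFamily) : Type := Σ n, RootedPlanarMap.IsoClass p.family n

variable {p q : PreFamily}

noncomputable def rooted (x : Obj p) : RootedPlanarMap (Fin (2 * x.1)) := (Quotient.out x.2).1

/-- A representative of an isomorphism class. -/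
noncomputable def rep (x : Obj p) : PreMap (Fin (2 * x.1)) := (rooted x).toPre

theorem rep_connected (x : Obj p) : (rep x).Connected := (rooted x).toPre_connected

theorem rep_planar (x : Obj p) : (rep x).Planar := (rooted x).toPre_planar

theorem rep_mem (x : Obj p) : p _ (rep x) := (Quotient.out x.2).2

theorem numFaces_eq (x : Obj p) (l : ℕ) :
    x.2.numFaces l = numCyclesOfLength (rep x).face l := by
  conv_lhs => rw [← Quotient.out_eq x.2]
  rfl

theorem eq_of_isIso_rep {x y : Obj p} {e : Fin (2 * x.1) ≃ Fin (2 * y.1)}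
    (h : (rep x).IsIso (rep y) e) : x = y := by
  obtain ⟨n, c⟩ := x
  obtain ⟨n', c'⟩ := y
  obtain rfl : n = n' := by
    have := Fintype.card_congr e
    simp only [Fintype.card_fin] at this
    omega
  congr 1
  rw [← Quotient.out_eq c, ← Quotient.out_eq c']
  exact Quotient.sound (RootedPlanarMap.iso_iff.2 ⟨e, h⟩)

/-- Invariance under isomorphism. -/
def Invariant (p : PreFamily) : Prop :=
  ∀ ⦃D D' : Type⦄ ⦃m : PreMap D⦄ ⦃m' : PreMap D'⦄ ⦃e : D ≃ D'⦄, m.IsIso m' e → p D m → p D' m'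

theorem exists_isIso_rep (hp : p.Invariant) {D : Type} [Finite D] {m : PreMap D} (hc : m.Connected)
    (hpl : m.Planar) (hm : p D m) : ∃ (x : Obj p) (e : D ≃ Fin (2 * x.1)), m.IsIso (rep x) e := by
  have h2 := two_mul_numCycles_of_involutive m.opp_opp m.opp_ne
  set n := numCycles m.opp
  let e : D ≃ Fin (2 * n) := (Finite.equivFin D).trans (finCongr h2.symm)
  have he := m.isIso_transport e
  let M : {m : RootedPlanarMap (Fin (2 * n)) // p.family _ m} :=
    ⟨(m.transport e).toRooted (he.connected hc) (he.planar hpl), hp he hm⟩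
  let x : Obj p := ⟨n, Quotient.mk _ M⟩
  have hx : RootedPlanarMap.Iso M.1 (rooted x) := Quotient.exact (Quotient.out_eq x.2).symm
  obtain ⟨e', he'⟩ := RootedPlanarMap.iso_iff.1 hx
  exact ⟨x, e.trans e', he.trans he'⟩

/-- The edges of a map. -/
abbrev Edges (x : Obj q) : Type := PermOrbit (rep x).opp

theorem card_edges (x : Obj q) : Nat.card (Edges x) = x.1 := by
  have := two_mul_numCycles_of_involutive (rep x).opp_opp (rep x).opp_ne
  rw [Nat.card_fin] at this
  change numCycles (rep x).opp = x.1
  omega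

/-- The size of what replaces an edge. -/
def slotSize (o : Option (Obj p)) : ℕ := 1 + o.elim 0 fun x => x.1

/-- The two families `p` and `q` are related by insertion of maps of `p` in maps of `q`. -/
structure Insertable (p q : PreFamily) : Prop where
  invariant : p.Invariant
  invariant' : q.Invariant
  loopless : ∀ {D : Type} {m : PreMap D}, p D m → m.Loopless
  simple : ∀ {D : Type} {m : PreMap D}, q D m → m.Simple
  glue_iff : ∀ {A K : Type} {Y : K → Type} {c : PreMap A} (d : Decoration c Y) [Finite A]
    [Finite K] [∀ i, Finite (Y i)], c.Simple → (∀ i, (d.n i).Loopless) →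
    (p _ d.glue ↔ q _ c ∧ ∀ i, p _ (d.n i))

/-- A map of the family `q` with maps of the family `p` to be inserted in some of its edges. -/
abbrev Decorated (p q : PreFamily) : Type := Σ x : Obj q, Edges x → Option (Obj p)

namespace Insertable

variable (h : Insertable p q)
include h

/-- The decoration that corresponds to a choice of inserted maps. -/
noncomputable def decoration (t : Decorated p q) :
    Decoration (rep t.1) fun i : {η : Edges t.1 // (t.2 η).isSome} =>
      Fin (2 * ((t.2 i.1).get i.2).1) where
  -- `Quotient.out` orients every edge of the representative once and for all, so the inserted root
  -- has a definite direction. `CoreOrientation.ofIsIso` makes the same choice.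
  o i := Quotient.out i.1
  o_inj _ _ hi := Subtype.ext (Quotient.out_injective hi)
  opp_o_ne i i' := (rep t.1).opp_out_ne i.1 i'.1
  n i := rep ((t.2 i.1).get i.2)
  root_sep _ := h.loopless (rep_mem _) _

theorem decoration_loopless (t : Decorated p q) (i) : ((h.decoration t).n i).Loopless :=
  h.loopless (rep_mem _)

theorem core_simple (t : Decorated p q) : (rep t.1).Simple := h.simple (rep_mem t.1)

theorem exists_obj (t : Decorated p q) :
    ∃ (x : Obj p) (e : _ ≃ Fin (2 * x.1)), (h.decoration t).glue.IsIso (rep x) e := by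
  refine exists_isIso_rep h.invariant ?_ ?_ ?_
  · exact (h.decoration t).connected_glue (rep_connected _) fun i => rep_connected _
  · exact ((h.decoration t).planar_glue_iff fun i => rep_planar _).2 (rep_planar _)
  · exact (h.glue_iff (h.decoration t) (h.core_simple t) (h.decoration_loopless t)).2
      ⟨rep_mem _, fun i => rep_mem _⟩

/-- The map obtained by inserting the chosen maps. -/
noncomputable def obj (t : Decorated p q) : Obj p := (h.exists_obj t).choose

theorem isIso_obj (t : Decorated p q) :
    ∃ e : _ ≃ Fin (2 * (h.obj t).1), (h.decoration t).glue.IsIso (rep (h.obj t)) e :=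
  (h.exists_obj t).choose_spec

omit h in
theorem prod_isSome {E S M : Type} [Fintype E] [CommMonoid M] (f : E → Option S) (g : S → M)
    [Fintype {η // (f η).isSome}] :
    ∏ i : {η // (f η).isSome}, g ((f i.1).get i.2) = ∏ η, (f η).elim 1 g := by
  classical
  have h1 : ∀ i : {η // (f η).isSome}, g ((f i.1).get i.2) = (f i.1).elim 1 g := by
    rintro ⟨η, hη⟩
    obtain ⟨x, hx⟩ := Option.isSome_iff_exists.1 hη
    simp [hx]
  rw [Finset.prod_congr rfl fun i _ => h1 i,
    ← Finset.prod_subtype (Finset.univ.filter fun η => (f η).isSome) (by simp)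
      (fun η => (f η).elim 1 g)]
  refine Finset.prod_filter_of_ne fun η _ hη => ?_
  cases hf : f η with
  | none => simp [hf] at hη
  | some x => rfl

omit h in
theorem sum_isSome {E S : Type} [Fintype E] (f : E → Option S) (g : S → ℕ)
    [Fintype {η // (f η).isSome}] :
    ∑ i : {η // (f η).isSome}, g ((f i.1).get i.2) = ∑ η, (f η).elim 0 g :=
  prod_isSome (M := Multiplicative ℕ) f g

theorem size_obj (t : Decorated p q) [Fintype (Edges t.1)] :
    (h.obj t).1 = ∑ η, slotSize (t.2 η) := by
  classical
  obtain ⟨e, -⟩ := h.isIso_obj t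
  have h1 := Nat.card_congr e
  simp only [Nat.card_sum, Nat.card_sigma, Nat.card_fin] at h1
  rw [← Finset.mul_sum, sum_isSome t.2 fun x => x.1] at h1
  simp only [slotSize, Finset.sum_add_distrib]
  have h2 := card_edges t.1
  rw [Nat.card_eq_fintype_card] at h2
  simp only [Finset.sum_const, Finset.card_univ, smul_eq_mul, mul_one, h2]
  omega

theorem numFaces_obj (t : Decorated p q) [Fintype (Edges t.1)] (l : ℕ) :
    (h.obj t).2.numFaces l = t.1.2.numFaces l + ∑ η, (t.2 η).elim 0 fun x => x.2.numFaces l := by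
  classical
  obtain ⟨e, he⟩ := h.isIso_obj t
  have h1 : numCyclesOfLength (h.decoration t).glue.face l =
      numCyclesOfLength (rep (h.obj t)).face l := numCyclesOfLength_congr e he.face l
  rw [numFaces_eq, ← h1, Decoration.numCyclesOfLength_face, ← sum_isSome t.2 fun x => x.2.numFaces l]
  congr 1
  · exact (numFaces_eq t.1 l).symm
  · exact Finset.sum_congr rfl fun i _ => (numFaces_eq _ l).symm

/-- An isomorphism that fixes the core pointwise matches marks with marks on the same edge, with the
same orientation, and hence the maps inserted there. -/
theorem some_of_isIso {b : Obj q} {f f' : Edges b → Option (Obj p)}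
    {e : _ ≃ _} (he : (h.decoration ⟨b, f⟩).glue.IsIso (h.decoration ⟨b, f'⟩).glue e)
    (heA : ∀ a, e (.inl a) = .inl a) (η : Edges b) (x : Obj p) (hx : f η = some x) :
    f' η = some x := by
  have hs := h.core_simple ⟨b, f⟩
  have hL := h.decoration_loopless ⟨b, f⟩
  have hL' := h.decoration_loopless ⟨b, f'⟩
  let i : {η // (f η).isSome} := ⟨η, by simp [hx]⟩
  obtain ⟨⟨i', ε'⟩, hi'⟩ := (h.decoration ⟨b, f⟩).exists_coreMark_of_isIso (h.decoration ⟨b, f'⟩) he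
    hs hL hs hL' (p := (i, true)) (heA _)
  have hη : i'.1 = η := by
    have h1 : (Quotient.mk _ ((h.decoration ⟨b, f'⟩).coreMark (i', ε')) : Edges b) = i'.1 := by
      rcases ε' with _ | _
      · refine Eq.trans ?_ (Quotient.out_eq i'.1)
        exact mk_eq_mk_iff.2 (Perm.sameCycle_apply_left.2 (Perm.SameCycle.refl _ _))
      · exact Quotient.out_eq i'.1
    rw [← h1, hi']
    exact Quotient.out_eq η
  obtain ⟨eY, heY⟩ := (h.decoration ⟨b, f⟩).exists_inner_iso (h.decoration ⟨b, f'⟩) he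
    hs hL hs hL' (i := i) (i' := i') (rep_connected _) (rep_connected _) (by
      intro ε
      rw [heA]
      congr 1
      have : (h.decoration ⟨b, f'⟩).o i' = (h.decoration ⟨b, f⟩).o i := congrArg Quotient.out hη
      cases ε
      · exact congrArg (rep b).opp this.symm
      · exact this.symm)
  have h2 : (f η).get i.2 = (f' i'.1).get i'.2 := eq_of_isIso_rep heY
  have h3 : f' i'.1 = some ((f' i'.1).get i'.2) := (Option.some_get _).symm
  rw [← hη, h3, ← h2]
  simp [hx]

theorem exists_isIso_of_obj_eq {t t' : Decorated p q} (ht : h.obj t = h.obj t') :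
    ∃ e, (h.decoration t).glue.IsIso (h.decoration t').glue e := by
  obtain ⟨e, he⟩ := h.isIso_obj t
  have h1 := h.isIso_obj t'
  rw [← ht] at h1
  obtain ⟨e', he'⟩ := h1
  exact ⟨_, he.trans he'.symm⟩

/-- Isomorphic results have isomorphic cores, hence the same representative. The isomorphism is then
the identity on the core by rigidity of rooted maps, so the decorations agree edge by edge. -/
theorem obj_injective : Function.Injective h.obj := by
  rintro ⟨b, f⟩ ⟨b', f'⟩ hobj
  obtain ⟨e, he⟩ := h.exists_isIso_of_obj_eq hobj
  obtain ⟨eA, hA, heA⟩ := (h.decoration ⟨b, f⟩).exists_core_iso (h.decoration ⟨b', f'⟩) he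
    (h.core_simple ⟨b, f⟩) (rep_connected b) (h.decoration_loopless ⟨b, f⟩)
    (h.core_simple ⟨b', f'⟩) (rep_connected b') (h.decoration_loopless ⟨b', f'⟩)
  obtain rfl : b = b' := eq_of_isIso_rep hA
  have heA' : ∀ a, e (.inl a) = .inl a := fun a => by rw [heA, hA.apply_eq_self (rep_connected b)]
  have heA'' : ∀ a, e.symm (.inl a) = .inl a := fun a => by
    rw [Equiv.symm_apply_eq, heA']
  congr 1
  funext η
  exact Option.ext fun x => ⟨h.some_of_isIso he heA' η x, h.some_of_isIso he.symm heA'' η x⟩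

theorem obj_surjective : Function.Surjective h.obj := by
  classical
  intro x
  have hm := h.loopless (rep_mem x)
  have hc := rep_connected x
  have hp := rep_planar x
  have hs := PreMap.coreMap_simple hm hc hp
  have hglue : ∀ {K : Type} [Finite K] (O : CoreOrientation (rep x) K),
      q _ (PreMap.coreMap hm hc hp) ∧ ∀ i, p _ ((O.decoration hm hc hp).n i) := fun O =>
    (h.glue_iff (O.decoration hm hc hp) hs fun i => (O.bigon i).inner_loopless hm hc hp).1
      (h.invariant (O.isIso_glue hm hc hp).symm (rep_mem x))
  -- A first orientation, on the core itself, shows that the core is planar and belongs to `q`. Only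
  -- then is there a representative `b`, whose edges index the final decoration.
  let O₀ := CoreOrientation.ofIsIso hm hc hp (c := PreMap.coreMap hm hc hp) (e := Equiv.refl _)
    ⟨fun _ => rfl, fun _ => rfl, rfl⟩ fun η => Iff.rfl
  obtain ⟨b, eC, heC⟩ := exists_isIso_rep h.invariant' (PreMap.coreMap_connected hm hc hp)
    (O₀.coreMap_planar hm hc hp) (hglue O₀).1
  let P : Edges b → Prop := fun η =>
    (rep x).nextParallel (eC.symm (Quotient.out η)) ≠ eC.symm (Quotient.out η)
  let O : CoreOrientation (rep x) {η // P η} :=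
    CoreOrientation.ofIsIso hm hc hp heC fun η => Iff.rfl
  choose y eY heY using fun i => exists_isIso_rep h.invariant
    ((O.bigon i).inner_connected hm hc hp) ((O.bigon i).inner_planar hm hc hp) ((hglue O).2 i)
  let f : Edges b → Option (Obj p) := fun η => if hη : P η then some (y ⟨η, hη⟩) else none
  have hf : ∀ η, (f η).isSome ↔ P η := fun η => by
    by_cases hη : P η <;> simp [f, hη]
  -- The orientation `O` reindexed by the edges where `f` is defined, as the definition of
  -- `h.decoration` requires.
  let O' : CoreOrientation (rep x) {η // (f η).isSome} :=
    CoreOrientation.ofIsIso hm hc hp heC hf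
  have key : ∀ i : {η // (f η).isSome}, ∃ e : _ ≃ Fin (2 * ((f i.1).get i.2).1),
      ((O'.decoration hm hc hp).n i).IsIso (rep ((f i.1).get i.2)) e := by
    intro i
    have h1 : (f i.1).get i.2 = y ⟨i.1, (hf i.1).1 i.2⟩ := by
      simp [f, (hf i.1).1 i.2]
    rw [h1]
    exact ⟨eY ⟨i.1, (hf i.1).1 i.2⟩, heY ⟨i.1, (hf i.1).1 i.2⟩⟩
  choose eZ heZ using key
  have h2 := (O'.decoration hm hc hp).glue_congr (h.decoration ⟨b, f⟩) heC
    (fun i => eC.apply_symm_apply _) eZ heZ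
  obtain ⟨e, he⟩ := h.isIso_obj ⟨b, f⟩
  exact ⟨⟨b, f⟩, (eq_of_isIso_rep ((O'.isIso_glue hm hc hp).symm.trans (h2.trans he))).symm⟩

end Insertable

end PreFamily

/-! ### Generating series of weighted classes: sums, powers and substitution. -/

/-- The power series is the generating series of the objects of a weighted class. -/
def IsGenSeries {R T : Type} [CommRing R] (A : PowerSeries R) (size : T → ℕ) (w : T → R) : Prop :=
  ∃ G : ℕ → Finset T, (∀ n t, t ∈ G n ↔ size t = n) ∧ ∀ n, A.coeff n = ∑ t ∈ G n, w t

namespace IsGenSeries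

variable {R S T : Type} [CommRing R] {A B C : PowerSeries R} {size : T → ℕ} {w : T → R}

theorem eq_of_bijective (hA : IsGenSeries A size w) {size' : S → ℕ} {w' : S → R}
    (hB : IsGenSeries B size' w') {φ : S → T} (hφ : Function.Bijective φ)
    (hs : ∀ s, size (φ s) = size' s) (hw : ∀ s, w (φ s) = w' s) : A = B := by
  obtain ⟨G, hG, hA⟩ := hA
  obtain ⟨H, hH, hB⟩ := hB
  ext n
  rw [hA, hB]
  symm
  refine Finset.sum_nbij φ (fun s h => ?_) hφ.1.injOn (fun t h => ?_) fun s _ => (hw s).symm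
  · rw [hG, hs, ← hH]
    exact h
  · obtain ⟨s, rfl⟩ := hφ.2 t
    rw [Finset.mem_coe, hG, hs, ← hH] at h
    exact ⟨s, h, rfl⟩

/-- The factor `X` counts the carrying edge; `none` is the edge left alone, of size 1. -/
theorem X_mul_one_add (hA : IsGenSeries A size w) :
    IsGenSeries (PowerSeries.X * (1 + A)) (fun o : Option T => 1 + o.elim 0 size)
      (fun o => o.elim 1 w) := by
  classical
  obtain ⟨G, hG, hA⟩ := hA
  refine ⟨fun n => n.casesOn ∅ fun n =>
    (if n = 0 then {none} else ∅) ∪ (G n).map Function.Embedding.some, fun n o => ?_, fun n => ?_⟩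
  · cases n with
    | zero => simp
    | succ n =>
      cases o with
      | none =>
        by_cases h : n = 0
        · simp [h]
        · simp [h]
      | some t =>
        by_cases h : n = 0
        · simp [h, hG]
        · simp [h, hG, add_comm]
  · cases n with
    | zero => simp
    | succ n =>
      rw [PowerSeries.coeff_succ_X_mul, map_add, hA, Finset.sum_union, Finset.sum_map]
      · congr 1
        rw [PowerSeries.coeff_one]
        split_ifs <;> simp
      · split_ifs <;> simp

theorem pow (hA : IsGenSeries A size w) {E : Type} [Fintype E] :
    IsGenSeries (A ^ Fintype.card E) (fun f : E → T => ∑ η, size (f η)) fun f => ∏ η, w (f η) := by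
  classical
  obtain ⟨G, hG, hA⟩ := hA
  refine ⟨fun n => (Finset.univ.finsuppAntidiag n).biUnion fun l : E →₀ ℕ =>
    Fintype.piFinset fun η => G (l η), fun n f => ?_, fun n => ?_⟩
  · simp only [Finset.mem_biUnion, Finset.mem_finsuppAntidiag, Fintype.mem_piFinset, hG]
    constructor
    · rintro ⟨l, ⟨h, -⟩, hl⟩
      rw [← h]
      exact Finset.sum_congr rfl fun η _ => hl η
    · intro h
      exact ⟨Finsupp.equivFunOnFinite.symm fun η => size (f η), ⟨h, Finset.subset_univ _⟩,
        fun η => rfl⟩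
  · rw [← Finset.card_univ, ← Finset.prod_const, PowerSeries.coeff_prod, Finset.sum_biUnion]
    · refine Finset.sum_congr rfl fun l _ => ?_
      simp only [hA]
      rw [Finset.prod_univ_sum]
    · intro l _ l' _ hl
      refine Finset.disjoint_left.2 fun f h h' => hl ?_
      ext η
      rw [← (hG _ _).1 (Fintype.mem_piFinset.1 h η), ← (hG _ _).1 (Fintype.mem_piFinset.1 h' η)]

/-- The bound `hle` leaves only outer objects of size at most `n` in degree `n`; on the series side,
`X ^ d` divides `B ^ d`, so the terms with `d > n` vanish. -/
theorem subst (hC : IsGenSeries C size w) (hB : PowerSeries.constantCoeff B = 0) {F : T → Type}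
    {size' : ∀ t, F t → ℕ} {w' : ∀ t, F t → R}
    (hF : ∀ t, IsGenSeries (B ^ size t) (size' t) (w' t)) (hle : ∀ t f, size t ≤ size' t f) :
    IsGenSeries (PowerSeries.subst B C) (fun x : Σ t, F t => size' x.1 x.2)
      fun x => w x.1 * w' x.1 x.2 := by
  classical
  obtain ⟨G, hG, hC⟩ := hC
  choose H hH hF using hF
  refine ⟨fun n => ((Finset.range (n + 1)).biUnion G).sigma fun t => H t n, ?_, fun n => ?_⟩
  · rintro n ⟨t, f⟩
    simp only [Finset.mem_sigma, Finset.mem_biUnion, Finset.mem_range, hG, hH]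
    constructor
    · exact fun h => h.2
    · exact fun h => ⟨⟨size t, Nat.lt_succ_of_le (h ▸ hle t f), rfl⟩, h⟩
  · rw [PowerSeries.coeff_subst' (PowerSeries.HasSubst.of_constantCoeff_zero' hB),
      finsum_eq_sum_of_support_subset (s := Finset.range (n + 1)), Finset.sum_sigma,
      Finset.sum_biUnion]
    · refine Finset.sum_congr rfl fun d _ => ?_
      rw [hC, smul_eq_mul, Finset.sum_mul]
      refine Finset.sum_congr rfl fun t ht => ?_
      rw [← (hG d t).1 ht, hF, Finset.mul_sum]
    · intro d _ d' _ hd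
      refine Finset.disjoint_left.2 fun t h h' => hd ?_
      rw [← (hG _ _).1 h, ← (hG _ _).1 h']
    · intro d hd
      rw [Finset.mem_coe, Finset.mem_range]
      by_contra hlt
      refine hd ?_
      change _ • _ = _
      rw [PowerSeries.X_pow_dvd_iff.1 (pow_dvd_pow_of_dvd (PowerSeries.X_dvd_iff.2 hB) d) n
        (by omega), smul_zero]

end IsGenSeries

/-! ### The functional equation and its two instances. -/

namespace PreFamily

open RootedPlanarMap

variable {p q : PreFamily}

/-- The weight of an isomorphism class in the generating series. -/
noncomputable def weight (L : Finset ℕ) (x : Obj p) : MvPolynomial L ℤ :=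
  ∏ l : L, MvPolynomial.X l ^ x.2.numFaces l

theorem isGenSeries_faceSeries (p : PreFamily) (L : Finset ℕ) :
    IsGenSeries (faceSeries p.family L) (fun x : Obj p => x.1) (weight L) := by
  refine ⟨fun n => Finset.univ.map (Function.Embedding.sigmaMk n), ?_, fun n => ?_⟩
  · rintro n ⟨k, c⟩
    simp only [Finset.mem_map, Finset.mem_univ, true_and]
    constructor
    · rintro ⟨c', h⟩
      exact (congrArg Sigma.fst h).symm
    · rintro rfl
      exact ⟨c, rfl⟩
  · rw [faceSeries, PowerSeries.coeff_mk, Finset.sum_map]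
    rfl

namespace Insertable

theorem weight_obj (h : Insertable p q) (L : Finset ℕ) (t : Decorated p q)
    [Fintype (Edges t.1)] :
    weight L (h.obj t) = weight L t.1 * ∏ η, (t.2 η).elim 1 (weight L) := by
  simp only [weight, h.numFaces_obj, pow_add, Finset.prod_mul_distrib]
  congr 1
  simp only [← Finset.prod_pow_eq_pow_sum]
  rw [Finset.prod_comm]
  refine Finset.prod_congr rfl fun η _ => ?_
  cases t.2 η <;> simp [weight]

/-- The right-hand side counts cores with an optional map on each edge, and `h.obj` is a bijection
from these onto the maps of `p` that respects size and weight. -/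
theorem faceSeries_eq_subst (h : Insertable p q) (L : Finset ℕ) :
    faceSeries p.family L =
      PowerSeries.subst (PowerSeries.X * (1 + faceSeries p.family L)) (faceSeries q.family L) := by
  classical
  have : ∀ x : Obj q, Fintype (Edges x) := fun x => Fintype.ofFinite _
  have hE : ∀ x : Obj q, Fintype.card (Edges x) = x.1 := fun x => by
    rw [← Nat.card_eq_fintype_card, card_edges]
  have hp := isGenSeries_faceSeries p L
  have hF : ∀ x : Obj q, IsGenSeries ((PowerSeries.X * (1 + faceSeries p.family L)) ^ x.1)
      (fun f : Edges x → Option (Obj p) => ∑ η, slotSize (f η))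
      (fun f => ∏ η, (f η).elim 1 (weight L)) := fun x => by
    rw [← hE x]
    exact hp.X_mul_one_add.pow
  have hle : ∀ (x : Obj q) (f : Edges x → Option (Obj p)), x.1 ≤ ∑ η, slotSize (f η) :=
    fun x f => by
      simp only [slotSize, Finset.sum_add_distrib, Finset.sum_const, Finset.card_univ, hE,
        smul_eq_mul, mul_one, Nat.le_add_right]
  have hS := (isGenSeries_faceSeries q L).subst (by simp) hF hle
  exact hp.eq_of_bijective hS ⟨h.obj_injective, h.obj_surjective⟩ (fun t => h.size_obj t)
    fun t => h.weight_obj L t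

end Insertable

theorem insertable_loopless : Insertable (fun _ m => m.Loopless) (fun _ m => m.Simple) where
  invariant _ _ _ _ _ he := he.loopless
  invariant' _ _ _ _ _ he := he.simple
  loopless := id
  simple := id
  glue_iff d _ _ _ hs hn := ⟨fun _ => ⟨hs, hn⟩, fun _ => d.loopless_glue hs.1 hn⟩

/-- The loopless bijection restricted to 2-connected maps: 2-connectedness passes both ways between
a glued map and its pieces, with the looplessness of the core used throughout except to descend to
the core. -/
theorem insertable_twoConnected : Insertable (fun _ m => m.TwoConnected ∧ m.Loopless)
    (fun _ m => m.TwoConnected ∧ m.Simple) where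
  invariant _ _ _ _ _ he := And.imp he.twoConnected he.loopless
  invariant' _ _ _ _ _ he := And.imp he.twoConnected he.simple
  loopless h := h.2
  simple h := h.2
  glue_iff d _ _ _ hs hn :=
    ⟨fun h => ⟨⟨d.twoConnected_core h.1, hs⟩, fun i => ⟨d.twoConnected_inserted hs.1 h.1 i, hn i⟩⟩,
      fun h => ⟨d.twoConnected_glue hs.1 h.1.1 fun i => (h.2 i).1, d.loopless_glue hs.1 hn⟩⟩

end PreFamily

namespace RootedPlanarMap

theorem seriesM3_eq (L : Finset ℕ) :
    seriesM3 L = faceSeries (PreFamily.family fun _ m => m.Simple) L := by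
  rw [seriesM3]
  congr 1
  funext D m
  exact propext m.simple_iff

theorem seriesM4_eq (L : Finset ℕ) :
    seriesM4 L = faceSeries (PreFamily.family fun _ m => m.TwoConnected ∧ m.Loopless) L := by
  rw [seriesM4]
  congr 1
  funext D m
  exact propext (and_congr m.twoConnected_iff Iff.rfl)

theorem seriesM5_eq (L : Finset ℕ) :
    seriesM5 L = faceSeries (PreFamily.family fun _ m => m.TwoConnected ∧ m.Simple) L := by
  rw [seriesM5]
  congr 1
  funext D m
  exact propext (and_congr m.twoConnected_iff m.simple_iff)

end RootedPlanarMap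

end

theorem mainTheorem8 (L : Finset ℕ) (hL : ∀ l ∈ L, 0 < l) :
    RootedPlanarMap.seriesM2l L =
        PowerSeries.subst (PowerSeries.X * (1 + RootedPlanarMap.seriesM2l L))
          (RootedPlanarMap.seriesM3 L) ∧
      RootedPlanarMap.seriesM4 L =
        PowerSeries.subst (PowerSeries.X * (1 + RootedPlanarMap.seriesM4 L))
          (RootedPlanarMap.seriesM5 L) := by
  rw [RootedPlanarMap.seriesM3_eq, RootedPlanarMap.seriesM4_eq, RootedPlanarMap.seriesM5_eq]
  exact ⟨PreFamily.insertable_loopless.faceSeries_eq_subst L,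
    PreFamily.insertable_twoConnected.faceSeries_eq_subst L⟩
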